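/- **Setting.** Let $\phi^A=(A^i,C^{\alpha a},B^\alpha)$, $a=1,2$, be finitely many fields (condensed notation: $i=1,\dots,n$, $\alpha=1,\dots,m$) with Grassmann parities $\varepsilon_A=(\varepsilon_i,\varepsilon_\alpha+1,\varepsilon_\alpha)$. Functionals are elements of $C^\infty(\mathbb R^p,\mathbb C)\otimes\Lambda$, where $p$ is the number of even fields and $\Lambda$ is the Grassmann algebra generated by the odd fields and by finitely many constant odd parameters; $G_{,A}=\delta G/\delta\phi^A$ is the right derivative. Let $R^i_\alpha(A)$, of parity $\varepsilon_i+\varepsilon_\alpha$, generate a closed gauge algebra $$R^i_{\alpha,j}R^j_\beta-(-1)^{\varepsilon_\alpha\varepsilon_\beta}R^i_{\beta,j}R^j_\alpha=-R^i_\gamma F^\gamma_{\alpha\beta},\qquad F^\gamma_{\alpha\beta}=-(-1)^{\varepsilon_\alpha\varepsilon_\beta}F^\gamma_{\beta\alpha},$$ where the $F^\gamma_{\alpha\beta}$ are constants, vanish unless $\varepsilon_\gamma=\varepsilon_\alpha+\varepsilon_\beta$, and satisfy the (graded) Jacobi identity; assume that the integration measure is invariant, $$\sum_i(-1)^{\varepsilon_i(\varepsilon_\alpha+1)}R^i_{\alpha,i}+\sum_\beta(-1)^{\varepsilon_\beta}F^\beta_{\alpha\beta}=0\quad\text{for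 all }\alpha$$ (in Yang–Mills theories both sums vanish, because the structure constants are completely antisymmetric). $\mathrm{Sp}(2)$ indices are moved by $\varepsilon^{ab}=-\varepsilon^{ba}$, $\varepsilon^{12}=1$, $\varepsilon^{ac}\varepsilon_{cb}=\delta^a_b$ (so $s_a=\varepsilon_{ab}s^b$, $\lambda^a=\varepsilon^{ab}\lambda_b$). The BRST-antiBRST generators are $s^aG=G_{,A}X^{Aa}$ with $X^{Aa}=s^a\phi^A$ given by $$s^aA^i=R^i_\alpha C^{\alpha a},\qquad s^aC^{\alpha b}=-\varepsilon^{ab}B^\alpha-\tfrac12(-1)^{\varepsilon_\beta}F^\alpha_{\beta\gamma}C^{\gamma b}C^{\beta a},$$ $$s^aB^\alpha=-\tfrac12F^\alpha_{\gamma\beta}B^\beta C^{\gamma a}-\tfrac1{12}(-1)^{\varepsilon_\beta}F^\alpha_{\gamma\sigma}F^\sigma_{\beta\rho}C^{\rho b}C^{\beta a}C^{\gamma c}\varepsilon_{cb},$$ and $Y^A$ has the components $Y^i=R^i_\alpha B^\alpha+\frac12(-1)^{\varepsilon_\alpha}R^i_{\alpha,j}R^j_\beta C^{\beta b}C^{\alpha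 a}\varepsilon_{ab}$ (for $A^i$), $-2s^aB^\alpha$ (for $C^{\alpha a}$), and $0$ (for $B^\alpha$). Put $s^2=\varepsilon_{ab}s^bs^a=s^1s^2-s^2s^1$ and $\lambda^2=\lambda_a\lambda^a$. For odd functionals $\lambda_a(\phi)$ let $$\Delta\phi^A=X^{Aa}\lambda_a-\tfrac12Y^A\lambda^2,\qquad M^A_B=\frac{\delta(\Delta\phi^A)}{\delta\phi^B},\qquad \Im=\mathrm{Str}\ln(\mathbb I+M)=-\sum_{n\ge1}\frac{(-1)^n}{n}\mathrm{Str}(M^n),\qquad m^a_b=s^a\lambda_b,$$ with $\mathrm{Str}\,N=\sum_A(-1)^{\varepsilon_A}N^A_A$. **Claim.** 1. For arbitrary odd $\lambda_a$, $$\Im=-\mathrm{tr}\ln(e+m)=\sum_{n\ge1}\frac{(-1)^n}{n}\mathrm{tr}(m^n),$$ where $e$ is the $2\times2$ unit matrix. This holds as an identity of expansions in powers of $\lambda_a$ (that is, of formal power series in $t$ after $\lambda_a\to t\lambda_a$). It also holds for the series themselves, which both converge at every point of the even field space at which all eigenvalues of the numerical part of $m$ have modulus less than $1$. Moreover, in the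 expansion in powers of $\lambda_a$, $e+m$ is invertible and $$s^a\Im=-(s^am^b_c)\,[(e+m)^{-1}]^c_b .$$ 2. If $\lambda_a=s_a\Lambda$ with an even functional $\Lambda$, then $\lambda_a$ is odd, $m^a_b=-\frac12\delta^a_b\,s^2\Lambda$, and $$\Im=-2\ln\bigl(1-\tfrac12s^2\Lambda\bigr)=\ln\bigl(1-\tfrac12s^2\Lambda\bigr)^{-2},$$ both in powers of $\Lambda$ and as convergent series wherever the numerical part of $\frac12s^2\Lambda$ has modulus less than $1$ (here $\ln(1+f)=-\sum_{n\ge1}\frac{(-1)^n}{n}f^n$); the expansion of $\Im$ in powers of $\Lambda$ satisfies $s^a\Im=0$. 3. In general $\Im$ is not BRST-antiBRST-invariant: if some $\varepsilon_\alpha=0$ and there is at least one constant odd parameter, then there are odd functionals $\lambda_a$ such that $s^a\Im\neq0$ for some $a$ (for the expansion of $\Im$ in powers of $\lambda_a$). -/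

import Mathlib

noncomputable section

open scoped TensorProduct ContDiff

namespace BRST

/-! ### Superfunctions

`Φ` is a finite index set of coordinates `φ^A` with Grassmann parities `ε A`, and `η` indexes
additional constant odd Grassmann parameters.  A superfunction is an element of
`C^∞(ℝ^p, ℂ) ⊗ Λ`, where `p` is the number of even coordinates and `Λ` is the Grassmann algebra
generated by the odd coordinates and the constant odd parameters. -/

section Superspace

variable {Φ : Type*}

/-- The sign `(-1)^p` of a parity `p`. -/
def sgn (p : ZMod 2) : ℂ := if p = 0 then 1 else -1

/-- Indices of the even (commuting) coordinates. -/
abbrev EvenIx (ε : Φ → ZMod 2) : Type _ := {A : Φ // ε A = 0}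

/-- Indices of the generators of the Grassmann algebra: odd coordinates and odd constants. -/
abbrev OddIx (ε : Φ → ZMod 2) (η : Type*) : Type _ := {A : Φ // ε A ≠ 0} ⊕ η

/-- The points of the underlying even space. -/
abbrev Pt (ε : Φ → ZMod 2) : Type _ := EvenIx ε → ℝ

/-- Smooth complex-valued functions of the even coordinates. -/
def SmoothFn [Fintype Φ] (ε : Φ → ZMod 2) : Subalgebra ℂ (Pt ε → ℂ) where
  carrier := {f | ContDiff ℝ ∞ f}
  mul_mem' {f g} (hf : ContDiff ℝ ∞ f) (hg : ContDiff ℝ ∞ g) :=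
    show ContDiff ℝ ∞ (fun x => f x * g x) from hf.mul hg
  add_mem' {f g} (hf : ContDiff ℝ ∞ f) (hg : ContDiff ℝ ∞ g) :=
    show ContDiff ℝ ∞ (fun x => f x + g x) from hf.add hg
  algebraMap_mem' c := show ContDiff ℝ ∞ (fun _ : Pt ε => c) from contDiff_const

theorem contDiff_smoothFn [Fintype Φ] {ε : Φ → ZMod 2} (f : SmoothFn ε) : ContDiff ℝ ∞ f.1 := f.2

theorem differentiable_smoothFn [Fintype Φ] {ε : Φ → ZMod 2} (f : SmoothFn ε) :
    Differentiable ℝ f.1 :=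
  (contDiff_smoothFn f).differentiable (by simp)

/-- The Grassmann algebra generated by the odd coordinates and the odd constants. -/
abbrev Grass (ε : Φ → ZMod 2) (η : Type*) : Type _ := ExteriorAlgebra ℂ (OddIx ε η → ℂ)

variable [Fintype Φ] [DecidableEq Φ]

/-- The algebra of superfunctions. -/
abbrev SuperFn (ε : Φ → ZMod 2) (η : Type*) : Type _ := SmoothFn ε ⊗[ℂ] Grass ε η

/-! Shortcuts for instance search. -/

instance instRingSuperFn (ε : Φ → ZMod 2) (η : Type*) : Ring (SuperFn ε η) :=
  Algebra.TensorProduct.instRing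

instance instAlgebraSuperFn (ε : Φ → ZMod 2) (η : Type*) : Algebra ℂ (SuperFn ε η) :=
  Algebra.TensorProduct.leftAlgebra

instance instAddCommGroupSuperFn (ε : Φ → ZMod 2) (η : Type*) : AddCommGroup (SuperFn ε η) :=
  (instRingSuperFn ε η).toAddCommGroup

instance instAddGroupSuperFn (ε : Φ → ZMod 2) (η : Type*) : AddGroup (SuperFn ε η) :=
  (instAddCommGroupSuperFn ε η).toAddGroup

variable {ε : Φ → ZMod 2} {η : Type*} [DecidableEq η]

/-- The partial derivative of a smooth function of the even coordinates. -/
def pderivSmooth (i : EvenIx ε) : SmoothFn ε →ₗ[ℂ] SmoothFn ε where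
  toFun f := ⟨fun x => fderiv ℝ f.1 x (Pi.single i 1),
    show ContDiff ℝ ∞ (fun x => fderiv ℝ f.1 x (Pi.single i 1)) from
      ((contDiff_smoothFn f).fderiv_right (m := ∞) (by simp)).clm_apply contDiff_const⟩
  map_add' f g := by
    apply Subtype.ext
    funext x
    change fderiv ℝ (f.1 + g.1) x _ = fderiv ℝ f.1 x _ + fderiv ℝ g.1 x _
    rw [fderiv_add (differentiable_smoothFn f x) (differentiable_smoothFn g x)]
    rfl
  map_smul' c f := by
    apply Subtype.ext
    funext x
    change fderiv ℝ (c • f.1) x _ = c • fderiv ℝ f.1 x _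
    rw [fderiv_const_smul (differentiable_smoothFn f x)]
    rfl

/-- The coordinate function of an even index. -/
def evenCoord (i : EvenIx ε) : SmoothFn ε :=
  ⟨fun x => (x i : ℂ),
    show ContDiff ℝ ∞ (fun x : Pt ε => (x i : ℂ)) from
      Complex.ofRealCLM.contDiff.comp (contDiff_apply ℝ ℝ i)⟩

/-- The coordinate superfunction `φ^A`. -/
def coord (η : Type*) [DecidableEq η] (A : Φ) : SuperFn ε η :=
  if h : ε A = 0 then evenCoord ⟨A, h⟩ ⊗ₜ 1
  else 1 ⊗ₜ ExteriorAlgebra.ι ℂ (Pi.single (Sum.inl ⟨A, h⟩) 1)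

/-- The right derivative `f ↦ f_{,A} = δf/δφ^A`.  For odd `A` this is the contraction from the
right, which satisfies `(g θ)_{,θ} = g - (g_{,θ}) θ`. -/
def rderiv (A : Φ) : SuperFn ε η →ₗ[ℂ] SuperFn ε η :=
  if h : ε A = 0 then LinearMap.rTensor (Grass ε η) (pderivSmooth ⟨A, h⟩)
  else LinearMap.lTensor (SmoothFn ε)
    (CliffordAlgebra.contractRight.flip (LinearMap.proj (Sum.inl ⟨A, h⟩)))

/-- The parity automorphism: `1` on even superfunctions, `-1` on odd ones. -/
def parityAut (ε : Φ → ZMod 2) (η : Type*) : SuperFn ε η →ₐ[ℂ] SuperFn ε η :=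
  Algebra.TensorProduct.map (AlgHom.id ℂ (SmoothFn ε)) CliffordAlgebra.involute

/-- `f` is homogeneous of Grassmann parity `p`. -/
def HasParity (p : ZMod 2) (f : SuperFn ε η) : Prop := parityAut ε η f = sgn p • f

/-- The value of a superfunction at a point of the even space, an element of the Grassmann
algebra. -/
def evalAt (x : Pt ε) : SuperFn ε η →ₐ[ℂ] Grass ε η :=
  Algebra.TensorProduct.lift
    ((Algebra.ofId ℂ (Grass ε η)).comp
      ((Pi.evalAlgHom ℂ (fun _ : Pt ε => ℂ) x).comp (SmoothFn ε).val))
    (AlgHom.id ℂ (Grass ε η)) fun f u => Algebra.commutes (f.1 x) u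

/-- The body (numerical part) of a superfunction at a point of the even space. -/
def bodyAt (x : Pt ε) (f : SuperFn ε η) : ℂ := ExteriorAlgebra.algebraMapInv (evalAt x f)

/-- The supertrace `Str M = ∑_A (-1)^{ε_A} M^A_A`, with entries in any algebra. -/
def str (ε : Φ → ZMod 2) {S : Type*} [Ring S] [Algebra ℂ S] (M : Matrix Φ Φ S) : S :=
  ∑ A, sgn (ε A) • M A A

/-- Unconditional convergence of a series in the (finite-dimensional) Grassmann algebra,
i.e. of all its coordinates. -/
def GrassHasSum (u : ℕ → Grass ε η) (J : Grass ε η) : Prop :=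
  ∀ ℓ : Module.Dual ℂ (Grass ε η), HasSum (fun n => ℓ (u n)) (ℓ J)

/-- The coefficient of `M^n`, `n ≥ 1`, in `ln (1 + M) = - ∑_{n ≥ 1} ((-1)^n / n) M^n`. -/
def logCoeff (n : ℕ) : ℂ := -((-1) ^ n / n)

/-- At the point `x` the series `Str ln (𝕀 + M) = - ∑_{n ≥ 1} ((-1)^n / n) Str (M^n)` converges
to `J`. -/
def HasStrLn (x : Pt ε) (M : Matrix Φ Φ (SuperFn ε η)) (J : Grass ε η) : Prop :=
  GrassHasSum (fun n => logCoeff (n + 1) • evalAt x (str ε (M ^ (n + 1)))) J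

/-- At the point `x` the series `tr ln (e + m) = - ∑_{n ≥ 1} ((-1)^n / n) tr (m^n)` converges
to `J`. -/
def HasTrLn (x : Pt ε) (m : Matrix (Fin 2) (Fin 2) (SuperFn ε η)) (J : Grass ε η) : Prop :=
  GrassHasSum (fun n => logCoeff (n + 1) • evalAt x (m ^ (n + 1)).trace) J

/-- At the point `x` the series `ln (1 + f) = - ∑_{n ≥ 1} ((-1)^n / n) f^n` converges to `J`. -/
def HasLn (x : Pt ε) (f : SuperFn ε η) (J : Grass ε η) : Prop :=
  GrassHasSum (fun n => logCoeff (n + 1) • evalAt x (f ^ (n + 1))) J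

end Superspace

/-- The formal series `- ∑_{n ≥ 1} ((-1)^n / n) u n` for power series `u n` in `t` of order at
least `n`: the coefficient of `t^N` receives contributions from `n ≤ N` only. -/
def formalLogSum {S : Type*} [Ring S] [Algebra ℂ S] (u : ℕ → PowerSeries S) : PowerSeries S :=
  PowerSeries.mk fun N => ∑ n ∈ Finset.Icc 1 N, logCoeff n • PowerSeries.coeff N (u n)

/-! ### `Sp(2)` indices: `0, 1 : Fin 2` stand for the values `1, 2`. -/

/-- `ε^{ab}` with `ε^{12} = 1`. -/
def epsUp : Matrix (Fin 2) (Fin 2) ℂ := !![0, 1; -1, 0]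

/-- `ε_{ab}` with `ε^{ac} ε_{cb} = δ^a_b`, so `ε_{12} = -1`. -/
def epsLow : Matrix (Fin 2) (Fin 2) ℂ := !![0, -1; 1, 0]

/-! ### Gauge theories with a closed algebra -/

/-- The fields `φ^A = (A^i, C^{αa}, B^α)`. -/
abbrev FieldIx (I 𝒜 : Type*) : Type _ := I ⊕ (𝒜 × Fin 2) ⊕ 𝒜

/-- The parities `(ε_i, ε_α + 1, ε_α)` of the fields `(A^i, C^{αa}, B^α)`. -/
def fieldParity {I 𝒜 : Type*} (εI : I → ZMod 2) (εA : 𝒜 → ZMod 2) : FieldIx I 𝒜 → ZMod 2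
  | .inl i => εI i
  | .inr (.inl (α, _)) => εA α + 1
  | .inr (.inr α) => εA α

/-- A gauge theory with a closed algebra of first rank and structure constants `F^γ_{αβ}`:
generators `R^i_α(A)` of gauge transformations of the classical fields `A^i`. -/
structure GaugeTheory (I 𝒜 η : Type*) [Fintype I] [Fintype 𝒜] [DecidableEq I] [DecidableEq 𝒜]
    [DecidableEq η] where
  /-- parities `ε_i` of the classical fields -/
  εI : I → ZMod 2
  /-- parities `ε_α` of the gauge parameters -/
  εA : 𝒜 → ZMod 2
  /-- gauge generators `R^i_α` -/
  R : I → 𝒜 → SuperFn (fieldParity εI εA) η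
  /-- structure constants, `F γ α β = F^γ_{αβ}` -/
  F : 𝒜 → 𝒜 → 𝒜 → ℂ
  R_parity : ∀ i α, HasParity (εI i + εA α) (R i α)
  /-- `R^i_α` does not depend on the ghosts and the Nakanishi--Lautrup fields -/
  R_indep : ∀ i α k, rderiv (Sum.inr k) (R i α) = 0
  F_parity : ∀ γ α β, F γ α β ≠ 0 → εA γ = εA α + εA β
  F_antisymm : ∀ γ α β, F γ α β = -(sgn (εA α * εA β) * F γ β α)
  /-- the closed gauge algebra -/
  closed : ∀ i α β,
    (∑ j, rderiv (Sum.inl j) (R i α) * R j β)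
      - sgn (εA α * εA β) • (∑ j, rderiv (Sum.inl j) (R i β) * R j α)
      = -∑ γ, F γ α β • R i γ
  /-- the Jacobi identity for the structure constants -/
  jacobi : ∀ δ α β γ,
    ∑ σ, F δ α σ * F σ β γ
      = ∑ σ, F σ α β * F δ σ γ + sgn (εA α * εA β) * ∑ σ, F δ β σ * F σ α γ
  /-- invariance of the integration measure: the divergence of the generators and the
  supertrace of the structure constants (both zero in Yang--Mills theories) compensate
  each other -/
  measure_inv : ∀ α,
    (∑ i, sgn (εI i * (εA α + 1)) • rderiv (Sum.inl i) (R i α))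
      + algebraMap ℂ _ (∑ β, sgn (εA β) * F β α β) = 0

namespace GaugeTheory

variable {I 𝒜 η : Type*} [Fintype I] [Fintype 𝒜] [DecidableEq I] [DecidableEq 𝒜]
  [DecidableEq η] (T : GaugeTheory I 𝒜 η)

/-- The parity of the fields of the theory. -/
abbrev par : FieldIx I 𝒜 → ZMod 2 := fieldParity T.εI T.εA

/-- The functionals of the fields of the theory. -/
abbrev Fn : Type _ := SuperFn T.par η

/-- The ghost and antighost fields `C^{αa}`. -/
def ghost (α : 𝒜) (a : Fin 2) : T.Fn := coord η (Sum.inr (Sum.inl (α, a)))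

/-- The Nakanishi--Lautrup fields `B^α`. -/
def nl (α : 𝒜) : T.Fn := coord η (Sum.inr (Sum.inr α))

/-- `X_2^{αa} = s^a B^α`. -/
def X₂ (α : 𝒜) (a : Fin 2) : T.Fn :=
  -((1 / 2 : ℂ) • ∑ γ, ∑ β, T.F α γ β • (T.nl β * T.ghost γ a))
    - (1 / 12 : ℂ) • ∑ β, ∑ γ, ∑ ρ, ∑ σ, ∑ b, ∑ c,
        (sgn (T.εA β) * T.F α γ σ * T.F σ β ρ * epsLow c b) •
          (T.ghost ρ b * T.ghost β a * T.ghost γ c)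

/-- `X^{Aa} = s^a φ^A`. -/
def X : FieldIx I 𝒜 → Fin 2 → T.Fn
  | .inl i, a => ∑ α, T.R i α * T.ghost α a
  | .inr (.inl (α, b)), a =>
      -(epsUp a b • T.nl α)
        - (1 / 2 : ℂ) • ∑ β, ∑ γ, (sgn (T.εA β) * T.F α β γ) • (T.ghost γ b * T.ghost β a)
  | .inr (.inr α), a => T.X₂ α a

/-- `Y^A`. -/
def Y : FieldIx I 𝒜 → T.Fn
  | .inl i =>
      (∑ α, T.R i α * T.nl α)
        + (1 / 2 : ℂ) • ∑ α, ∑ β, ∑ j, ∑ a, ∑ b, (sgn (T.εA α) * epsLow a b) •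
            (rderiv (Sum.inl j) (T.R i α) * T.R j β * T.ghost β b * T.ghost α a)
  | .inr (.inl (α, a)) => -((2 : ℂ) • T.X₂ α a)
  | .inr (.inr _) => 0

/-- The BRST-antiBRST generators `s^a G = G_{,A} X^{Aa}`. -/
def s (a : Fin 2) (G : T.Fn) : T.Fn := ∑ A, rderiv A G * T.X A a

/-- `s_a = ε_{ab} s^b`. -/
def sLow (a : Fin 2) (G : T.Fn) : T.Fn := ∑ b, epsLow a b • T.s b G

/-- `s² = ε_{ab} s^b s^a = s^1 s^2 - s^2 s^1`. -/
def sSq (G : T.Fn) : T.Fn := ∑ a, ∑ b, epsLow a b • T.s b (T.s a G)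

/-- `λ² = λ_a λ^a` with `λ^a = ε^{ab} λ_b`. -/
def lamSq (lam : Fin 2 → T.Fn) : T.Fn := ∑ a, ∑ b, epsUp a b • (lam a * lam b)

/-- The part `X^{Aa} λ_a` of `Δφ^A` linear in the parameters. -/
def shift₁ (lam : Fin 2 → T.Fn) (A : FieldIx I 𝒜) : T.Fn := ∑ a, T.X A a * lam a

/-- The part `-(1/2) Y^A λ²` of `Δφ^A` quadratic in the parameters. -/
def shift₂ (lam : Fin 2 → T.Fn) (A : FieldIx I 𝒜) : T.Fn :=
  -((1 / 2 : ℂ) • (T.Y A * T.lamSq lam))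

/-- The finite field-dependent transformation `Δφ^A = X^{Aa} λ_a - (1/2) Y^A λ²`. -/
def shift (lam : Fin 2 → T.Fn) (A : FieldIx I 𝒜) : T.Fn := T.shift₁ lam A + T.shift₂ lam A

/-- The matrix `M^A_B = δ(Δφ^A)/δφ^B`. -/
def jac (lam : Fin 2 → T.Fn) : Matrix (FieldIx I 𝒜) (FieldIx I 𝒜) T.Fn :=
  Matrix.of fun A B => rderiv B (T.shift lam A)

/-- The matrix `M` of the parameters `t λ_a`, as a power series in the even formal parameter `t`
counting the powers of `λ_a`. -/
def jacT (lam : Fin 2 → T.Fn) : Matrix (FieldIx I 𝒜) (FieldIx I 𝒜) (PowerSeries T.Fn) :=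
  Matrix.of fun A B =>
    PowerSeries.monomial 1 (rderiv B (T.shift₁ lam A))
      + PowerSeries.monomial 2 (rderiv B (T.shift₂ lam A))

/-- The `Sp(2)` matrix `m^a_b = s^a λ_b`. -/
def m (lam : Fin 2 → T.Fn) : Matrix (Fin 2) (Fin 2) T.Fn := Matrix.of fun a b => T.s a (lam b)

/-- The matrix `m` of the parameters `t λ_a`. -/
def mT (lam : Fin 2 → T.Fn) : Matrix (Fin 2) (Fin 2) (PowerSeries T.Fn) :=
  (T.m lam).map (PowerSeries.monomial 1)

/-- `ℑ = Str ln (𝕀 + M)` as an expansion in powers of the parameters `λ_a`. -/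
def logJac (lam : Fin 2 → T.Fn) : PowerSeries T.Fn :=
  formalLogSum fun n => str T.par (T.jacT lam ^ n)

/-- `tr ln (e + m)` as an expansion in powers of the parameters `λ_a`. -/
def trLn (lam : Fin 2 → T.Fn) : PowerSeries T.Fn :=
  formalLogSum fun n => (T.mT lam ^ n).trace

/-- `ln (1 + t f)` as a power series in `t`. -/
def lnT (f : T.Fn) : PowerSeries T.Fn :=
  formalLogSum fun n => PowerSeries.monomial 1 f ^ n

/-- The generator `s^a` on expansions in powers of the parameters, term by term. -/
def sT (a : Fin 2) (J : PowerSeries T.Fn) : PowerSeries T.Fn :=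
  PowerSeries.mk fun n => T.s a (PowerSeries.coeff n J)

end GaugeTheory

end BRST

end

open BRST

noncomputable section

open scoped TensorProduct ContDiff

set_option linter.unusedSectionVars false

namespace BRST

/-! ### Signs -/

/-! Two facts about the generators carry the theorem: the Sp(2) algebra s^b X^{Aa} = ε^{ab} Y^A, s^a
Y^A = 0 (`s_X`, `s_Y`), and the vanishing divergence X^{Aa}_{,A} = 0 (`div_X`). The first comes from
the closed gauge algebra on A^i and from the Jacobi identity on the ghosts and B; the second is the
invariance of the measure.

Differentiating the shift gives M = P + Q + R + QP, where P = X^{Aa} λ_{a,B} contains the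
derivatives of the parameters and Q = (-1)^{ε_B} X^{Aa}_{,B} λ_a, R = -(1/2) Y^A_{,B} λ² do not. The
derivative of λ² produces exactly QP, because QX is proportional to Yλ, and RP = 0 because sY = 0.
Hence 1 + M = (1 + Q + R)(1 + P). Any product of three λ's vanishes, so Str ln of the first factor
reduces to Str Q + Str(R - Q²/2), and both terms are zero by `div_X` (`str_matQ`,
`str_matQ_mul_matQ`). For the second factor, cyclicity of the supertrace gives Str P^n = -tr m^n
(`str_matP_pow`), the minus sign coming from the odd Sp(2) index. The logarithm of the
noncommutative product is handled under the trace by the Euler derivation t d/dt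
(`sum_logCoeff_trace_of_factorization`).

The variation formula follows because s^a is a derivation and m has even entries. For λ_a = s_a Λ
the matrix m is scalar since the s^a anticommute, and ℑ is invariant since any product of three s's
vanishes. Non-invariance is witnessed by λ_1 = ζ C^1 C^2, λ_2 = 0 with an odd constant ζ.

For convergence, the numerical part of M is that of P, whose nonzero eigenvalues are those of m
(det(1 - XL) = det(1 - LX)); the rest is nilpotent, so the powers of M decay geometrically. The
formal identity orders terms by degree in λ, the series by powers of M; `hasSum_formalLog` passes
between the two, since a nonzero word contains at most two factors of the t² part R + QP. -/

theorem zmod_two_eq (p : ZMod 2) : p = 0 ∨ p = 1 := by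
  revert p; decide

@[simp] theorem sgn_zero : sgn 0 = 1 := by simp [sgn]

@[simp] theorem sgn_one : sgn 1 = -1 := by simp [sgn]

theorem sgn_add (p q : ZMod 2) : sgn (p + q) = sgn p * sgn q := by
  rcases zmod_two_eq p with rfl | rfl <;> rcases zmod_two_eq q with rfl | rfl <;>
    simp [show (1 + 1 : ZMod 2) = 0 from rfl]

@[simp] theorem sgn_mul_sgn (p : ZMod 2) : sgn p * sgn p = 1 := by
  rcases zmod_two_eq p with rfl | rfl <;> simp

@[simp] theorem sgn_mul_sgn_mul (p : ZMod 2) (z : ℂ) : sgn p * (sgn p * z) = z := by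
  rw [← mul_assoc, sgn_mul_sgn, one_mul]

theorem add_self_zmod_two (p : ZMod 2) : p + p = 0 := by
  revert p; decide

/-! ### The algebra of superfunctions -/

section Superspace

variable {Φ : Type*} [Fintype Φ] [DecidableEq Φ] {ε : Φ → ZMod 2} {η : Type*} [DecidableEq η]

theorem superFn_induction {C : SuperFn ε η → Prop}
    (smooth : ∀ f : SmoothFn ε, C (f ⊗ₜ 1))
    (odd : ∀ v : OddIx ε η → ℂ, C (1 ⊗ₜ ExteriorAlgebra.ι ℂ v))
    (mul : ∀ f g, C f → C g → C (f * g)) (add : ∀ f g, C f → C g → C (f + g))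
    (f : SuperFn ε η) : C f := by
  have hone : C 1 := smooth 1
  have hgrass : ∀ w : Grass ε η, C (1 ⊗ₜ w) := by
    intro w
    induction w using ExteriorAlgebra.induction with
    | algebraMap r =>
      have := smooth (algebraMap ℂ _ r)
      rwa [Algebra.TensorProduct.tmul_one_eq_one_tmul] at this
    | ι v => exact odd v
    | mul a b ha hb => simpa using mul _ _ ha hb
    | add a b ha hb => simpa [TensorProduct.tmul_add] using add _ _ ha hb
  induction f using TensorProduct.induction_on with
  | zero => simpa using smooth 0
  | tmul f w => simpa using mul _ _ (smooth f) (hgrass w)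
  | add f g hf hg => exact add _ _ hf hg

@[simp] theorem parityAut_tmul (f : SmoothFn ε) (w : Grass ε η) :
    parityAut ε η (f ⊗ₜ w) = f ⊗ₜ CliffordAlgebra.involute w := rfl

@[simp] theorem parityAut_parityAut (f : SuperFn ε η) :
    parityAut ε η (parityAut ε η f) = f := by
  induction f using TensorProduct.induction_on with
  | zero => simp
  | tmul f w => simp
  | add f g hf hg => rw [map_add, map_add, hf, hg]

theorem smooth_mul_comm (f : SmoothFn ε) (g : SuperFn ε η) :
    (f ⊗ₜ 1 : SuperFn ε η) * g = g * f ⊗ₜ 1 := by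
  induction g using TensorProduct.induction_on with
  | zero => simp
  | tmul h w => simp [mul_comm]
  | add g h hg hh => rw [mul_add, add_mul, hg, hh]

theorem ι_mul_eq_involute_mul (v : OddIx ε η → ℂ) (w : Grass ε η) :
    ExteriorAlgebra.ι ℂ v * w = CliffordAlgebra.involute w * ExteriorAlgebra.ι ℂ v := by
  induction w using ExteriorAlgebra.induction with
  | algebraMap r => simp [Algebra.commutes]
  | ι u =>
    have h := ExteriorAlgebra.ι_add_mul_swap (R := ℂ) v u
    rw [show CliffordAlgebra.involute (ExteriorAlgebra.ι ℂ u) = -ExteriorAlgebra.ι ℂ u from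
      CliffordAlgebra.involute_ι u, neg_mul]
    exact eq_neg_of_add_eq_zero_left h
  | mul a b ha hb => rw [← mul_assoc, ha, mul_assoc, hb, map_mul, mul_assoc]
  | add a b ha hb => rw [mul_add, map_add, add_mul, ha, hb]

theorem odd_mul_eq_parityAut_mul (v : OddIx ε η → ℂ) (g : SuperFn ε η) :
    (1 ⊗ₜ ExteriorAlgebra.ι ℂ v : SuperFn ε η) * g
      = parityAut ε η g * 1 ⊗ₜ ExteriorAlgebra.ι ℂ v := by
  induction g using TensorProduct.induction_on with
  | zero => simp
  | tmul h w =>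
    simp only [parityAut_tmul, Algebra.TensorProduct.tmul_mul_tmul, one_mul, mul_one,
      ι_mul_eq_involute_mul]
  | add g h hg hh => rw [mul_add, map_add, add_mul, hg, hh]

/-- `f ↦ (-1)^{p ε(f)} f`. -/
def parityPow (ε : Φ → ZMod 2) (η : Type*) (p : ZMod 2) : SuperFn ε η →ₐ[ℂ] SuperFn ε η :=
  if p = 0 then AlgHom.id ℂ _ else parityAut ε η

@[simp] theorem parityPow_zero (f : SuperFn ε η) : parityPow ε η 0 f = f := by simp [parityPow]

@[simp] theorem parityPow_one (f : SuperFn ε η) : parityPow ε η 1 f = parityAut ε η f := by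
  simp [parityPow]

theorem parityPow_add (p q : ZMod 2) (f : SuperFn ε η) :
    parityPow ε η (p + q) f = parityPow ε η p (parityPow ε η q f) := by
  rcases zmod_two_eq p with rfl | rfl <;> rcases zmod_two_eq q with rfl | rfl <;>
    simp [show (1 + 1 : ZMod 2) = 0 from rfl]

namespace HasParity

variable {p q : ZMod 2} {f g : SuperFn ε η}

theorem parityPow (hf : HasParity p f) (q : ZMod 2) :
    BRST.parityPow ε η q f = sgn (q * p) • f := by
  rcases zmod_two_eq q with rfl | rfl
  · simp
  · rw [parityPow_one, one_mul]
    exact hf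

theorem mul (hf : HasParity p f) (hg : HasParity q g) : HasParity (p + q) (f * g) := by
  unfold HasParity at *
  rw [map_mul, hf, hg, sgn_add, smul_mul_smul_comm]

theorem add (hf : HasParity p f) (hg : HasParity p g) : HasParity p (f + g) := by
  unfold HasParity at *
  rw [map_add, hf, hg, smul_add]

theorem zero : HasParity p (0 : SuperFn ε η) := by simp [HasParity]

theorem algebraMap (z : ℂ) : HasParity 0 (algebraMap ℂ (SuperFn ε η) z) := by
  simp [HasParity, -Algebra.TensorProduct.algebraMap_apply]

theorem smul (z : ℂ) (hf : HasParity p f) : HasParity p (z • f) := by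
  unfold HasParity at *
  rw [map_smul, hf, smul_comm]

theorem neg (hf : HasParity p f) : HasParity p (-f) := by
  simpa using hf.smul (-1)

theorem sub (hf : HasParity p f) (hg : HasParity p g) : HasParity p (f - g) := by
  simpa [sub_eq_add_neg] using hf.add hg.neg

theorem sum {ι : Type*} {t : Finset ι} {f : ι → SuperFn ε η} (h : ∀ i ∈ t, HasParity p (f i)) :
    HasParity p (∑ i ∈ t, f i) := by
  unfold HasParity at *
  rw [map_sum, Finset.smul_sum]
  exact Finset.sum_congr rfl h

theorem of_eq (hf : HasParity p f) (h : p = q) : HasParity q f := h ▸ hf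

theorem mul_comm_even (hf : HasParity 0 f) (g : SuperFn ε η) : f * g = g * f := by
  have hf' : BRST.parityAut ε η f = f := by simpa [HasParity] using hf
  induction g using superFn_induction with
  | smooth h => exact (smooth_mul_comm h f).symm
  | odd v => rw [odd_mul_eq_parityAut_mul, hf']
  | mul a b ha hb => rw [← mul_assoc, ha, mul_assoc, hb, mul_assoc]
  | add a b ha hb => rw [mul_add, add_mul, ha, hb]

theorem mul_comm_odd (hf : HasParity 1 f) (g : SuperFn ε η) :
    f * g = BRST.parityAut ε η g * f := by
  have hf' : BRST.parityAut ε η f = -f := by simpa [HasParity] using hf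
  induction g using superFn_induction with
  | smooth h => simp [smooth_mul_comm h f]
  | odd v =>
    have h1 : BRST.parityAut ε η (1 ⊗ₜ ExteriorAlgebra.ι ℂ v)
        = -(1 ⊗ₜ ExteriorAlgebra.ι ℂ v) := by
      rw [parityAut_tmul, ← TensorProduct.tmul_neg]
      congr 1
      exact CliffordAlgebra.involute_ι v
    rw [h1, neg_mul, odd_mul_eq_parityAut_mul, hf']
    simp
  | mul a b ha hb => rw [← mul_assoc, ha, mul_assoc, hb, map_mul, mul_assoc]
  | add a b ha hb => rw [mul_add, map_add, add_mul, ha, hb]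

theorem mul_comm (hf : HasParity p f) (hg : HasParity q g) :
    f * g = sgn (p * q) • (g * f) := by
  rcases zmod_two_eq p with rfl | rfl
  · simp [hf.mul_comm_even]
  · rw [hf.mul_comm_odd, show BRST.parityAut ε η g = sgn q • g from hg, one_mul, smul_mul_assoc]

end HasParity

/-! ### Derivatives -/

theorem pderivSmooth_mul (i : EvenIx ε) (f g : SmoothFn ε) :
    pderivSmooth i (f * g) = f * pderivSmooth i g + pderivSmooth i f * g := by
  apply Subtype.ext
  funext x
  change fderiv ℝ (f.1 * g.1) x _ = f.1 x * fderiv ℝ g.1 x _ + fderiv ℝ f.1 x _ * g.1 x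
  rw [fderiv_mul (differentiable_smoothFn f x) (differentiable_smoothFn g x)]
  simp [mul_comm]

theorem pderivSmooth_comm (i j : EvenIx ε) (f : SmoothFn ε) :
    pderivSmooth i (pderivSmooth j f) = pderivSmooth j (pderivSmooth i f) := by
  apply Subtype.ext
  funext x
  have hd : DifferentiableAt ℝ (fderiv ℝ f.1) x :=
    (((contDiff_smoothFn f).fderiv_right (m := ∞) (by simp)).differentiable (by simp)) x
  have key : ∀ a b : Pt ε, fderiv ℝ (fun y => fderiv ℝ f.1 y a) x b
      = fderiv ℝ (fderiv ℝ f.1) x b a := by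
    intro a b
    rw [fderiv_clm_apply hd (differentiableAt_const a)]
    simp
  change fderiv ℝ (fun y => fderiv ℝ f.1 y _) x _ = fderiv ℝ (fun y => fderiv ℝ f.1 y _) x _
  rw [key, key]
  exact ((contDiff_smoothFn f).contDiffAt.isSymmSndFDerivAt (by
    rw [minSmoothness_of_isRCLikeNormedField]
    exact WithTop.coe_le_coe.2 le_top)) _ _

/-- The contraction comes from the right, so reaching `u` costs the parity of `w`. The induction on
`w` keeps `u` arbitrary because the product case absorbs a factor into it. -/
theorem contractRight_mul (d : Module.Dual ℂ (OddIx ε η → ℂ)) (u w : Grass ε η) :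
    CliffordAlgebra.contractRight (u * w) d
      = u * CliffordAlgebra.contractRight w d
        + CliffordAlgebra.contractRight u d * CliffordAlgebra.involute w := by
  induction w using ExteriorAlgebra.induction generalizing u with
  | algebraMap r =>
    rw [show (algebraMap ℂ (Grass ε η)) r = algebraMap ℂ (CliffordAlgebra 0) r from rfl]
    rw [CliffordAlgebra.contractRight_mul_algebraMap, CliffordAlgebra.contractRight_algebraMap]
    simp
  | ι v =>
    have h1 := CliffordAlgebra.contractRight_mul_ι (d := d) v u
    have h2 := CliffordAlgebra.contractRight_ι (Q := (0 : QuadraticForm ℂ (OddIx ε η → ℂ))) d v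
    have h3 := CliffordAlgebra.involute_ι (Q := (0 : QuadraticForm ℂ (OddIx ε η → ℂ))) v
    unfold ExteriorAlgebra.ι
    rw [h1, h2, h3, ← Algebra.commutes, ← Algebra.smul_def]
    simp [sub_eq_add_neg]
  | mul a b ha hb =>
    rw [← mul_assoc, hb, ha, hb a, map_mul]
    noncomm_ring
  | add a b ha hb =>
    rw [mul_add, map_add, LinearMap.add_apply, ha, hb, map_add, map_add, LinearMap.add_apply]
    noncomm_ring

theorem involute_contractRight (d : Module.Dual ℂ (OddIx ε η → ℂ)) (w : Grass ε η) :
    CliffordAlgebra.involute (CliffordAlgebra.contractRight w d)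
      = -CliffordAlgebra.contractRight (CliffordAlgebra.involute w) d := by
  induction w using ExteriorAlgebra.induction with
  | algebraMap r =>
    rw [show (algebraMap ℂ (Grass ε η)) r = algebraMap ℂ (CliffordAlgebra 0) r from rfl]
    rw [CliffordAlgebra.contractRight_algebraMap, AlgHom.commutes,
      CliffordAlgebra.contractRight_algebraMap]
    simp
  | ι v =>
    have h2 := CliffordAlgebra.contractRight_ι (Q := (0 : QuadraticForm ℂ (OddIx ε η → ℂ))) d v
    have h3 := CliffordAlgebra.involute_ι (Q := (0 : QuadraticForm ℂ (OddIx ε η → ℂ))) v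
    unfold ExteriorAlgebra.ι
    rw [h2, h3, map_neg, LinearMap.neg_apply, h2, AlgHom.commutes, neg_neg]
  | mul a b ha hb =>
    rw [contractRight_mul, map_mul, contractRight_mul, map_add, map_mul, map_mul, ha, hb]
    simp only [mul_neg, neg_mul, neg_add]
  | add a b ha hb =>
    simp only [map_add, LinearMap.add_apply, ha, hb, neg_add]

theorem rderiv_even {A : Φ} (h : ε A = 0) (f : SmoothFn ε) (w : Grass ε η) :
    rderiv A (f ⊗ₜ w : SuperFn ε η) = pderivSmooth ⟨A, h⟩ f ⊗ₜ w := by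
  simp [rderiv, h]

theorem rderiv_odd {A : Φ} (h : ε A ≠ 0) (f : SmoothFn ε) (w : Grass ε η) :
    rderiv A (f ⊗ₜ w : SuperFn ε η)
      = f ⊗ₜ CliffordAlgebra.contractRight w (LinearMap.proj (Sum.inl ⟨A, h⟩)) := by
  simp [rderiv, h]

theorem rderiv_mul (A : Φ) (f g : SuperFn ε η) :
    rderiv A (f * g) = f * rderiv A g + rderiv A f * parityPow ε η (ε A) g := by
  induction f using TensorProduct.induction_on with
  | zero => simp
  | add f f' hf hf' => simp only [add_mul, map_add, hf, hf']; abel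
  | tmul f u =>
    induction g using TensorProduct.induction_on with
    | zero => simp
    | add g g' hg hg' => simp only [mul_add, map_add, hg, hg']; abel
    | tmul g w =>
      by_cases h : ε A = 0
      · rw [Algebra.TensorProduct.tmul_mul_tmul, rderiv_even h, rderiv_even h, rderiv_even h, h,
          parityPow_zero, pderivSmooth_mul, Algebra.TensorProduct.tmul_mul_tmul,
          Algebra.TensorProduct.tmul_mul_tmul, TensorProduct.add_tmul]
      · rw [Algebra.TensorProduct.tmul_mul_tmul, rderiv_odd h, rderiv_odd h, rderiv_odd h,
          (zmod_two_eq _).resolve_left h, parityPow_one, contractRight_mul, parityAut_tmul,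
          Algebra.TensorProduct.tmul_mul_tmul, Algebra.TensorProduct.tmul_mul_tmul,
          TensorProduct.tmul_add]

theorem parityAut_rderiv (A : Φ) (f : SuperFn ε η) :
    parityAut ε η (rderiv A f) = sgn (ε A) • rderiv A (parityAut ε η f) := by
  induction f using TensorProduct.induction_on with
  | zero => simp
  | add f f' hf hf' => simp only [map_add, hf, hf', smul_add]
  | tmul f u =>
    by_cases h : ε A = 0
    · rw [rderiv_even h, parityAut_tmul, parityAut_tmul, rderiv_even h, h]; simp
    · rw [rderiv_odd h, parityAut_tmul, parityAut_tmul, rderiv_odd h,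
        (zmod_two_eq _).resolve_left h, involute_contractRight]
      simp [TensorProduct.tmul_neg]

theorem HasParity.rderiv {p : ZMod 2} {f : SuperFn ε η} (hf : HasParity p f) (A : Φ) :
    HasParity (p + ε A) (rderiv A f) := by
  unfold HasParity at *
  rw [parityAut_rderiv, hf, map_smul, sgn_add, smul_smul, _root_.mul_comm (sgn p)]

theorem rderiv_comm (A B : Φ) (f : SuperFn ε η) :
    rderiv A (rderiv B f) = sgn (ε A * ε B) • rderiv B (rderiv A f) := by
  induction f using TensorProduct.induction_on with
  | zero => simp
  | add f f' hf hf' => simp only [map_add, hf, hf', smul_add]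
  | tmul f u =>
    by_cases hA : ε A = 0 <;> by_cases hB : ε B = 0
    · rw [rderiv_even hA, rderiv_even hB, rderiv_even hB, rderiv_even hA, pderivSmooth_comm]
      simp [hA]
    · rw [rderiv_even hA, rderiv_odd hB, rderiv_odd hB, rderiv_even hA]
      simp [hA]
    · rw [rderiv_even hB, rderiv_odd hA, rderiv_odd hA, rderiv_even hB]
      simp [hB]
    · rw [rderiv_odd hA, rderiv_odd hB, rderiv_odd hB, rderiv_odd hA,
        CliffordAlgebra.contractRight_comm, (zmod_two_eq _).resolve_left hA,
        (zmod_two_eq _).resolve_left hB]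
      simp [TensorProduct.tmul_neg]

theorem hasParity_coord (A : Φ) : HasParity (ε A) (coord η A : SuperFn ε η) := by
  unfold HasParity coord
  by_cases h : ε A = 0
  · simp [h]
  · rw [dif_neg h, parityAut_tmul, (zmod_two_eq _).resolve_left h,
      show CliffordAlgebra.involute (ExteriorAlgebra.ι ℂ _) = -ExteriorAlgebra.ι ℂ _ from
      CliffordAlgebra.involute_ι _]
    simp [TensorProduct.tmul_neg]

theorem pderivSmooth_one (i : EvenIx ε) : pderivSmooth i (1 : SmoothFn ε) = 0 := by
  have := pderivSmooth_mul i (1 : SmoothFn ε) 1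
  simpa using this

theorem pderivSmooth_evenCoord (i j : EvenIx ε) :
    pderivSmooth i (evenCoord j) = if i = j then 1 else 0 := by
  apply Subtype.ext
  funext x
  change fderiv ℝ (fun x : Pt ε => (x j : ℂ)) x (Pi.single i 1) = _
  have : (fun x : Pt ε => (x j : ℂ))
      = (Complex.ofRealCLM.comp (ContinuousLinearMap.proj (R := ℝ) (φ := fun _ => ℝ) j)) := rfl
  rw [this, ContinuousLinearMap.fderiv]
  by_cases h : i = j
  · subst h; simp
  · simp [h, Ne.symm h]

theorem rderiv_one (A : Φ) : rderiv A (1 : SuperFn ε η) = 0 := by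
  have := rderiv_mul A (1 : SuperFn ε η) 1
  rw [map_one (parityPow ε η (ε A)), one_mul, one_mul, mul_one] at this
  exact left_eq_add.mp this

theorem rderiv_coord (A B : Φ) :
    rderiv A (coord η B : SuperFn ε η) = if A = B then 1 else 0 := by
  unfold coord
  by_cases hB : ε B = 0 <;> by_cases hA : ε A = 0
  · rw [dif_pos hB, rderiv_even hA, pderivSmooth_evenCoord]
    by_cases h : A = B
    · subst h; simp [Algebra.TensorProduct.one_def]
    · simp [h]
  · have h : A ≠ B := by rintro rfl; exact hA hB
    rw [dif_pos hB, rderiv_odd hA, if_neg h, CliffordAlgebra.contractRight_one,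
      TensorProduct.tmul_zero]
  · have h : A ≠ B := by rintro rfl; exact hB hA
    rw [dif_neg hB, rderiv_even hA, if_neg h, pderivSmooth_one, TensorProduct.zero_tmul]
  · rw [dif_neg hB, rderiv_odd hA]
    unfold ExteriorAlgebra.ι
    rw [CliffordAlgebra.contractRight_ι]
    by_cases h : A = B
    · subst h; simp [Algebra.TensorProduct.one_def]
    · simp [h]

/-- The constant odd parameter with index `ζ`. -/
def oddConst (ε : Φ → ZMod 2) (ζ : η) : SuperFn ε η :=
  1 ⊗ₜ ExteriorAlgebra.ι ℂ (Pi.single (Sum.inr ζ) 1)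

theorem hasParity_oddConst (ζ : η) : HasParity 1 (oddConst ε ζ) := by
  unfold HasParity oddConst
  rw [parityAut_tmul, show CliffordAlgebra.involute (ExteriorAlgebra.ι ℂ _)
    = -ExteriorAlgebra.ι ℂ _ from CliffordAlgebra.involute_ι _]
  simp [TensorProduct.tmul_neg]

theorem rderiv_oddConst (A : Φ) (ζ : η) : rderiv A (oddConst ε ζ) = 0 := by
  unfold oddConst
  by_cases hA : ε A = 0
  · rw [rderiv_even hA, pderivSmooth_one, TensorProduct.zero_tmul]
  · rw [rderiv_odd hA]
    unfold ExteriorAlgebra.ι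
    rw [CliffordAlgebra.contractRight_ι]
    simp

end Superspace

namespace GaugeTheory

variable {I 𝒜 η : Type*} [Fintype I] [Fintype 𝒜] [DecidableEq I] [DecidableEq 𝒜]
  [DecidableEq η] (T : GaugeTheory I 𝒜 η)

/-! ### Parities of the BRST-antiBRST generators -/

theorem hasParity_ghost (α : 𝒜) (a : Fin 2) : HasParity (T.εA α + 1) (T.ghost α a) :=
  hasParity_coord (ε := T.par) (Sum.inr (Sum.inl (α, a)))

theorem hasParity_nl (α : 𝒜) : HasParity (T.εA α) (T.nl α) :=
  hasParity_coord (ε := T.par) (Sum.inr (Sum.inr α))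

theorem hasParity_smul_of_ne {p : ZMod 2} {z : ℂ} {f : T.Fn} (h : z ≠ 0 → HasParity p f) :
    HasParity p (z • f) := by
  by_cases hz : z = 0
  · rw [hz, zero_smul]; exact .zero
  · exact (h hz).smul z

theorem hasParity_X₂ (α : 𝒜) (a : Fin 2) : HasParity (T.εA α + 1) (T.X₂ α a) := by
  refine .sub (.neg (.smul _ (.sum fun γ _ => .sum fun β _ => ?_))) (.smul _ (.sum fun β _ =>
    .sum fun γ _ => .sum fun ρ _ => .sum fun σ _ => .sum fun b _ => .sum fun c _ => ?_))
  · refine T.hasParity_smul_of_ne fun hF => ?_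
    refine ((T.hasParity_nl β).mul (T.hasParity_ghost γ a)).of_eq ?_
    rw [T.F_parity _ _ _ hF]; ring
  · refine T.hasParity_smul_of_ne fun hF => ?_
    have h1 : T.F α γ σ ≠ 0 := by rintro h; simp [h] at hF
    have h2 : T.F σ β ρ ≠ 0 := by rintro h; simp [h] at hF
    refine (((T.hasParity_ghost ρ b).mul (T.hasParity_ghost β a)).mul
      (T.hasParity_ghost γ c)).of_eq ?_
    rw [T.F_parity _ _ _ h1, T.F_parity _ _ _ h2]
    generalize T.εA ρ = x; generalize T.εA β = y; generalize T.εA γ = z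
    revert x y z; decide

theorem hasParity_X (A : FieldIx I 𝒜) (a : Fin 2) : HasParity (T.par A + 1) (T.X A a) := by
  rcases A with i | ⟨α, b⟩ | α
  · refine .sum fun α _ => ((T.R_parity i α).mul (T.hasParity_ghost α a)).of_eq ?_
    change _ = T.εI i + 1
    generalize T.εI i = x; generalize T.εA α = y
    revert x y; decide
  · refine .sub (.neg (.smul _ ((T.hasParity_nl α).of_eq ?_))) (.smul _ (.sum fun β _ =>
      .sum fun γ _ => T.hasParity_smul_of_ne fun hF => ?_))
    · change _ = T.εA α + 1 + 1
      generalize T.εA α = x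
      revert x; decide
    · have h1 : T.F α β γ ≠ 0 := by rintro h; simp [h] at hF
      refine ((T.hasParity_ghost γ b).mul (T.hasParity_ghost β a)).of_eq ?_
      change _ = T.εA α + 1 + 1
      rw [T.F_parity _ _ _ h1]; ring
  · exact T.hasParity_X₂ α a

/-! ### The generators are odd derivations -/

@[simp] theorem s_zero (a : Fin 2) : T.s a 0 = 0 := by simp [s]

theorem s_add (a : Fin 2) (f g : T.Fn) : T.s a (f + g) = T.s a f + T.s a g := by
  simp [s, add_mul, Finset.sum_add_distrib]

theorem s_smul (a : Fin 2) (z : ℂ) (f : T.Fn) : T.s a (z • f) = z • T.s a f := by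
  simp [s, Finset.smul_sum]

theorem s_neg (a : Fin 2) (f : T.Fn) : T.s a (-f) = -T.s a f := by
  simpa using T.s_smul a (-1) f

theorem s_sum (a : Fin 2) {ι : Type*} (t : Finset ι) (f : ι → T.Fn) :
    T.s a (∑ i ∈ t, f i) = ∑ i ∈ t, T.s a (f i) := by
  classical
  induction t using Finset.induction_on with
  | empty => simp
  | insert i t hi ih => rw [Finset.sum_insert hi, Finset.sum_insert hi, s_add, ih]

/-- Moving g across X^{Aa}, of parity ε_A + 1, costs (-1)^{(ε_A+1)ε(g)}; combined with the Leibniz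
sign (-1)^{ε_A ε(g)} the dependence on A drops out. This is what makes s^a an odd derivation. -/
theorem parityPow_mul_X (A : FieldIx I 𝒜) (a : Fin 2) (g : T.Fn) :
    parityPow T.par η (T.par A) g * T.X A a = T.X A a * parityAut T.par η g := by
  have hX := T.hasParity_X A a
  rcases zmod_two_eq (T.par A) with h | h
  · rw [h] at hX ⊢
    rw [parityPow_zero, HasParity.mul_comm_odd (hX.of_eq (by decide)), parityAut_parityAut]
  · rw [h] at hX ⊢
    rw [parityPow_one, HasParity.mul_comm_even (hX.of_eq (by decide))]

theorem s_mul (a : Fin 2) (f g : T.Fn) :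
    T.s a (f * g) = f * T.s a g + T.s a f * parityAut T.par η g := by
  simp only [s, Finset.mul_sum, Finset.sum_mul, ← Finset.sum_add_distrib]
  refine Finset.sum_congr rfl fun A _ => ?_
  rw [rderiv_mul, add_mul, mul_assoc, mul_assoc, parityPow_mul_X, ← mul_assoc, ← mul_assoc]

theorem parityAut_s (a : Fin 2) (f : T.Fn) :
    parityAut T.par η (T.s a f) = -T.s a (parityAut T.par η f) := by
  simp only [s, map_sum, map_mul, ← Finset.sum_neg_distrib]
  refine Finset.sum_congr rfl fun A _ => ?_
  rw [parityAut_rderiv, show parityAut T.par η (T.X A a) = sgn (T.par A + 1) • T.X A a from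
    T.hasParity_X A a, smul_mul_smul_comm, sgn_add]
  simp

theorem parityPow_s (p : ZMod 2) (a : Fin 2) (f : T.Fn) :
    T.s a (parityPow T.par η p f) = sgn p • parityPow T.par η p (T.s a f) := by
  rcases zmod_two_eq p with rfl | rfl
  · simp
  · simp [parityAut_s]

theorem hasParity_s {p : ZMod 2} {f : T.Fn} (hf : HasParity p f) (a : Fin 2) :
    HasParity (p + 1) (T.s a f) := by
  unfold HasParity at *
  rw [parityAut_s, hf, s_smul, sgn_add]
  simp

theorem s_coord (a : Fin 2) (A : FieldIx I 𝒜) : T.s a (coord η A) = T.X A a := by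
  simp only [s, rderiv_coord]
  rw [Finset.sum_eq_single A]
  · simp
  · intro B _ hB; simp [hB]
  · simp

end GaugeTheory

namespace GaugeTheory

variable {I 𝒜 η : Type*} [Fintype I] [Fintype 𝒜] [DecidableEq I] [DecidableEq 𝒜]
  [DecidableEq η] (T : GaugeTheory I 𝒜 η)

/-! ### The Lie superalgebra of the structure constants -/

/-- The bracket `[v, u]` of the superfunction-valued elements `v = T_β v^β` and `u = T_γ u^γ` of
the Lie superalgebra with basis `T_α` and structure constants `F`. -/
def br : (𝒜 → T.Fn) →ₗ[ℂ] (𝒜 → T.Fn) →ₗ[ℂ] (𝒜 → T.Fn) :=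
  LinearMap.mk₂ ℂ
    (fun v u α => ∑ β, ∑ γ, T.F α β γ • (parityPow T.par η (T.εA γ) (v β) * u γ))
    (fun v v' u => by
      funext α
      simp only [Pi.add_apply, map_add, add_mul, smul_add, Finset.sum_add_distrib])
    (fun z v u => by
      funext α
      simp only [Pi.smul_apply, map_smul, smul_mul_assoc, Finset.smul_sum, smul_comm z])
    (fun v u u' => by
      funext α
      simp only [Pi.add_apply, mul_add, smul_add, Finset.sum_add_distrib])
    (fun z v u => by
      funext α
      simp only [Pi.smul_apply, mul_smul_comm, Finset.smul_sum, smul_comm z])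

theorem br_apply (v u : 𝒜 → T.Fn) (α : 𝒜) :
    T.br v u α = ∑ β, ∑ γ, T.F α β γ • (parityPow T.par η (T.εA γ) (v β) * u γ) := rfl

/-- `u = T_α u^α` is homogeneous of parity `p`. -/
def VecParity (p : ZMod 2) (u : 𝒜 → T.Fn) : Prop := ∀ α, HasParity (T.εA α + p) (u α)

/-- The generator `s^a` acting on components. -/
def sV (a : Fin 2) : (𝒜 → T.Fn) →ₗ[ℂ] (𝒜 → T.Fn) where
  toFun u α := T.s a (u α)
  map_add' _ _ := funext fun _ => T.s_add a _ _
  map_smul' z _ := funext fun _ => T.s_smul a z _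

theorem sV_apply (a : Fin 2) (u : 𝒜 → T.Fn) (α : 𝒜) : T.sV a u α = T.s a (u α) := rfl

variable {T}

theorem VecParity.sV {p : ZMod 2} {u : 𝒜 → T.Fn} (h : T.VecParity p u) (a : Fin 2) :
    T.VecParity (p + 1) (T.sV a u) := fun α => (T.hasParity_s (h α) a).of_eq (add_assoc _ _ _)

theorem VecParity.br {p q : ZMod 2} {v u : 𝒜 → T.Fn} (hv : T.VecParity p v)
    (hu : T.VecParity q u) : T.VecParity (p + q) (T.br v u) := by
  intro α
  refine .sum fun β _ => .sum fun γ _ => T.hasParity_smul_of_ne fun hF => ?_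
  rw [(hv β).parityPow]
  refine (((hv β).smul _).mul (hu γ)).of_eq ?_
  rw [T.F_parity _ _ _ hF]; ring

theorem br_swap {p q : ZMod 2} {v u : 𝒜 → T.Fn} (hv : T.VecParity p v)
    (hu : T.VecParity q u) : T.br v u = -(sgn (p * q) • T.br u v) := by
  funext α
  rw [Pi.neg_apply, Pi.smul_apply, br_apply, br_apply, Finset.sum_comm, Finset.smul_sum,
    ← Finset.sum_neg_distrib]
  refine Finset.sum_congr rfl fun γ _ => ?_
  rw [Finset.smul_sum, ← Finset.sum_neg_distrib]
  refine Finset.sum_congr rfl fun β _ => ?_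
  rw [T.F_antisymm α β γ, (hv β).parityPow, (hu γ).parityPow, smul_mul_assoc, smul_mul_assoc,
    (hv β).mul_comm (hu γ)]
  simp only [smul_smul, ← neg_smul]
  congr 1
  generalize T.εA β = x; generalize T.εA γ = y; generalize T.F α γ β = F
  rcases zmod_two_eq x with rfl | rfl <;> rcases zmod_two_eq y with rfl | rfl <;>
    rcases zmod_two_eq p with rfl | rfl <;> rcases zmod_two_eq q with rfl | rfl <;>
    simp [show (1 + 1 : ZMod 2) = 0 from rfl]

/-- Both nestings of the bracket are expanded over the same monomials in w, v, u, so that the Jacobi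
identity becomes a comparison of structure constants. -/
theorem br_br_right (w v u : 𝒜 → T.Fn) (δ : 𝒜) :
    T.br w (T.br v u) δ = ∑ α, ∑ β, ∑ γ, (∑ σ, T.F δ α σ * T.F σ β γ) •
      (parityPow T.par η (T.εA γ) (parityPow T.par η (T.εA β) (w α) * v β) * u γ) := by
  rw [br_apply]
  refine Finset.sum_congr rfl fun α _ => ?_
  simp only [br_apply, Finset.mul_sum, Finset.smul_sum, Finset.sum_smul]
  rw [Finset.sum_comm]
  refine Finset.sum_congr rfl fun β _ => ?_
  rw [Finset.sum_comm]
  refine Finset.sum_congr rfl fun γ _ => Finset.sum_congr rfl fun σ _ => ?_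
  -- A nonzero constant forces ε_σ = ε_β + ε_γ, which splits the sign attached to σ into those
  -- attached to β and γ.
  by_cases hF : T.F σ β γ = 0
  · simp [hF]
  · rw [T.F_parity _ _ _ hF, mul_smul_comm, smul_smul, map_mul, mul_assoc, add_comm (T.εA β),
      parityPow_add]

theorem br_br_left (w v u : 𝒜 → T.Fn) (δ : 𝒜) :
    T.br (T.br w v) u δ = ∑ α, ∑ β, ∑ γ, (∑ σ, T.F σ α β * T.F δ σ γ) •
      (parityPow T.par η (T.εA γ) (parityPow T.par η (T.εA β) (w α) * v β) * u γ) := by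
  rw [br_apply]
  simp only [br_apply, map_sum, map_smul, Finset.sum_mul, Finset.smul_sum, Finset.sum_smul,
    smul_mul_assoc, smul_smul]
  have h1 : ∀ σ, (∑ γ, ∑ α, ∑ β, (T.F δ σ γ * T.F σ α β) •
      (parityPow T.par η (T.εA γ) (parityPow T.par η (T.εA β) (w α) * v β) * u γ))
      = ∑ α, ∑ β, ∑ γ, (T.F σ α β * T.F δ σ γ) •
      (parityPow T.par η (T.εA γ) (parityPow T.par η (T.εA β) (w α) * v β) * u γ) := by
    intro σ
    rw [Finset.sum_comm]
    refine Finset.sum_congr rfl fun α _ => ?_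
    rw [Finset.sum_comm]
    refine Finset.sum_congr rfl fun β _ => Finset.sum_congr rfl fun γ _ => ?_
    rw [mul_comm (T.F δ σ γ)]
  rw [Finset.sum_congr rfl fun σ _ => h1 σ, Finset.sum_comm]
  refine Finset.sum_congr rfl fun α _ => ?_
  rw [Finset.sum_comm]
  refine Finset.sum_congr rfl fun β _ => ?_
  rw [Finset.sum_comm]

theorem br_jacobi {p q : ZMod 2} {w v : 𝒜 → T.Fn} (hw : T.VecParity p w)
    (hv : T.VecParity q v) (u : 𝒜 → T.Fn) :
    T.br w (T.br v u) = T.br (T.br w v) u + sgn (p * q) • T.br v (T.br w u) := by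
  funext δ
  rw [Pi.add_apply, Pi.smul_apply, br_br_right, br_br_left, br_br_right v]
  rw [Finset.sum_comm (f := fun β α => ∑ γ, (∑ σ, T.F δ β σ * T.F σ α γ) •
      (parityPow T.par η (T.εA γ) (parityPow T.par η (T.εA α) (v β) * w α) * u γ))]
  simp only [Finset.smul_sum, ← Finset.sum_add_distrib]
  refine Finset.sum_congr rfl fun α _ => Finset.sum_congr rfl fun β _ =>
    Finset.sum_congr rfl fun γ _ => ?_
  rw [(hv β).parityPow, (hw α).parityPow, smul_mul_assoc, smul_mul_assoc, (hv β).mul_comm (hw α),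
    T.jacobi]
  simp only [map_smul, smul_mul_assoc, smul_smul, ← add_smul]
  congr 1
  generalize T.εA α = x; generalize T.εA β = y
  generalize ∑ σ, T.F σ α β * T.F δ σ γ = F; generalize ∑ σ, T.F δ β σ * T.F σ α γ = G
  rcases zmod_two_eq x with rfl | rfl <;> rcases zmod_two_eq y with rfl | rfl <;>
    rcases zmod_two_eq p with rfl | rfl <;> rcases zmod_two_eq q with rfl | rfl <;>
    simp [show (1 + 1 : ZMod 2) = 0 from rfl] <;> ring

/-- The derivation acts from the right and so crosses u with sign (-1)^{ε_γ+q}; the factor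
(-1)^{ε_γ} is cancelled by commuting s^a with the sign built into the bracket. -/
theorem sV_br {q : ZMod 2} (a : Fin 2) (v : 𝒜 → T.Fn) {u : 𝒜 → T.Fn}
    (hu : T.VecParity q u) :
    T.sV a (T.br v u) = T.br v (T.sV a u) + sgn q • T.br (T.sV a v) u := by
  funext α
  rw [sV_apply, Pi.add_apply, Pi.smul_apply, br_apply, br_apply, br_apply, s_sum,
    Finset.smul_sum, ← Finset.sum_add_distrib]
  refine Finset.sum_congr rfl fun β _ => ?_
  rw [s_sum, Finset.smul_sum, ← Finset.sum_add_distrib]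
  refine Finset.sum_congr rfl fun γ _ => ?_
  rw [s_smul, s_mul, parityPow_s, show parityAut T.par η (u γ) = sgn (T.εA γ + q) • u γ from hu γ,
    smul_mul_smul_comm, sgn_add, sgn_mul_sgn_mul, smul_add, smul_comm (sgn q)]
  rfl

end GaugeTheory

namespace GaugeTheory

variable {I 𝒜 η : Type*} [Fintype I] [Fintype 𝒜] [DecidableEq I] [DecidableEq 𝒜]
  [DecidableEq η] {T : GaugeTheory I 𝒜 η}

/-! ### The BRST-antiBRST algebra -/

theorem sum_neg_sum_comm {V : Type*} [AddCommGroup V] (g : 𝒜 → 𝒜 → 𝒜 → 𝒜 → V) :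
    ∑ γ, ∑ σ, -∑ β, ∑ ρ, g β γ ρ σ = -∑ β, ∑ γ, ∑ ρ, ∑ σ, g β γ ρ σ := by
  simp only [Finset.sum_neg_distrib]
  congr 1
  rw [Finset.sum_comm (s := Finset.univ) (t := Finset.univ) (f := fun β γ => ∑ ρ, ∑ σ, g β γ ρ σ)]
  refine Finset.sum_congr rfl fun γ _ => ?_
  rw [Finset.sum_comm]
  refine Finset.sum_congr rfl fun β _ => ?_
  rw [Finset.sum_comm]

theorem neg_sum_smul_sum_comm {V : Type*} [AddCommGroup V] [Module ℂ V]
    (k : 𝒜 → 𝒜 → 𝒜 → 𝒜 → ℂ) (e : Fin 2 → Fin 2 → ℂ) (g : 𝒜 → 𝒜 → 𝒜 → Fin 2 → Fin 2 → V) :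
    -∑ β, ∑ γ, ∑ ρ, ∑ σ, ∑ b, ∑ c, (k β γ ρ σ * e c b) • g β γ ρ b c
      = ∑ b, ∑ c, e c b • -∑ β, ∑ γ, ∑ ρ, ∑ σ, k β γ ρ σ • g β γ ρ b c := by
  simp only [Fin.sum_univ_two, smul_neg, Finset.smul_sum, smul_smul, ← neg_add_rev, mul_comm (k _ _ _ _)]
  simp only [Finset.sum_add_distrib]
  abel

/-- Jacobi for v, v, u reads [[v,v],u] = 2[v,[v,u]] for odd v; swapping the even element [v,v] with
u supplies the minus sign. -/
theorem br_self_br_self {v u : 𝒜 → T.Fn} (hv : T.VecParity 1 v) (hu : T.VecParity 1 u) :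
    T.br u (T.br v v) = (-2 : ℂ) • T.br v (T.br v u) := by
  have h := br_jacobi hv hv u
  rw [br_swap (hv.br hv) hu] at h
  simp only [mul_one, sgn_one, show (1 + 1 : ZMod 2) = 0 from rfl, sgn_zero,
    one_smul, neg_smul] at h
  rw [neg_smul, two_smul]
  nth_rw 1 [h]
  abel

theorem br_br_self {v : 𝒜 → T.Fn} (hv : T.VecParity 1 v) : T.br v (T.br v v) = 0 := by
  have h := br_self_br_self hv hv
  -- For u = v the preceding identity is x = -2x.
  have : (3 : ℂ) • T.br v (T.br v v) = 0 := by
    rw [show (3 : ℂ) = 1 - (-2) by norm_num, sub_smul, one_smul, ← h, sub_self]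
  exact (smul_eq_zero.1 this).resolve_left (by norm_num)

theorem br_br_self_even {v : 𝒜 → T.Fn} (hv : T.VecParity 1 v) (u : 𝒜 → T.Fn) :
    T.br (T.br v v) u = (2 : ℂ) • T.br v (T.br v u) := by
  have h := br_jacobi hv hv u
  simp only [mul_one, sgn_one, neg_smul, one_smul] at h
  rw [two_smul]
  nth_rw 1 [h]
  abel

theorem br_self_of_even {v : 𝒜 → T.Fn} (hv : T.VecParity 0 v) : T.br v v = 0 := by
  have h := br_swap hv hv
  simp only [mul_zero, sgn_zero, one_smul] at h
  have : (2 : ℂ) • T.br v v = 0 := by rw [two_smul]; nth_rw 1 [h]; simp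
  exact (smul_eq_zero.1 this).resolve_left (by norm_num)

variable (T)

/-- The ghosts `C^a = T_α C^{αa}`. -/
def ghostV (a : Fin 2) : 𝒜 → T.Fn := fun α => T.ghost α a

theorem vecParity_ghostV (a : Fin 2) : T.VecParity 1 (T.ghostV a) := fun α => T.hasParity_ghost α a

/-- Dictionary between the component formulas and the bracket: the quadratic ghost term of s^a C^b
becomes +(1/2)[C^a, C^b]. -/
theorem br_ghostV (a b : Fin 2) (α : 𝒜) :
    T.br (T.ghostV a) (T.ghostV b) α
      = -∑ β, ∑ γ, (sgn (T.εA β) * T.F α β γ) • (T.ghost γ b * T.ghost β a) := by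
  rw [br_apply, ← Finset.sum_neg_distrib]
  refine Finset.sum_congr rfl fun β _ => ?_
  rw [← Finset.sum_neg_distrib]
  refine Finset.sum_congr rfl fun γ _ => ?_
  rw [(T.vecParity_ghostV a β).parityPow, smul_mul_assoc,
    (T.vecParity_ghostV a β).mul_comm (T.vecParity_ghostV b γ), smul_smul, smul_smul, ← neg_smul]
  change _ • (T.ghost γ b * T.ghost β a) = _
  congr 1
  generalize T.F α β γ = F; generalize T.εA β = x; generalize T.εA γ = y
  rcases zmod_two_eq x with rfl | rfl <;> rcases zmod_two_eq y with rfl | rfl <;>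
    simp [show (1 + 1 : ZMod 2) = 0 from rfl]

theorem X_ghost (α : 𝒜) (a b : Fin 2) :
    T.X (Sum.inr (Sum.inl (α, b))) a
      = -(epsUp a b • T.nl α) + (1 / 2 : ℂ) • T.br (T.ghostV a) (T.ghostV b) α := by
  rw [br_ghostV, smul_neg, ← sub_eq_add_neg]
  rfl

theorem sV_ghostV (a b : Fin 2) :
    T.sV a (T.ghostV b)
      = -(epsUp a b • T.nl) + (1 / 2 : ℂ) • T.br (T.ghostV a) (T.ghostV b) := by
  funext α
  exact (T.s_coord a (Sum.inr (Sum.inl (α, b)))).trans (T.X_ghost α a b)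

/-- In nested-bracket form, the later algebra of the s^a on ghosts and B uses only antisymmetry and
Jacobi. -/
theorem X₂_eq (a : Fin 2) :
    (fun α => T.X₂ α a) = -((1 / 2 : ℂ) • T.br (T.ghostV a) T.nl)
      + (1 / 12 : ℂ) • ∑ b, ∑ c, epsLow c b •
        T.br (T.ghostV c) (T.br (T.ghostV a) (T.ghostV b)) := by
  funext α
  have h1 : T.br (T.ghostV a) T.nl α = ∑ γ, ∑ β, T.F α γ β • (T.nl β * T.ghost γ a) := by
    rw [br_apply]
    refine Finset.sum_congr rfl fun γ _ => Finset.sum_congr rfl fun β _ => ?_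
    rw [(T.vecParity_ghostV a γ).parityPow, smul_mul_assoc,
      (T.vecParity_ghostV a γ).mul_comm (T.hasParity_nl β), smul_smul, smul_smul,
      mul_comm (T.εA β), mul_assoc, sgn_mul_sgn, mul_one]
    rfl
  have h2 : ∀ b c, T.br (T.ghostV c) (T.br (T.ghostV a) (T.ghostV b)) α
      = -∑ β, ∑ γ, ∑ ρ, ∑ σ, (sgn (T.εA β) * T.F α γ σ * T.F σ β ρ) •
        (T.ghost ρ b * T.ghost β a * T.ghost γ c) := by
    intro b c
    have h3 : T.br (T.ghostV c) (T.br (T.ghostV a) (T.ghostV b)) α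
        = ∑ γ, ∑ σ, T.F α γ σ • (T.br (T.ghostV a) (T.ghostV b) σ * T.ghost γ c) := by
      rw [br_apply]
      refine Finset.sum_congr rfl fun γ _ => Finset.sum_congr rfl fun σ _ => ?_
      have h4 : HasParity (T.εA σ) (T.br (T.ghostV a) (T.ghostV b) σ) :=
        ((T.vecParity_ghostV a).br (T.vecParity_ghostV b) σ).of_eq (by
          rw [show (1 + 1 : ZMod 2) = 0 from rfl, add_zero])
      rw [(T.vecParity_ghostV c γ).parityPow, smul_mul_assoc,
        (T.vecParity_ghostV c γ).mul_comm h4, smul_smul, smul_smul,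
        mul_comm (T.εA σ), mul_assoc, sgn_mul_sgn, mul_one]
      rfl
    have h5 : ∀ γ σ, T.F α γ σ • (T.br (T.ghostV a) (T.ghostV b) σ * T.ghost γ c)
        = -∑ β, ∑ ρ, (sgn (T.εA β) * T.F α γ σ * T.F σ β ρ) •
        (T.ghost ρ b * T.ghost β a * T.ghost γ c) := by
      intro γ σ
      rw [br_ghostV, neg_mul, smul_neg, Finset.sum_mul, Finset.smul_sum]
      refine congrArg Neg.neg (Finset.sum_congr rfl fun β _ => ?_)
      rw [Finset.sum_mul, Finset.smul_sum]
      refine Finset.sum_congr rfl fun ρ _ => ?_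
      rw [smul_mul_assoc, smul_smul]
      congr 1
      ring
    rw [h3, Finset.sum_congr rfl fun γ _ => Finset.sum_congr rfl fun σ _ => h5 γ σ]
    exact sum_neg_sum_comm (𝒜 := 𝒜) fun β γ ρ σ => (sgn (T.εA β) * T.F α γ σ * T.F σ β ρ) •
        (T.ghost ρ b * T.ghost β a * T.ghost γ c)
  have h6 : (∑ b, ∑ c, epsLow c b • T.br (T.ghostV c) (T.br (T.ghostV a) (T.ghostV b))) α
      = ∑ b, ∑ c, epsLow c b • -∑ β, ∑ γ, ∑ ρ, ∑ σ, (sgn (T.εA β) * T.F α γ σ * T.F σ β ρ) •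
        (T.ghost ρ b * T.ghost β a * T.ghost γ c) := by
    rw [Finset.sum_apply]
    refine Finset.sum_congr rfl fun b _ => ?_
    rw [Finset.sum_apply]
    refine Finset.sum_congr rfl fun c _ => ?_
    rw [Pi.smul_apply, h2]
  rw [X₂, Pi.add_apply, Pi.neg_apply, Pi.smul_apply, Pi.smul_apply, h1, h6, sub_eq_add_neg,
    ← smul_neg (1 / 12 : ℂ)]
  congr 2
  exact neg_sum_smul_sum_comm (𝒜 := 𝒜)
    (fun β γ ρ σ => sgn (T.εA β) * T.F α γ σ * T.F σ β ρ) (fun c b => epsLow c b)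
    fun β γ ρ b c => T.ghost ρ b * T.ghost β a * T.ghost γ c

theorem sV_nl (a : Fin 2) : T.sV a T.nl = fun α => T.X₂ α a :=
  funext fun α => T.s_coord a (Sum.inr (Sum.inr α))

/-- By Jacobi [C^2,[C^1,C^1]] = -2[C^1,[C^1,C^2]], so the cubic terms add up to 3·(1/12) = 1/4 of a
single double bracket. This is the amount that completes B to s^2 C^1. -/
theorem sV_nl_zero : T.sV 0 T.nl = (-(1 / 2) : ℂ) • T.br (T.ghostV 0) (T.sV 1 (T.ghostV 0)) := by
  have h := br_self_br_self (T.vecParity_ghostV 0) (T.vecParity_ghostV 1)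
  have h' := br_swap (T.vecParity_ghostV 1) (T.vecParity_ghostV 0)
  simp only [mul_one, sgn_one, neg_smul, one_smul, neg_neg] at h'
  rw [sV_nl, X₂_eq, sV_ghostV, h']
  simp only [Fin.sum_univ_two, epsLow, epsUp, Matrix.of_apply, Matrix.cons_val', Matrix.cons_val_zero,
    Matrix.cons_val_one, Matrix.cons_val_fin_one, zero_smul, neg_smul, one_smul, h, map_add,
    map_smul, zero_add, add_zero, neg_neg]
  module

theorem sV_nl_one : T.sV 1 T.nl = (1 / 2 : ℂ) • T.br (T.ghostV 1) (T.sV 0 (T.ghostV 1)) := by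
  have h := br_self_br_self (T.vecParity_ghostV 1) (T.vecParity_ghostV 0)
  have h' := br_swap (T.vecParity_ghostV 1) (T.vecParity_ghostV 0)
  simp only [mul_one, sgn_one, neg_smul, one_smul, neg_neg] at h'
  rw [h'] at h
  rw [sV_nl, X₂_eq, sV_ghostV]
  simp only [h', Fin.sum_univ_two, epsLow, epsUp, Matrix.of_apply, Matrix.cons_val', Matrix.cons_val_zero,
    Matrix.cons_val_one, Matrix.cons_val_fin_one, zero_smul, neg_smul, one_smul, h, map_add,
    map_neg, map_smul, zero_add, add_zero, neg_neg]
  module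

/-- After s^a is distributed over the bracket, the Jacobi consequences reduce each of the eight
index choices to a linear identity among brackets [C,B] and a few double ghost brackets. -/
theorem sV_sV_ghostV (a b c : Fin 2) :
    T.sV a (T.sV b (T.ghostV c)) = (2 * epsUp a b) • T.sV c T.nl := by
  have hs : ∀ x y, T.sV x (T.ghostV y)
      = -(epsUp x y • T.nl) + (1 / 2 : ℂ) • T.br (T.ghostV x) (T.ghostV y) := T.sV_ghostV
  have e00 := br_br_self (T.vecParity_ghostV 0)
  have e11 := br_br_self (T.vecParity_ghostV 1)
  have e10 := br_self_br_self (T.vecParity_ghostV 0) (T.vecParity_ghostV 1)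
  have e01 := br_self_br_self (T.vecParity_ghostV 1) (T.vecParity_ghostV 0)
  have hsw := br_swap (T.vecParity_ghostV 1) (T.vecParity_ghostV 0)
  simp only [mul_one, sgn_one, neg_smul, one_smul, neg_neg] at hsw
  have key : ∀ x y z, T.br (T.sV x (T.ghostV y)) (T.ghostV z)
      = -T.br (T.ghostV z) (T.sV x (T.ghostV y)) := by
    intro x y z
    have := br_swap ((T.vecParity_ghostV y).sV x) (T.vecParity_ghostV z)
    simpa only [show (1 + 1 : ZMod 2) = 0 from rfl, zero_mul, sgn_zero, one_smul] using this
  rw [hs b c, map_add, map_neg, map_smul, map_smul,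
    sV_br a (T.ghostV b) (T.vecParity_ghostV c), key]
  fin_cases a <;> fin_cases b <;> fin_cases c <;>
  simp only [Fin.zero_eta, Fin.mk_one, sV_nl_zero, sV_nl_one, hs, epsUp, Matrix.of_apply,
    Matrix.cons_val',
    Matrix.cons_val_zero, Matrix.cons_val_one, Matrix.cons_val_fin_one, zero_smul, neg_smul,
    one_smul, map_add, map_neg, map_smul, zero_add, add_zero, neg_neg, hsw, e00, e11, e10, e01,
    sgn_one, smul_zero, neg_zero] <;> module

/-- Up to a factor s^b B is [C^b, u] with u = s^c C^b even and c ≠ b. For a = b the two Leibniz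
terms cancel by [[C,C],u] = 2[C,[C,u]]; for a ≠ b one has s^a u = 0 and [u,u] = 0. -/
theorem sV_sV_nl (a b : Fin 2) : T.sV a (T.sV b T.nl) = 0 := by
  have p01 : T.VecParity 0 (T.sV 0 (T.ghostV 1)) := (T.vecParity_ghostV 1).sV 0
  have p10 : T.VecParity 0 (T.sV 1 (T.ghostV 0)) := (T.vecParity_ghostV 0).sV 1
  have d : ∀ x, T.sV x (T.ghostV x) = (1 / 2 : ℂ) • T.br (T.ghostV x) (T.ghostV x) := by
    intro x
    rw [sV_ghostV, show epsUp x x = 0 by fin_cases x <;> simp [epsUp]]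
    simp
  fin_cases b
  · change T.sV a (T.sV 0 T.nl) = 0
    rw [sV_nl_zero, map_smul, sV_br a _ p10, sV_sV_ghostV]
    fin_cases a
    · change (-(1 / 2) : ℂ) • (T.br _ ((2 * epsUp 0 1) • T.sV 0 T.nl)
        + sgn 0 • T.br (T.sV 0 (T.ghostV 0)) _) = 0
      rw [d, sV_nl_zero, map_smul T.br, LinearMap.smul_apply,
        br_br_self_even (T.vecParity_ghostV 0)]
      simp only [epsUp, Matrix.of_apply, Matrix.cons_val', Matrix.cons_val_zero,
        Matrix.cons_val_one, Matrix.cons_val_fin_one, sgn_zero, map_smul]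
      module
    · change (-(1 / 2) : ℂ) • (T.br _ ((2 * epsUp 1 1) • T.sV 0 T.nl)
        + sgn 0 • T.br (T.sV 1 (T.ghostV 0)) _) = 0
      rw [br_self_of_even p10]
      simp [epsUp]
  · change T.sV a (T.sV 1 T.nl) = 0
    rw [sV_nl_one, map_smul, sV_br a _ p01, sV_sV_ghostV]
    fin_cases a
    · change ((1 / 2) : ℂ) • (T.br _ ((2 * epsUp 0 0) • T.sV 1 T.nl)
        + sgn 0 • T.br (T.sV 0 (T.ghostV 1)) _) = 0
      rw [br_self_of_even p01]
      simp [epsUp]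
    · change ((1 / 2) : ℂ) • (T.br _ ((2 * epsUp 1 0) • T.sV 1 T.nl)
        + sgn 0 • T.br (T.sV 1 (T.ghostV 1)) _) = 0
      rw [d, sV_nl_one, map_smul T.br, LinearMap.smul_apply,
        br_br_self_even (T.vecParity_ghostV 1)]
      simp only [epsUp, Matrix.of_apply, Matrix.cons_val', Matrix.cons_val_zero,
        Matrix.cons_val_one, Matrix.cons_val_fin_one, sgn_zero, map_smul]
      module

end GaugeTheory

/-! ### The Sp(2) algebra on classical fields and on arbitrary functionals, and the divergence of
the generators. -/

namespace GaugeTheory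

variable {I 𝒜 η : Type*} [Fintype I] [Fintype 𝒜] [DecidableEq I] [DecidableEq 𝒜]
  [DecidableEq η] (T : GaugeTheory I 𝒜 η)

theorem s_R (a : Fin 2) (i : I) (α : 𝒜) :
    T.s a (T.R i α) = ∑ β, (∑ j, rderiv (Sum.inl j) (T.R i α) * T.R j β) * T.ghost β a := by
  rw [s, Fintype.sum_sum_type]
  rw [Finset.sum_eq_zero (s := (Finset.univ : Finset ((𝒜 × Fin 2) ⊕ 𝒜)))
    (fun k _ => by rw [T.R_indep, zero_mul]), add_zero]
  have h : ∀ j, rderiv (Sum.inl j) (T.R i α) * T.X (Sum.inl j) a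
      = ∑ β, rderiv (Sum.inl j) (T.R i α) * T.R j β * T.ghost β a := by
    intro j
    change _ * ∑ β, T.R j β * T.ghost β a = _
    rw [Finset.mul_sum]
    exact Finset.sum_congr rfl fun β _ => (mul_assoc _ _ _).symm
  rw [Finset.sum_congr rfl fun j _ => h j, Finset.sum_comm]
  exact Finset.sum_congr rfl fun β _ => (Finset.sum_mul _ _ _).symm

/-- The sum `(-1)^{ε_α} R^i_{α,j} R^j_β C^{βb} C^{αa}`. -/
def ghostQuad (i : I) (a b : Fin 2) : T.Fn :=
  ∑ α, ∑ β, sgn (T.εA α) •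
    ((∑ j, rderiv (Sum.inl j) (T.R i α) * T.R j β) * (T.ghost β b * T.ghost α a))

/-- Symmetrizing in the Sp(2) indices amounts to graded antisymmetrization in α, β because of the
ghost statistics, so the closed gauge algebra applies. -/
theorem ghostQuad_add_swap (i : I) (a b : Fin 2) :
    T.ghostQuad i a b + T.ghostQuad i b a
      = ∑ γ, T.R i γ * T.br (T.ghostV a) (T.ghostV b) γ := by
  have h1 : T.ghostQuad i b a = ∑ α, ∑ β, -(sgn (T.εA α) • (sgn (T.εA α * T.εA β) •
      (∑ j, rderiv (Sum.inl j) (T.R i β) * T.R j α) * (T.ghost β b * T.ghost α a))) := by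
    rw [ghostQuad, Finset.sum_comm]
    refine Finset.sum_congr rfl fun α _ => Finset.sum_congr rfl fun β _ => ?_
    rw [(T.hasParity_ghost α a).mul_comm (T.hasParity_ghost β b), mul_smul_comm, smul_smul,
      smul_mul_assoc, smul_smul, ← neg_smul]
    congr 1
    generalize T.εA α = x; generalize T.εA β = y
    rcases zmod_two_eq x with rfl | rfl <;> rcases zmod_two_eq y with rfl | rfl <;>
      simp [show (1 + 1 : ZMod 2) = 0 from rfl]
  have h2 : ∀ γ, T.R i γ * T.br (T.ghostV a) (T.ghostV b) γ
      = ∑ α, ∑ β, -(sgn (T.εA α) • (T.F γ α β • T.R i γ * (T.ghost β b * T.ghost α a))) := by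
    intro γ
    rw [br_ghostV, mul_neg, Finset.mul_sum, ← Finset.sum_neg_distrib]
    refine Finset.sum_congr rfl fun α _ => ?_
    rw [Finset.mul_sum, ← Finset.sum_neg_distrib]
    refine Finset.sum_congr rfl fun β _ => ?_
    rw [mul_smul_comm, smul_mul_assoc, smul_smul]
  rw [h1, ghostQuad, ← Finset.sum_add_distrib, Finset.sum_congr rfl fun γ _ => h2 γ,
    Finset.sum_comm]
  refine Finset.sum_congr rfl fun α _ => ?_
  rw [← Finset.sum_add_distrib, Finset.sum_comm]
  refine Finset.sum_congr rfl fun β _ => ?_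
  rw [← sub_eq_add_neg, ← smul_sub, ← sub_mul, T.closed, Finset.sum_neg_distrib, ← Finset.smul_sum,
    ← Finset.sum_mul, neg_mul, smul_neg]

theorem Y_inl (i : I) :
    T.Y (Sum.inl i) = (∑ α, T.R i α * T.nl α)
      + (1 / 2 : ℂ) • (T.ghostQuad i 1 0 - T.ghostQuad i 0 1) := by
  change _ + _ = _
  congr 2
  have h : ∀ α β, (∑ j, ∑ a, ∑ b, (sgn (T.εA α) * epsLow a b) •
      (rderiv (Sum.inl j) (T.R i α) * T.R j β * T.ghost β b * T.ghost α a))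
      = sgn (T.εA α) •
        ((∑ j, rderiv (Sum.inl j) (T.R i α) * T.R j β) * (T.ghost β 0 * T.ghost α 1))
      - sgn (T.εA α) •
        ((∑ j, rderiv (Sum.inl j) (T.R i α) * T.R j β) * (T.ghost β 1 * T.ghost α 0)) := by
    intro α β
    rw [Finset.sum_mul, Finset.sum_mul, Finset.smul_sum, Finset.smul_sum, ← Finset.sum_sub_distrib]
    refine Finset.sum_congr rfl fun j _ => ?_
    simp only [Fin.sum_univ_two, epsLow, Matrix.of_apply, Matrix.cons_val',
      Matrix.cons_val_zero, Matrix.cons_val_one, Matrix.cons_val_fin_one, mul_zero, zero_smul,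
      mul_one, mul_neg, neg_smul, zero_add, add_zero, mul_assoc]
    rw [sub_eq_add_neg, add_comm]
  rw [Finset.sum_congr rfl fun α _ => Finset.sum_congr rfl fun β _ => h α β, ghostQuad, ghostQuad]
  simp only [Finset.sum_sub_distrib]

/-- The part of the quadratic ghost term symmetric in a, b cancels the bracket in s^b C^a by closure
of the algebra. The antisymmetric part, together with the B term, is Y. -/
theorem s_X_inl (i : I) (a b : Fin 2) :
    T.s b (T.X (Sum.inl i) a) = epsUp a b • T.Y (Sum.inl i) := by
  have h1 : T.s b (T.X (Sum.inl i) a)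
      = -(epsUp b a • ∑ α, T.R i α * T.nl α)
        + (1 / 2 : ℂ) • (∑ γ, T.R i γ * T.br (T.ghostV b) (T.ghostV a) γ)
        - T.ghostQuad i a b := by
    change T.s b (∑ α, T.R i α * T.ghost α a) = _
    rw [s_sum, Finset.smul_sum, Finset.smul_sum, ← Finset.sum_neg_distrib,
      ← Finset.sum_add_distrib, ghostQuad, ← Finset.sum_sub_distrib]
    refine Finset.sum_congr rfl fun α _ => ?_
    rw [s_mul, show T.s b (T.ghost α a) = _ from
      (T.s_coord b (Sum.inr (Sum.inl (α, a)))).trans (T.X_ghost α b a),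
      show parityAut T.par η (T.ghost α a) = sgn (T.εA α + 1) • T.ghost α a from
      T.hasParity_ghost α a, s_R, mul_add, mul_neg, mul_smul_comm, mul_smul_comm, sub_eq_add_neg]
    congr 1
    rw [Finset.sum_mul, ← Finset.sum_neg_distrib]
    refine Finset.sum_congr rfl fun β _ => ?_
    rw [mul_smul_comm, mul_assoc, sgn_add, sgn_one, mul_neg_one, neg_smul]
  rw [h1, ← ghostQuad_add_swap, Y_inl]
  generalize T.ghostQuad i = S
  generalize ∑ α, T.R i α * T.nl α = N
  fin_cases a <;> fin_cases b <;>
    simp only [Fin.zero_eta, Fin.mk_one, epsUp, Matrix.of_apply, Matrix.cons_val',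
      Matrix.cons_val_zero, Matrix.cons_val_one, Matrix.cons_val_fin_one] <;> module

theorem s_X (A : FieldIx I 𝒜) (a b : Fin 2) : T.s b (T.X A a) = epsUp a b • T.Y A := by
  rcases A with i | ⟨α, c⟩ | α
  · exact T.s_X_inl i a b
  · have h := congrFun (T.sV_sV_ghostV b a c) α
    rw [sV_nl] at h
    rw [← T.s_coord]
    refine h.trans ?_
    change (2 * epsUp b a) • T.X₂ α c = epsUp a b • -((2 : ℂ) • T.X₂ α c)
    rw [show epsUp b a = -epsUp a b by fin_cases a <;> fin_cases b <;> simp [epsUp]]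
    module
  · have h := congrFun (T.sV_sV_nl b a) α
    rw [← T.s_coord]
    refine h.trans ?_
    change 0 = epsUp a b • (0 : T.Fn)
    rw [smul_zero]

theorem epsUp_swap (a b : Fin 2) : epsUp b a = -epsUp a b := by
  fin_cases a <;> fin_cases b <;> simp [epsUp]

theorem s_s_eq (a b : Fin 2) (f : T.Fn) :
    T.s a (T.s b f) = epsUp b a • (∑ B, rderiv B f * T.Y B)
      + ∑ B, ∑ A, sgn (T.par B + 1) • (rderiv A (rderiv B f) * (T.X A a * T.X B b)) := by
  rw [show T.s b f = ∑ B, rderiv B f * T.X B b from rfl, s_sum, Finset.smul_sum,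
    ← Finset.sum_add_distrib]
  refine Finset.sum_congr rfl fun B _ => ?_
  rw [s_mul, s_X, mul_smul_comm, show parityAut T.par η (T.X B b) = sgn (T.par B + 1) • T.X B b from
    T.hasParity_X B b, mul_smul_comm, s, Finset.sum_mul, Finset.smul_sum]
  congr 1
  refine Finset.sum_congr rfl fun A _ => ?_
  rw [mul_assoc]

/-- The first-derivative part is antisymmetric through ε^{ab}; the second-derivative part is so
because the graded symmetry of f_{,BA} and the statistics of the X's leave one net minus sign. -/
theorem s_s_anticomm (a b : Fin 2) (f : T.Fn) : T.s a (T.s b f) = -T.s b (T.s a f) := by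
  rw [s_s_eq, s_s_eq, epsUp_swap a b, neg_smul, neg_add]
  congr 1
  rw [Finset.sum_comm, ← Finset.sum_neg_distrib]
  refine Finset.sum_congr rfl fun A _ => ?_
  rw [← Finset.sum_neg_distrib]
  refine Finset.sum_congr rfl fun B _ => ?_
  rw [rderiv_comm A B, (T.hasParity_X A a).mul_comm (T.hasParity_X B b), mul_smul_comm,
    smul_mul_assoc, smul_smul, smul_smul, ← neg_smul]
  congr 1
  generalize T.par A = x; generalize T.par B = y
  rcases zmod_two_eq x with rfl | rfl <;> rcases zmod_two_eq y with rfl | rfl <;>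
    simp [show (1 + 1 : ZMod 2) = 0 from rfl]

theorem s_s_self (a : Fin 2) (f : T.Fn) : T.s a (T.s a f) = 0 := by
  have h := T.s_s_anticomm a a f
  have : (2 : ℂ) • T.s a (T.s a f) = 0 := by rw [two_smul]; nth_rw 1 [h]; simp
  exact (smul_eq_zero.1 this).resolve_left (by norm_num)

theorem s_s_s (a b c : Fin 2) (f : T.Fn) : T.s a (T.s b (T.s c f)) = 0 := by
  -- Three indices with two values: two coincide, and anticommutation brings them together.
  have h : a = b ∨ b = c ∨ a = c := by revert a b c; decide
  rcases h with rfl | rfl | rfl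
  · exact T.s_s_self _ _
  · rw [s_s_self, s_zero]
  · rw [T.s_s_anticomm b a f, s_neg, s_s_self, neg_zero]

/-- Y^A = s^2 s^1 φ^A, so this is a triple product of generators. -/
theorem s_Y (a : Fin 2) (A : FieldIx I 𝒜) : T.s a (T.Y A) = 0 := by
  have h := T.s_X A 0 1
  rw [show epsUp 0 1 = 1 by simp [epsUp], one_smul] at h
  rw [← h, ← T.s_coord, s_s_s]

theorem hasParity_Y (A : FieldIx I 𝒜) : HasParity (T.par A) (T.Y A) := by
  have h := T.s_X A 0 1
  rw [show epsUp 0 1 = 1 by simp [epsUp], one_smul] at h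
  rw [← h]
  refine (T.hasParity_s (T.hasParity_X A 0) 1).of_eq ?_
  rw [add_assoc, show (1 + 1 : ZMod 2) = 0 from rfl, add_zero]

/-! ### The divergence of the generators -/

theorem rderiv_ghost (A : FieldIx I 𝒜) (α : 𝒜) (a : Fin 2) :
    rderiv A (T.ghost α a) = if A = Sum.inr (Sum.inl (α, a)) then 1 else 0 := rderiv_coord _ _

theorem rderiv_nl (A : FieldIx I 𝒜) (α : 𝒜) :
    rderiv A (T.nl α) = if A = Sum.inr (Sum.inr α) then 1 else 0 := rderiv_coord _ _

/-- The supertrace `(-1)^{ε_β} F^β_{αβ}`. -/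
def strF (α : 𝒜) : ℂ := ∑ β, sgn (T.εA β) * T.F β α β

/-- Only even gauge indices enter the supertrace of the structure constants, so all signs involving
ε_α disappear from the divergence. -/
theorem F_diag_parity {α β : 𝒜} (h : T.F β α β ≠ 0) : T.εA α = 0 := by
  have := T.F_parity _ _ _ h
  exact right_eq_add.mp (this.trans (add_comm _ _) |>.trans (add_comm _ _))

theorem div_X_inl (a : Fin 2) :
    ∑ i, rderiv (Sum.inl i) (T.X (Sum.inl i) a) = -∑ α, T.strF α • T.ghost α a := by
  have h : ∀ i, rderiv (Sum.inl i) (T.X (Sum.inl i) a)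
      = ∑ α, (sgn (T.εI i * (T.εA α + 1)) • rderiv (Sum.inl i) (T.R i α)) * T.ghost α a := by
    intro i
    change rderiv (Sum.inl i) (∑ α, T.R i α * T.ghost α a) = _
    rw [map_sum]
    refine Finset.sum_congr rfl fun α _ => ?_
    rw [rderiv_mul, rderiv_ghost, if_neg (by simp), mul_zero, zero_add,
      (T.hasParity_ghost α a).parityPow, mul_smul_comm, smul_mul_assoc]
    rfl
  rw [Finset.sum_congr rfl fun i _ => h i, Finset.sum_comm, ← Finset.sum_neg_distrib]
  refine Finset.sum_congr rfl fun α _ => ?_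
  rw [← Finset.sum_mul, eq_neg_of_add_eq_zero_left (T.measure_inv α), neg_mul, ← Algebra.smul_def]
  rfl

/-- Differentiating the factor C^{γb} gives 1/2 for each of the two values of b, and the factor
C^{βa} gives a further 1/2 when b = a: in total 3/2. -/
theorem div_X_ghost (a : Fin 2) :
    ∑ k : 𝒜 × Fin 2, rderiv (Sum.inr (Sum.inl k)) (T.X (Sum.inr (Sum.inl k)) a)
      = (3 / 2 : ℂ) • ∑ α, T.strF α • T.ghost α a := by
  have h : ∀ α b, rderiv (Sum.inr (Sum.inl (α, b))) (T.X (Sum.inr (Sum.inl (α, b))) a)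
      = (1 / 2 : ℂ) • (∑ β, if b = a then (sgn (T.εA α) * T.F α β α) • T.ghost β a else 0)
        + (1 / 2 : ℂ) • ∑ β, (sgn (T.εA α) * T.F α β α) • T.ghost β a := by
    intro α b
    change rderiv (Sum.inr (Sum.inl (α, b))) (-(epsUp a b • T.nl α)
        - (1 / 2 : ℂ) • ∑ β, ∑ γ, (sgn (T.εA β) * T.F α β γ) • (T.ghost γ b * T.ghost β a)) = _
    have h1 : ∀ β γ, rderiv (Sum.inr (Sum.inl (α, b)))
        ((sgn (T.εA β) * T.F α β γ) • (T.ghost γ b * T.ghost β a))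
        = (if β = α then (if b = a then (sgn (T.εA α) * T.F α α γ) • T.ghost γ a else 0) else 0)
          + if γ = α then -((sgn (T.εA α) * T.F α β α) • T.ghost β a) else 0 := by
      intro β γ
      rw [map_smul, rderiv_mul, rderiv_ghost, rderiv_ghost, (T.hasParity_ghost β a).parityPow,
        smul_add]
      congr 1
      · by_cases hβ : β = α
        · subst hβ
          by_cases hb : b = a
          · subst hb; simp only [if_true, mul_one]
          · simp [hb]
        · simp [hβ, Ne.symm hβ]
      · by_cases hγ : γ = α
        · subst hγ
          rw [if_pos rfl, if_pos rfl, one_mul, smul_smul, ← neg_smul]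
          by_cases hF : T.F γ β γ = 0
          · simp [hF]
          · change (_ * sgn ((T.εA γ + 1) * (T.εA β + 1))) • _ = _
            rw [T.F_diag_parity hF]
            simp [sgn_add, mul_comm]
        · rw [if_neg (by simpa using Ne.symm hγ), if_neg hγ, zero_mul, smul_zero]
    have h2 : ∀ γ, sgn (T.εA α) * T.F α α γ = -(sgn (T.εA α) * T.F α γ α) := by
      intro γ
      rw [T.F_antisymm α α γ]
      by_cases hF : T.F α γ α = 0
      · simp [hF]
      · rw [T.F_diag_parity hF]; simp
    rw [map_sub, map_neg, map_smul, map_smul, rderiv_nl, if_neg (by simp), smul_zero, neg_zero,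
      zero_sub, map_sum]
    simp only [map_sum, h1, Finset.sum_add_distrib, Finset.sum_ite_eq', Finset.mem_univ, if_true,
      Finset.sum_neg_distrib, h2, neg_smul]
    rw [Finset.sum_comm]
    simp only [Finset.sum_ite_eq', Finset.mem_univ, if_true]
    by_cases hb : b = a
    · simp only [if_pos hb, Finset.sum_neg_distrib]
      module
    · simp only [if_neg hb, Finset.sum_const_zero]
      module
  have h3 : ∑ α, ∑ β, (sgn (T.εA α) * T.F α β α) • T.ghost β a = ∑ α, T.strF α • T.ghost α a := by
    rw [Finset.sum_comm]
    exact Finset.sum_congr rfl fun β _ => (Finset.sum_smul).symm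
  rw [Fintype.sum_prod_type]
  have h4 : ∀ α, ∑ b, rderiv (Sum.inr (Sum.inl (α, b))) (T.X (Sum.inr (Sum.inl (α, b))) a)
      = (3 / 2 : ℂ) • ∑ β, (sgn (T.εA α) * T.F α β α) • T.ghost β a := by
    intro α
    rw [Fin.sum_univ_two, h, h]
    fin_cases a
    · simp only [Fin.zero_eta, if_true, one_ne_zero, if_false, Finset.sum_const_zero]
      module
    · simp only [Fin.mk_one, if_true, zero_ne_one, if_false, Finset.sum_const_zero]
      module
  rw [Finset.sum_congr rfl fun α _ => h4 α, ← Finset.smul_sum, h3]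

theorem div_X_nl (a : Fin 2) :
    ∑ α, rderiv (Sum.inr (Sum.inr α)) (T.X (Sum.inr (Sum.inr α)) a)
      = -((1 / 2 : ℂ) • ∑ α, T.strF α • T.ghost α a) := by
  have h : ∀ α, rderiv (Sum.inr (Sum.inr α)) (T.X (Sum.inr (Sum.inr α)) a)
      = -((1 / 2 : ℂ) • ∑ γ, (sgn (T.εA α) * T.F α γ α) • T.ghost γ a) := by
    intro α
    have hg : ∀ γ c, rderiv (Sum.inr (Sum.inr α)) (T.ghost γ c) = 0 := fun γ c => by
      rw [rderiv_ghost, if_neg (by simp)]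
    have h1 : ∀ β γ, rderiv (Sum.inr (Sum.inr α)) (T.F α γ β • (T.nl β * T.ghost γ a))
        = if β = α then (sgn (T.εA α) * T.F α γ α) • T.ghost γ a else 0 := by
      intro β γ
      rw [map_smul, rderiv_mul, hg, mul_zero, zero_add, rderiv_nl,
        (T.hasParity_ghost γ a).parityPow]
      by_cases hβ : β = α
      · subst hβ
        rw [if_pos rfl, if_pos rfl, one_mul, smul_smul]
        by_cases hF : T.F β γ β = 0
        · simp [hF]
        · change (_ * sgn (T.εA β * (T.εA γ + 1))) • _ = _
          rw [T.F_diag_parity hF, zero_add, mul_one, mul_comm]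
      · rw [if_neg (by simpa using Ne.symm hβ), if_neg hβ, zero_mul, smul_zero]
    change rderiv (Sum.inr (Sum.inr α)) (T.X₂ α a) = _
    rw [X₂, map_sub, map_neg, map_smul, map_smul]
    have h5 : rderiv (Sum.inr (Sum.inr α)) (∑ β, ∑ γ, ∑ ρ, ∑ σ, ∑ b, ∑ c,
        (sgn (T.εA β) * T.F α γ σ * T.F σ β ρ * epsLow c b) •
          (T.ghost ρ b * T.ghost β a * T.ghost γ c)) = 0 := by
      rw [map_sum]; refine Finset.sum_eq_zero fun β _ => ?_
      rw [map_sum]; refine Finset.sum_eq_zero fun γ _ => ?_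
      rw [map_sum]; refine Finset.sum_eq_zero fun ρ _ => ?_
      rw [map_sum]; refine Finset.sum_eq_zero fun σ _ => ?_
      rw [map_sum]; refine Finset.sum_eq_zero fun b _ => ?_
      rw [map_sum]; refine Finset.sum_eq_zero fun c _ => ?_
      rw [map_smul, rderiv_mul, rderiv_mul, hg, hg, hg, mul_zero, mul_zero, zero_mul, add_zero,
        zero_mul, add_zero, smul_zero]
    rw [h5, smul_zero, sub_zero, map_sum]
    congr 2
    refine Finset.sum_congr rfl fun γ _ => ?_
    rw [map_sum, Finset.sum_congr rfl fun β _ => h1 β γ, Finset.sum_ite_eq', if_pos (Finset.mem_univ _)]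
  rw [Finset.sum_congr rfl fun α _ => h α, Finset.sum_neg_distrib, ← Finset.smul_sum,
    Finset.sum_comm]
  congr 2
  exact Finset.sum_congr rfl fun β _ => (Finset.sum_smul).symm

/-- The sectors A^i, C, B contribute -1, 3/2, -1/2 times the same ghost combination; the first
coefficient is where the measure condition enters. -/
theorem div_X (a : Fin 2) : ∑ A, rderiv A (T.X A a) = 0 := by
  rw [Fintype.sum_sum_type, Fintype.sum_sum_type, div_X_inl, div_X_ghost, div_X_nl]
  module

end GaugeTheory

/-! ### The logarithm of power series with a trace -/

section FormalLog

open PowerSeries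

variable {A : Type*} [Ring A]

theorem coeff_mul_of_lt {f g : PowerSeries A} {a b : ℕ} (hf : ∀ k < a, coeff k f = 0)
    (hg : ∀ k < b, coeff k g = 0) {k : ℕ} (hk : k < a + b) : coeff k (f * g) = 0 := by
  rw [coeff_mul]
  refine Finset.sum_eq_zero fun x hx => ?_
  rw [Finset.HasAntidiagonal.mem_antidiagonal] at hx
  by_cases h : x.1 < a
  · rw [hf _ h, zero_mul]
  · rw [hg _ (by omega), mul_zero]

theorem coeff_pow_of_lt' {f : PowerSeries A} (hf : coeff 0 f = 0) (n : ℕ) {k : ℕ} (hk : k < n) :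
    coeff k (f ^ n) = 0 := by
  induction n generalizing k with
  | zero => omega
  | succ n ih =>
    rw [pow_succ]
    exact coeff_mul_of_lt (a := n) (b := 1) (fun k hk => ih hk)
      (fun k hk => by rwa [Nat.lt_one_iff.1 hk]) hk

/-- The Euler derivation `t d/dt`. -/
def eulerD (f : PowerSeries A) : PowerSeries A := mk fun n => n • coeff n f

theorem coeff_eulerD (n : ℕ) (f : PowerSeries A) : coeff n (eulerD f) = n • coeff n f :=
  coeff_mk _ _

theorem eulerD_mul (f g : PowerSeries A) : eulerD (f * g) = eulerD f * g + f * eulerD g := by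
  ext n
  rw [coeff_eulerD, map_add, coeff_mul, coeff_mul, coeff_mul, Finset.smul_sum,
    ← Finset.sum_add_distrib]
  refine Finset.sum_congr rfl fun x hx => ?_
  rw [Finset.HasAntidiagonal.mem_antidiagonal] at hx
  rw [coeff_eulerD, coeff_eulerD, smul_mul_assoc, mul_smul_comm, ← add_smul, hx]

theorem eulerD_add (f g : PowerSeries A) : eulerD (f + g) = eulerD f + eulerD g := by
  ext n
  simp [coeff_eulerD]

theorem eulerD_one : eulerD (1 : PowerSeries A) = 0 := by
  ext n
  rw [coeff_eulerD, coeff_one]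
  split_ifs with h <;> simp [h]

theorem eulerD_monomial (n : ℕ) (a : A) : eulerD (monomial n a) = monomial n (n • a) := by
  ext k
  rw [coeff_eulerD, coeff_monomial, coeff_monomial]
  split_ifs with h <;> simp [h]

variable [Algebra ℂ A] {V : Type*} [AddCommGroup V] [Module ℂ V] (τ : A →ₗ[ℂ] V)

theorem trace_coeff_mul_comm (hτ : ∀ x y, τ (x * y) = τ (y * x)) (N : ℕ) (f g : PowerSeries A) :
    τ (coeff N (f * g)) = τ (coeff N (g * f)) := by
  rw [coeff_mul, coeff_mul, map_sum, map_sum]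
  refine Finset.sum_equiv (Equiv.prodComm ℕ ℕ) (fun x => ?_) fun x _ => hτ _ _
  simp [Finset.HasAntidiagonal.mem_antidiagonal, add_comm]

/-- A cyclic functional lets D(f^{n+1}) be treated as (n+1) f^n Df although f and Df need not
commute. The prefix f^k is carried along for the induction. -/
theorem trace_coeff_eulerD_pow (hτ : ∀ x y, τ (x * y) = τ (y * x)) (N : ℕ) (f : PowerSeries A)
    (n k : ℕ) :
    τ (coeff N (f ^ k * eulerD (f ^ (n + 1))))
      = (n + 1) • τ (coeff N (f ^ (k + n) * eulerD f)) := by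
  induction n generalizing k with
  | zero => simp
  | succ n ih =>
    rw [pow_succ f (n + 1), eulerD_mul, mul_add, map_add, map_add, ← mul_assoc,
      trace_coeff_mul_comm τ hτ, ← mul_assoc, ← pow_succ', ih, ← mul_assoc, ← pow_add,
      succ_nsmul _ (n + 1), show k + 1 + n = k + (n + 1) by omega]

theorem coeff_neg_pow_mul (N j : ℕ) (f g : PowerSeries A) :
    coeff N ((-f) ^ j * g) = ((-1) ^ j : ℂ) • coeff N (f ^ j * g) := by
  rcases Nat.even_or_odd j with h | h
  · simp [h.neg_pow]
  · simp [h.neg_pow]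

theorem logCoeff_succ_mul (j : ℕ) : logCoeff (j + 1) * ((j + 1 : ℕ) : ℂ) = (-1) ^ j := by
  have : ((j + 1 : ℕ) : ℂ) ≠ 0 := by exact_mod_cast Nat.succ_ne_zero j
  rw [logCoeff, neg_mul, div_mul_cancel₀ _ this, pow_succ]
  ring

/-- This is D ln(1+f) = (1+f)^{-1} Df under the trace; D multiplies the coefficient of t^N by N. -/
theorem sum_logCoeff_trace_coeff_pow (hτ : ∀ x y, τ (x * y) = τ (y * x)) {f g : PowerSeries A}
    (hf : coeff 0 f = 0) (hg : g * (1 + f) = 1) (N : ℕ) :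
    (N : ℂ) • ∑ n ∈ Finset.Icc 1 N, logCoeff n • τ (coeff N (f ^ n))
      = τ (coeff N (g * eulerD f)) := by
  have h1 : ∀ j, (N : ℂ) • logCoeff (j + 1) • τ (coeff N (f ^ (j + 1)))
      = τ (coeff N ((-f) ^ j * eulerD f)) := by
    intro j
    have h := trace_coeff_eulerD_pow τ hτ N f j 0
    rw [pow_zero, one_mul, coeff_eulerD, map_nsmul, zero_add, ← Nat.cast_smul_eq_nsmul ℂ,
      ← Nat.cast_smul_eq_nsmul ℂ] at h
    rw [smul_comm, h, smul_smul, logCoeff_succ_mul, coeff_neg_pow_mul, map_smul]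
  -- Truncated geometric series with exact remainder; multiplied by Df, of order at least 1, the
  -- remainder starts beyond t^N.
  have h2 : g = ∑ j ∈ Finset.range N, (-f) ^ j + g * (-f) ^ N := by
    have h3 := mul_neg_geom_sum (-f) N
    rw [sub_neg_eq_add] at h3
    rw [← one_mul (∑ j ∈ Finset.range N, (-f) ^ j), ← hg, mul_assoc, h3, mul_sub, mul_one,
      sub_add_cancel]
  have h4 : coeff N (g * (-f) ^ N * eulerD f) = 0 := by
    refine coeff_mul_of_lt (a := N) (b := 1) (fun k hk => ?_) (fun k hk => ?_) (Nat.lt_succ_self N)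
    · refine coeff_mul_of_lt (a := 0) (b := N) (fun k hk => by omega) (fun k hk => ?_)
        (by omega)
      exact coeff_pow_of_lt' (by simpa using hf) N hk
    · rw [Nat.lt_one_iff.1 hk, coeff_eulerD, zero_smul]
  rw [h2, add_mul, map_add, map_add, h4, map_zero, add_zero, Finset.sum_mul, map_sum, map_sum,
    Finset.smul_sum, Finset.range_eq_Ico, Finset.sum_congr rfl fun j _ => (h1 j).symm,
    Finset.sum_Ico_add' (fun n => (N : ℂ) • logCoeff n • τ (coeff N (f ^ n))) 0 N 1]
  refine Finset.sum_congr ?_ fun _ _ => rfl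
  ext j
  simp only [Finset.mem_Icc, Finset.mem_Ico]
  omega

theorem monomial_pow (a : A) (n : ℕ) : (monomial 1 a) ^ n = monomial n (a ^ n) := by
  induction n with
  | zero => simp
  | succ n ih => rw [pow_succ, ih, monomial_mul_monomial, pow_succ]

/-- If `1 + t m₁ + t² m₂ = (1 + t q + t² r) (1 + t p)` and the first factor has trivial
`tr ln`, then the two sides of `tr ln (1 + t m₁ + t² m₂) = tr ln (1 + t p)` agree. -/
theorem sum_logCoeff_trace_of_factorization (hτ : ∀ x y, τ (x * y) = τ (y * x)) {p q r : A}
    (hq : q * q * q = 0) (hqr : q * r = 0) (hrq : r * q = 0) (hr : r * r = 0) (hrp : r * p = 0)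
    (hτq : τ q = 0) (hτr : τ (q * q) = (2 : ℂ) • τ r) {N : ℕ} (hN : N ≠ 0) :
    ∑ n ∈ Finset.Icc 1 N,
        logCoeff n • τ (coeff N ((monomial 1 (p + q) + monomial 2 (r + q * p)) ^ n))
      = logCoeff N • τ (p ^ N) := by
  set M : PowerSeries A := monomial 1 (p + q) + monomial 2 (r + q * p) with hM
  set P : PowerSeries A := monomial 1 p with hP
  set ν : PowerSeries A := 1 + (monomial 1 q + monomial 2 r) with hν
  set ν' : PowerSeries A := 1 - monomial 1 q + monomial 2 (q * q - r) with hν'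
  have hN' : (N : ℂ) ≠ 0 := by exact_mod_cast hN
  have hfac : 1 + M = ν * (1 + P) := by
    rw [hM, hν, hP]
    simp only [add_mul, mul_add, one_mul, mul_one, monomial_mul_monomial, hrp, map_add, map_zero]
    abel
  -- The geometric series for ν stops at t², since q³, qr, rq and r² all vanish.
  have hinv : ν' * ν = 1 := by
    rw [hν, hν']
    have e1 : q * q * r = 0 := by rw [mul_assoc, hqr, mul_zero]
    simp only [add_mul, sub_mul, mul_add, one_mul, mul_one, monomial_mul_monomial, hqr, hrq, hq,
      hr, e1, map_sub, map_zero, Nat.reduceAdd, sub_self]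
    abel
  -- The logarithmic derivative of ν has only two coefficients, and `hτq`, `hτr` say precisely that
  -- both are traceless.
  have hDν : ν' * eulerD ν = monomial 1 q + monomial 2 (r + r - q * q) := by
    rw [hν, hν', eulerD_add, eulerD_add, eulerD_one, eulerD_monomial, eulerD_monomial]
    have e1 : q * q * r = 0 := by rw [mul_assoc, hqr, mul_zero]
    simp only [two_nsmul, one_smul, add_mul, sub_mul, mul_add, one_mul,
      monomial_mul_monomial, hqr, hrq, hq, hr, e1, map_sub, map_zero, Nat.reduceAdd, sub_self,
      add_zero, sub_zero, zero_add, map_add]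
    abel
  obtain ⟨g, hg⟩ : ∃ g : PowerSeries A, g * (1 + P) = 1 :=
    ⟨invOfUnit (1 + P) 1, invOfUnit_mul _ _ (by
      rw [map_add, map_one, ← coeff_zero_eq_constantCoeff_apply, hP, coeff_monomial]; simp)⟩
  have hg' : (1 + P) * g = 1 := by
    have hu : IsUnit (1 + P) := isUnit_iff_constantCoeff.2 (by
      rw [map_add, map_one, ← coeff_zero_eq_constantCoeff_apply, hP, coeff_monomial]; simp)
    rw [← hu.mul_left_inj, mul_assoc, hg, mul_one, one_mul]
  have hM0 : coeff 0 M = 0 := by rw [hM, map_add, coeff_monomial, coeff_monomial]; simp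
  have hP0 : coeff 0 P = 0 := by rw [hP, coeff_monomial]; simp
  have hgM : g * ν' * (1 + M) = 1 := by
    rw [hfac, mul_assoc, ← mul_assoc ν', hinv, one_mul, hg]
  have h1 := sum_logCoeff_trace_coeff_pow τ hτ hM0 hgM N
  have h2 := sum_logCoeff_trace_coeff_pow τ hτ hP0 hg N
  have hDM : eulerD M = eulerD ν * (1 + P) + ν * eulerD P := by
    have h3 : eulerD (1 + M) = eulerD M := by rw [eulerD_add, eulerD_one, zero_add]
    have h4 : eulerD (1 + P) = eulerD P := by rw [eulerD_add, eulerD_one, zero_add]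
    rw [← h3, hfac, eulerD_mul, h4]
  have h5 : τ (coeff N (g * ν' * eulerD M)) = τ (coeff N (g * eulerD P)) := by
    have h6 : τ (coeff N (ν' * eulerD ν)) = 0 := by
      rw [hDν, map_add, coeff_monomial, coeff_monomial, map_add]
      have : τ (r + r - q * q) = 0 := by
        rw [map_sub, map_add, hτr, two_smul, sub_self]
      split_ifs <;> simp [hτq, this]
    have h7 : g * ν' * eulerD M = g * (ν' * eulerD ν * (1 + P)) + g * eulerD P := by
      rw [hDM, mul_add, mul_assoc g ν' (ν * eulerD P), ← mul_assoc ν' ν, hinv, one_mul]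
      simp only [mul_assoc]
    rw [h7, map_add, map_add, trace_coeff_mul_comm τ hτ, mul_assoc, hg', mul_one, h6, zero_add]
  rw [h5, ← h2] at h1
  have h8 := smul_right_injective V hN' h1
  rw [h8, Finset.sum_eq_single N]
  · rw [hP, monomial_pow, coeff_monomial_same]
  · intro n _ hn
    rw [hP, monomial_pow, coeff_monomial, if_neg (Ne.symm hn), map_zero, smul_zero]
  · intro h
    exact absurd (Finset.mem_Icc.2 ⟨Nat.one_le_iff_ne_zero.2 hN, le_rfl⟩) h

end FormalLog

/-! ### Even supermatrices and the supertrace -/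

section Supermatrix

variable {Φ : Type*} [Fintype Φ] [DecidableEq Φ] {ε : Φ → ZMod 2} {η : Type*} [DecidableEq η]
  {Ψ Ω : Type*} [Fintype Ψ] [DecidableEq Ψ] [Fintype Ω] [DecidableEq Ω]

/-- The even supermatrices with respect to the parities `εΨ` of rows and columns. -/
def evenMat (ε : Φ → ZMod 2) (η : Type*) [DecidableEq η] (εΨ : Ψ → ZMod 2) :
    Subalgebra ℂ (Matrix Ψ Ψ (SuperFn ε η)) where
  carrier := {M | ∀ A B, HasParity (εΨ A + εΨ B) (M A B)}
  mul_mem' {M N} hM hN A B := by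
    rw [Matrix.mul_apply]
    refine .sum fun C _ => ((hM A C).mul (hN C B)).of_eq ?_
    generalize εΨ A = x; generalize εΨ B = y; generalize εΨ C = z
    revert x y z; decide
  add_mem' {M N} hM hN A B := (hM A B).add (hN A B)
  algebraMap_mem' z A B := by
    rw [Matrix.algebraMap_matrix_apply]
    split_ifs with h
    · subst h
      rw [add_self_zmod_two]
      exact .algebraMap z
    · exact .zero

/-- The supertrace of a product does not depend on the order of the factors. -/
theorem str_mul_comm {εΨ : Ψ → ZMod 2} {εΩ : Ω → ZMod 2} {M : Matrix Ψ Ω (SuperFn ε η)}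
    {N : Matrix Ω Ψ (SuperFn ε η)} (hM : ∀ A B, HasParity (εΨ A + εΩ B) (M A B))
    (hN : ∀ B A, HasParity (εΩ B + εΨ A) (N B A)) : str εΨ (M * N) = str εΩ (N * M) := by
  simp only [str, Matrix.mul_apply, Finset.smul_sum]
  rw [Finset.sum_comm]
  refine Finset.sum_congr rfl fun B _ => Finset.sum_congr rfl fun A _ => ?_
  rw [(hM A B).mul_comm (hN B A), smul_smul]
  congr 1
  generalize εΨ A = x; generalize εΩ B = y
  rcases zmod_two_eq x with rfl | rfl <;> rcases zmod_two_eq y with rfl | rfl <;>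
    simp [show (1 + 1 : ZMod 2) = 0 from rfl]

/-- The supertrace as a linear map on matrices. -/
def strLin (εΨ : Ψ → ZMod 2) (S : Type*) [Ring S] [Algebra ℂ S] : Matrix Ψ Ψ S →ₗ[ℂ] S where
  toFun := str εΨ
  map_add' M N := by simp [str, Finset.sum_add_distrib]
  map_smul' z M := by simp [str, Finset.smul_sum, smul_comm z]

/-- The supertrace on even supermatrices. -/
def strEven (ε : Φ → ZMod 2) (η : Type*) [DecidableEq η] (εΨ : Ψ → ZMod 2) :
    evenMat ε η εΨ →ₗ[ℂ] SuperFn ε η :=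
  (strLin εΨ (SuperFn ε η)).comp (evenMat ε η εΨ).val.toLinearMap

theorem strEven_mul_comm (εΨ : Ψ → ZMod 2) (M N : evenMat ε η εΨ) :
    strEven ε η εΨ (M * N) = strEven ε η εΨ (N * M) := str_mul_comm M.2 N.2

open PowerSeries in
/-- A power series with matrix coefficients as a matrix of power series. -/
def matSeries {S : Type*} [Ring S] [Algebra ℂ S] (E : Subalgebra ℂ (Matrix Ψ Ψ S))
    (f : PowerSeries E) : Matrix Ψ Ψ (PowerSeries S) :=
  Matrix.of fun A B => mk fun n => (coeff n f).1 A B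

section

open PowerSeries

variable {S : Type*} [Ring S] [Algebra ℂ S] {E : Subalgebra ℂ (Matrix Ψ Ψ S)}

theorem coeff_matSeries (f : PowerSeries E) (n : ℕ) (A B : Ψ) :
    coeff n (matSeries E f A B) = (coeff n f).1 A B := by
  rw [matSeries, Matrix.of_apply, coeff_mk]

theorem matSeries_one : matSeries E 1 = 1 := by
  ext A B n
  rw [coeff_matSeries, coeff_one, Matrix.one_apply]
  by_cases hn : n = 0 <;> by_cases hA : A = B <;> simp [hn, hA, coeff_one]

theorem matSeries_add (f g : PowerSeries E) : matSeries E (f + g) = matSeries E f + matSeries E g := by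
  ext A B n
  rw [coeff_matSeries, Matrix.add_apply, map_add, map_add, coeff_matSeries, coeff_matSeries]
  rfl

theorem matSeries_mul (f g : PowerSeries E) : matSeries E (f * g) = matSeries E f * matSeries E g := by
  ext A B n
  rw [coeff_matSeries, Matrix.mul_apply, map_sum, coeff_mul]
  simp only [coeff_mul, coeff_matSeries]
  rw [Finset.sum_comm, AddSubmonoidClass.coe_finsetSum, Matrix.sum_apply]
  rfl

theorem matSeries_pow (f : PowerSeries E) (n : ℕ) : matSeries E (f ^ n) = matSeries E f ^ n := by
  induction n with
  | zero => rw [pow_zero, pow_zero, matSeries_one]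
  | succ n ih => rw [pow_succ, pow_succ, matSeries_mul, ih]

theorem matSeries_monomial (k : ℕ) (M : E) :
    matSeries E (monomial k M) = M.1.map (monomial k) := by
  ext A B n
  rw [coeff_matSeries, coeff_monomial, Matrix.map_apply, coeff_monomial]
  split_ifs <;> rfl

theorem coeff_str_matSeries (εΨ : Ψ → ZMod 2) (f : PowerSeries E) (n : ℕ) :
    coeff n (str εΨ (matSeries E f)) = str εΨ (coeff n f).1 := by
  simp only [str, map_sum]
  refine Finset.sum_congr rfl fun A _ => ?_
  rw [← coeff_matSeries]
  rfl

end

end Supermatrix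

namespace GaugeTheory

variable {I 𝒜 η : Type*} [Fintype I] [Fintype 𝒜] [DecidableEq I] [DecidableEq 𝒜]
  [DecidableEq η] (T : GaugeTheory I 𝒜 η)

/-! ### The factorization of the Jacobian matrix -/

/-- The matrix `X^{Aa}`. -/
def matX : Matrix (FieldIx I 𝒜) (Fin 2) T.Fn := Matrix.of T.X

/-- The matrix `λ_{a,B}`. -/
def matDLam (lam : Fin 2 → T.Fn) : Matrix (Fin 2) (FieldIx I 𝒜) T.Fn :=
  Matrix.of fun a B => rderiv B (lam a)

/-- The matrix `X^{Aa} λ_{a,B}`. -/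
def matP (lam : Fin 2 → T.Fn) : Matrix (FieldIx I 𝒜) (FieldIx I 𝒜) T.Fn :=
  T.matX * T.matDLam lam

/-- The part of `M` linear in the undifferentiated parameters, `(-1)^{ε_B} X^{Aa}_{,B} λ_a`. -/
def matQ (lam : Fin 2 → T.Fn) : Matrix (FieldIx I 𝒜) (FieldIx I 𝒜) T.Fn :=
  Matrix.of fun A B => ∑ a, sgn (T.par B) • (rderiv B (T.X A a) * lam a)

/-- The part `-(1/2) Y^A_{,B} λ²` of `M`. -/
def matR (lam : Fin 2 → T.Fn) : Matrix (FieldIx I 𝒜) (FieldIx I 𝒜) T.Fn :=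
  Matrix.of fun A B => -(rderiv B (T.Y A) * (lam 0 * lam 1))

/-- The entry λ_{a,A} X^{Ab} is s^b λ_a, with row and column exchanged relative to m. -/
theorem matDLam_mul_matX (lam : Fin 2 → T.Fn) :
    T.matDLam lam * T.matX = (T.m lam).transpose := rfl

variable {T} {lam : Fin 2 → T.Fn}

theorem hasParity_matX (A : FieldIx I 𝒜) (a : Fin 2) : HasParity (T.par A + 1) (T.matX A a) :=
  T.hasParity_X A a

theorem hasParity_matDLam (hlam : ∀ a, HasParity 1 (lam a)) (a : Fin 2) (B : FieldIx I 𝒜) :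
    HasParity (1 + T.par B) (T.matDLam lam a B) := (hlam a).rderiv B

theorem matP_mem (hlam : ∀ a, HasParity 1 (lam a)) : T.matP lam ∈ evenMat T.par η T.par := by
  intro A B
  rw [matP, Matrix.mul_apply]
  refine .sum fun a _ => ((hasParity_matX A a).mul (hasParity_matDLam hlam a B)).of_eq ?_
  generalize T.par A = x; generalize T.par B = y
  revert x y; decide

theorem matQ_mem (hlam : ∀ a, HasParity 1 (lam a)) : T.matQ lam ∈ evenMat T.par η T.par := by
  intro A B
  change HasParity _ (∑ a, sgn (T.par B) • (rderiv B (T.X A a) * lam a))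
  refine .sum fun a _ => .smul _ ((((T.hasParity_X A a).rderiv B).mul (hlam a)).of_eq ?_)
  generalize T.par A = x; generalize T.par B = y
  revert x y; decide

theorem hasParity_lam_mul (hlam : ∀ a, HasParity 1 (lam a)) : HasParity 0 (lam 0 * lam 1) :=
  ((hlam 0).mul (hlam 1)).of_eq rfl

theorem matR_mem (hlam : ∀ a, HasParity 1 (lam a)) : T.matR lam ∈ evenMat T.par η T.par := by
  intro A B
  refine .neg ((((T.hasParity_Y A).rderiv B).mul (hasParity_lam_mul hlam)).of_eq (add_zero _))

theorem m_mem (hlam : ∀ a, HasParity 1 (lam a)) :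
    T.m lam ∈ evenMat T.par η (fun _ : Fin 2 => 1) :=
  fun a b => T.hasParity_s (hlam b) a

theorem lam_swap (hlam : ∀ a, HasParity 1 (lam a)) (a b : Fin 2) :
    lam a * lam b = -(lam b * lam a) := by
  have := (hlam a).mul_comm (hlam b)
  rwa [mul_one, sgn_one, neg_smul, one_smul] at this

theorem lam_mul_self (hlam : ∀ a, HasParity 1 (lam a)) (a : Fin 2) : lam a * lam a = 0 := by
  have h := lam_swap hlam a a
  have : (2 : ℂ) • (lam a * lam a) = 0 := by rw [two_smul]; nth_rw 1 [h]; rw [neg_add_cancel]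
  exact (smul_eq_zero.1 this).resolve_left (by norm_num)

theorem lamSq_eq (hlam : ∀ a, HasParity 1 (lam a)) : T.lamSq lam = (2 : ℂ) • (lam 0 * lam 1) := by
  simp only [lamSq, Fin.sum_univ_two, epsUp, Matrix.of_apply, Matrix.cons_val',
    Matrix.cons_val_zero, Matrix.cons_val_one, Matrix.cons_val_fin_one, zero_smul, one_smul,
    neg_smul, zero_add, add_zero, two_smul]
  rw [lam_swap hlam 1 0, neg_neg]

theorem rderiv_shift₁ (hlam : ∀ a, HasParity 1 (lam a)) (A B : FieldIx I 𝒜) :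
    rderiv B (T.shift₁ lam A) = (T.matP lam + T.matQ lam) A B := by
  rw [Matrix.add_apply, matP, Matrix.mul_apply, shift₁, map_sum]
  change _ = _ + ∑ a, sgn (T.par B) • (rderiv B (T.X A a) * lam a)
  rw [← Finset.sum_add_distrib]
  refine Finset.sum_congr rfl fun a _ => ?_
  rw [rderiv_mul, (hlam a).parityPow, mul_one, mul_smul_comm]
  rfl

/-- Carrying λ_a across X^{Cb} absorbs the sign (-1)^{ε_C} of Q and leaves -(s^b X^{Aa}) λ_a, to
which the Sp(2) algebra applies. -/
theorem matQ_mul_matX (hlam : ∀ a, HasParity 1 (lam a)) (A : FieldIx I 𝒜) (b : Fin 2) :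
    (T.matQ lam * T.matX) A b = -∑ a, epsUp a b • (T.Y A * lam a) := by
  have h : ∀ C, T.matQ lam A C * T.matX C b
      = ∑ a, -(rderiv C (T.X A a) * T.X C b * lam a) := by
    intro C
    change (∑ a, sgn (T.par C) • (rderiv C (T.X A a) * lam a)) * T.X C b = _
    rw [Finset.sum_mul]
    refine Finset.sum_congr rfl fun a _ => ?_
    rw [smul_mul_assoc, mul_assoc, (hlam a).mul_comm (T.hasParity_X C b), mul_smul_comm, smul_smul,
      one_mul, sgn_add, sgn_mul_sgn_mul, sgn_one, neg_smul, one_smul, mul_assoc]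
  rw [Matrix.mul_apply, Finset.sum_congr rfl fun C _ => h C, Finset.sum_comm,
    ← Finset.sum_neg_distrib]
  refine Finset.sum_congr rfl fun a _ => ?_
  rw [Finset.sum_neg_distrib, ← Finset.sum_mul,
    show ∑ C, rderiv C (T.X A a) * T.X C b = epsUp a b • T.Y A from T.s_X A a b, smul_mul_assoc]

/-- The term of Y^A λ² in which the parameters are differentiated equals QP because QX is
proportional to Yλ. This is the cross term needed for 1 + M = (1 + Q + R)(1 + P). -/
theorem rderiv_shift₂ (hlam : ∀ a, HasParity 1 (lam a)) (A B : FieldIx I 𝒜) :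
    rderiv B (T.shift₂ lam A) = (T.matR lam + T.matQ lam * T.matP lam) A B := by
  have h1 : T.shift₂ lam A = -(T.Y A * (lam 0 * lam 1)) := by
    rw [shift₂, lamSq_eq hlam, mul_smul_comm, smul_smul]
    norm_num
  have h2 : rderiv B (lam 0 * lam 1) = lam 0 * rderiv B (lam 1) - lam 1 * rderiv B (lam 0) := by
    rw [rderiv_mul, (hlam 1).parityPow, mul_one, mul_smul_comm,
      ((hlam 0).rderiv B).mul_comm (hlam 1), mul_one, smul_smul, add_comm 1 (T.par B), sgn_add,
      sgn_mul_sgn_mul, sgn_one, neg_smul, one_smul, sub_eq_add_neg]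
  rw [h1, map_neg, rderiv_mul, h2, (hasParity_lam_mul hlam).parityPow, mul_zero, sgn_zero, one_smul,
    matP, ← Matrix.mul_assoc, Matrix.add_apply, Matrix.mul_apply, Fin.sum_univ_two,
    matQ_mul_matX hlam, matQ_mul_matX hlam]
  simp only [Fin.sum_univ_two, epsUp, Matrix.of_apply, Matrix.cons_val',
    Matrix.cons_val_zero, Matrix.cons_val_one, Matrix.cons_val_fin_one, zero_smul, one_smul,
    neg_smul, zero_add, add_zero, neg_neg, neg_mul]
  change _ = -(rderiv B (T.Y A) * (lam 0 * lam 1))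
    + (T.Y A * lam 1 * rderiv B (lam 0) + -(T.Y A * lam 0 * rderiv B (lam 1)))
  rw [mul_sub, mul_assoc, mul_assoc]
  abel

/-- RX is s^b Y^A times λ_1 λ_2 up to sign, hence zero. -/
theorem matR_mul_matP (hlam : ∀ a, HasParity 1 (lam a)) : T.matR lam * T.matP lam = 0 := by
  have h : T.matR lam * T.matX = 0 := by
    ext A b
    have h1 : ∀ C, T.matR lam A C * T.matX C b
        = -(rderiv C (T.Y A) * T.X C b * (lam 0 * lam 1)) := by
      intro C
      change -(rderiv C (T.Y A) * (lam 0 * lam 1)) * T.X C b = _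
      rw [neg_mul, mul_assoc, (hasParity_lam_mul hlam).mul_comm_even, mul_assoc]
    rw [Matrix.mul_apply, Finset.sum_congr rfl fun C _ => h1 C, Finset.sum_neg_distrib,
      ← Finset.sum_mul, show ∑ C, rderiv C (T.Y A) * T.X C b = 0 from T.s_Y b A, zero_mul,
      neg_zero, Matrix.zero_apply]
  rw [matP, ← Matrix.mul_assoc, h, Matrix.zero_mul]

/-! The left ideals of superfunctions of first and second order in the parameters. -/

/-- The ideal generated by `λ_1` and `λ_2`. -/
def lamIdeal (lam : Fin 2 → T.Fn) : Submodule T.Fn T.Fn := Submodule.span T.Fn {lam 0, lam 1}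

/-- The ideal generated by `λ_1 λ_2`. -/
def lamSqIdeal (lam : Fin 2 → T.Fn) : Submodule T.Fn T.Fn := Submodule.span T.Fn {lam 0 * lam 1}

theorem lam_mem_lamIdeal (a : Fin 2) : lam a ∈ lamIdeal lam := by
  refine Submodule.subset_span ?_
  fin_cases a
  · exact Or.inl rfl
  · exact Or.inr rfl

theorem mul_mem_lamIdeal_left (hlam : ∀ a, HasParity 1 (lam a)) {f : T.Fn}
    (hf : f ∈ lamIdeal lam) (g : T.Fn) : f * g ∈ lamIdeal lam := by
  obtain ⟨a, b, rfl⟩ := Submodule.mem_span_pair.1 hf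
  rw [smul_eq_mul, smul_eq_mul, add_mul, mul_assoc, mul_assoc, (hlam 0).mul_comm_odd,
    (hlam 1).mul_comm_odd, ← mul_assoc, ← mul_assoc]
  exact add_mem (Submodule.smul_mem _ _ (lam_mem_lamIdeal 0))
    (Submodule.smul_mem _ _ (lam_mem_lamIdeal 1))

theorem lamSqIdeal_le : lamSqIdeal lam ≤ lamIdeal lam := by
  rw [lamSqIdeal, Submodule.span_singleton_le_iff_mem]
  exact Submodule.smul_mem _ (lam 0) (lam_mem_lamIdeal 1)

theorem mul_mem_lamSqIdeal (hlam : ∀ a, HasParity 1 (lam a)) {f g : T.Fn}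
    (hf : f ∈ lamIdeal lam) (hg : g ∈ lamIdeal lam) : f * g ∈ lamSqIdeal lam := by
  obtain ⟨a, b, rfl⟩ := Submodule.mem_span_pair.1 hf
  obtain ⟨c, d, rfl⟩ := Submodule.mem_span_pair.1 hg
  refine Submodule.mem_span_singleton.2 ⟨a * parityAut T.par η d - b * parityAut T.par η c, ?_⟩
  simp only [smul_eq_mul, add_mul, mul_add, sub_mul]
  have h : ∀ (x y : T.Fn) (i j : Fin 2), x * lam i * (y * lam j)
      = x * parityAut T.par η y * (lam i * lam j) := by
    intro x y i j
    rw [mul_assoc, ← mul_assoc (lam i), (hlam i).mul_comm_odd]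
    simp only [mul_assoc]
  rw [h, h, h, h, lam_mul_self hlam, lam_mul_self hlam, lam_swap hlam 1 0, mul_zero, mul_zero,
    mul_neg, zero_add, add_zero, sub_eq_add_neg, add_comm]

/-- Three factors drawn from two anticommuting parameters contain a repeated one. -/
theorem lamIdeal_mul_lamSqIdeal (hlam : ∀ a, HasParity 1 (lam a)) {f g : T.Fn}
    (hf : f ∈ lamIdeal lam) (hg : g ∈ lamSqIdeal lam) : f * g = 0 := by
  obtain ⟨a, b, rfl⟩ := Submodule.mem_span_pair.1 hf
  obtain ⟨c, rfl⟩ := Submodule.mem_span_singleton.1 hg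
  have h : ∀ i, lam i * (lam 0 * lam 1) = 0 := by
    intro i
    fin_cases i
    · change lam 0 * (lam 0 * lam 1) = 0
      rw [← mul_assoc, lam_mul_self hlam, zero_mul]
    · change lam 1 * (lam 0 * lam 1) = 0
      rw [lam_swap hlam 0 1, mul_neg, ← mul_assoc, lam_mul_self hlam, zero_mul, neg_zero]
  have h' : ∀ (x : T.Fn) i, x * lam i * (c * (lam 0 * lam 1)) = 0 := by
    intro x i
    rw [mul_assoc, ← mul_assoc (lam i), (hlam i).mul_comm_odd, mul_assoc, h, mul_zero, mul_zero]
  rw [smul_eq_mul, smul_eq_mul, smul_eq_mul, add_mul, h', h', add_zero]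

theorem lamSqIdeal_mul_lamIdeal (hlam : ∀ a, HasParity 1 (lam a)) {f g : T.Fn}
    (hf : f ∈ lamSqIdeal lam) (hg : g ∈ lamIdeal lam) : f * g = 0 := by
  obtain ⟨c, rfl⟩ := Submodule.mem_span_singleton.1 hf
  have h2 := lamIdeal_mul_lamSqIdeal hlam hg
    (Submodule.mem_span_singleton_self (R := T.Fn) (lam 0 * lam 1))
  rw [smul_eq_mul, mul_assoc, (hasParity_lam_mul hlam).mul_comm_even, h2, mul_zero]

theorem matQ_mem_lamIdeal (A B : FieldIx I 𝒜) : T.matQ lam A B ∈ lamIdeal lam := by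
  change (∑ a, sgn (T.par B) • (rderiv B (T.X A a) * lam a)) ∈ _
  refine Submodule.sum_mem _ fun a _ => ?_
  rw [← smul_mul_assoc]
  exact Submodule.smul_mem _ _ (lam_mem_lamIdeal a)

theorem matR_mem_lamSqIdeal (A B : FieldIx I 𝒜) : T.matR lam A B ∈ lamSqIdeal lam :=
  neg_mem (Submodule.smul_mem _ _ (Submodule.mem_span_singleton_self _))

theorem matQ_mul_matR (hlam : ∀ a, HasParity 1 (lam a)) : T.matQ lam * T.matR lam = 0 := by
  ext A B
  exact Finset.sum_eq_zero fun C _ => lamIdeal_mul_lamSqIdeal hlam (matQ_mem_lamIdeal A C)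
    (matR_mem_lamSqIdeal C B)

theorem matR_mul_matQ (hlam : ∀ a, HasParity 1 (lam a)) : T.matR lam * T.matQ lam = 0 := by
  ext A B
  exact Finset.sum_eq_zero fun C _ => lamSqIdeal_mul_lamIdeal hlam (matR_mem_lamSqIdeal A C)
    (matQ_mem_lamIdeal C B)

theorem matR_mul_matR (hlam : ∀ a, HasParity 1 (lam a)) : T.matR lam * T.matR lam = 0 := by
  ext A B
  exact Finset.sum_eq_zero fun C _ => lamSqIdeal_mul_lamIdeal hlam (matR_mem_lamSqIdeal A C)
    (lamSqIdeal_le (matR_mem_lamSqIdeal C B))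

theorem matQ_mul_matQ_mul_matQ (hlam : ∀ a, HasParity 1 (lam a)) :
    T.matQ lam * T.matQ lam * T.matQ lam = 0 := by
  ext A B
  refine Finset.sum_eq_zero fun C _ => lamSqIdeal_mul_lamIdeal hlam ?_ (matQ_mem_lamIdeal C B)
  exact Submodule.sum_mem _ fun D _ =>
    mul_mem_lamSqIdeal hlam (matQ_mem_lamIdeal A D) (matQ_mem_lamIdeal D C)

/-! ### Supertraces of the factors -/

theorem str_matQ : str T.par (T.matQ lam) = 0 := by
  have h : ∀ A, sgn (T.par A) • T.matQ lam A A = ∑ a, rderiv A (T.X A a) * lam a := by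
    intro A
    change sgn (T.par A) • ∑ a, sgn (T.par A) • (rderiv A (T.X A a) * lam a) = _
    rw [Finset.smul_sum]
    refine Finset.sum_congr rfl fun a _ => ?_
    rw [smul_smul, sgn_mul_sgn, one_smul]
  rw [str, Finset.sum_congr rfl fun A _ => h A, Finset.sum_comm]
  refine Finset.sum_eq_zero fun a _ => ?_
  rw [← Finset.sum_mul, T.div_X, zero_mul]

/-- Differentiate s^b X^{Aa} = ε^{ab} Y^A by φ^A and sum over A with signs: the terms with second
derivatives of X assemble into the derivative of the divergence and vanish. -/
theorem sum_rderiv_X_mul_rderiv_X (a b : Fin 2) :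
    ∑ A, ∑ B, sgn (T.par A) • (rderiv B (T.X A a) * rderiv A (T.X B b))
      = epsUp a b • ∑ A, sgn (T.par A) • rderiv A (T.Y A) := by
  have h : ∀ A, epsUp a b • sgn (T.par A) • rderiv A (T.Y A)
      = (∑ B, sgn (T.par A) • (rderiv B (T.X A a) * rderiv A (T.X B b)))
        + ∑ B, rderiv B (rderiv A (T.X A a)) * T.X B b := by
    intro A
    rw [smul_comm, ← map_smul, ← T.s_X A a b, s, map_sum, Finset.smul_sum,
      ← Finset.sum_add_distrib]
    refine Finset.sum_congr rfl fun B _ => ?_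
    rw [rderiv_mul, smul_add, rderiv_comm A B, (T.hasParity_X B b).parityPow, smul_mul_assoc,
      mul_smul_comm, smul_smul, smul_smul]
    congr 1
    have : sgn (T.par A) * sgn (T.par A * T.par B) * sgn (T.par A * (T.par B + 1)) = 1 := by
      generalize T.par A = x; generalize T.par B = y
      rcases zmod_two_eq x with rfl | rfl <;> rcases zmod_two_eq y with rfl | rfl <;>
        simp [show (1 + 1 : ZMod 2) = 0 from rfl]
    rw [this, one_smul]
  rw [Finset.smul_sum, Finset.sum_congr rfl fun A _ => h A, Finset.sum_add_distrib, left_eq_add,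
    Finset.sum_comm]
  refine Finset.sum_eq_zero fun B _ => ?_
  rw [← Finset.sum_mul, ← map_sum, T.div_X, map_zero, zero_mul]

/-- This cancels the second-order term Str(R - Q²/2) of Str ln(1 + Q + R). -/
theorem str_matQ_mul_matQ (hlam : ∀ a, HasParity 1 (lam a)) :
    str T.par (T.matQ lam * T.matQ lam) = (2 : ℂ) • str T.par (T.matR lam) := by
  have h : ∀ A B, sgn (T.par A) • (T.matQ lam A B * T.matQ lam B A)
      = ∑ a, ∑ b, -(sgn (T.par A) • (rderiv B (T.X A a) * rderiv A (T.X B b))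
        * (lam a * lam b)) := by
    intro A B
    change sgn (T.par A) • ((∑ a, sgn (T.par B) • (rderiv B (T.X A a) * lam a))
      * ∑ b, sgn (T.par A) • (rderiv A (T.X B b) * lam b)) = _
    rw [Finset.sum_mul_sum, Finset.smul_sum]
    refine Finset.sum_congr rfl fun a _ => ?_
    rw [Finset.smul_sum]
    refine Finset.sum_congr rfl fun b _ => ?_
    have h1 : rderiv B (T.X A a) * lam a * (rderiv A (T.X B b) * lam b)
        = sgn (T.par B + 1 + T.par A) •
          (rderiv B (T.X A a) * rderiv A (T.X B b) * (lam a * lam b)) := by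
      rw [mul_assoc, ← mul_assoc (lam a), (hlam a).mul_comm ((T.hasParity_X B b).rderiv A),
        one_mul, smul_mul_assoc, mul_smul_comm]
      simp only [mul_assoc]
    rw [smul_mul_smul_comm, h1, smul_smul, smul_smul, smul_mul_assoc, ← neg_smul]
    congr 1
    generalize T.par A = x; generalize T.par B = y
    rcases zmod_two_eq x with rfl | rfl <;> rcases zmod_two_eq y with rfl | rfl <;>
      simp [show (1 + 1 : ZMod 2) = 0 from rfl]
  have h2 : str T.par (T.matQ lam * T.matQ lam)
      = ∑ a, ∑ b, -((epsUp a b • ∑ A, sgn (T.par A) • rderiv A (T.Y A)) * (lam a * lam b)) := by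
    have h3 : ∀ A, sgn (T.par A) • (T.matQ lam * T.matQ lam) A A
        = ∑ a, ∑ b, -((∑ B, sgn (T.par A) • (rderiv B (T.X A a) * rderiv A (T.X B b)))
          * (lam a * lam b)) := by
      intro A
      rw [Matrix.mul_apply, Finset.smul_sum, Finset.sum_congr rfl fun B _ => h A B,
        Finset.sum_comm]
      refine Finset.sum_congr rfl fun a _ => ?_
      rw [Finset.sum_comm]
      refine Finset.sum_congr rfl fun b _ => ?_
      rw [Finset.sum_neg_distrib, ← Finset.sum_mul]
    rw [str, Finset.sum_congr rfl fun A _ => h3 A, Finset.sum_comm]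
    refine Finset.sum_congr rfl fun a _ => ?_
    rw [Finset.sum_comm]
    refine Finset.sum_congr rfl fun b _ => ?_
    rw [Finset.sum_neg_distrib, ← Finset.sum_mul, sum_rderiv_X_mul_rderiv_X]
  have h4 : str T.par (T.matR lam)
      = -((∑ A, sgn (T.par A) • rderiv A (T.Y A)) * (lam 0 * lam 1)) := by
    rw [str, Finset.sum_mul, ← Finset.sum_neg_distrib]
    refine Finset.sum_congr rfl fun A _ => ?_
    change sgn (T.par A) • -(rderiv A (T.Y A) * (lam 0 * lam 1)) = _
    rw [smul_neg, smul_mul_assoc]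
  rw [h2, h4]
  simp only [Fin.sum_univ_two, epsUp, Matrix.of_apply, Matrix.cons_val',
    Matrix.cons_val_zero, Matrix.cons_val_one, Matrix.cons_val_fin_one, zero_smul, one_smul,
    neg_smul, zero_mul, neg_zero, zero_add, add_zero, neg_mul, neg_neg, two_smul]
  rw [lam_swap hlam 1 0, mul_neg]

theorem transpose_pow_m (hlam : ∀ a, HasParity 1 (lam a)) (n : ℕ) :
    (T.m lam).transpose ^ n = (T.m lam ^ n).transpose := by
  induction n with
  | zero => rw [pow_zero, pow_zero, Matrix.transpose_one]
  | succ n ih =>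
    rw [pow_succ, ih, pow_succ']
    ext a b
    rw [Matrix.transpose_apply, Matrix.mul_apply, Matrix.mul_apply]
    refine Finset.sum_congr rfl fun c _ => ?_
    exact HasParity.mul_comm_even (pow_mem (m_mem hlam) n c a) _

/-- Write P^{n+1} = X (m^T)^n L with L = λ_{a,B} and rotate X to the end. The supertrace then runs
over Sp(2) indices, which count as odd and give -tr. -/
theorem str_matP_pow (hlam : ∀ a, HasParity 1 (lam a)) (n : ℕ) :
    str T.par (T.matP lam ^ (n + 1)) = -(T.m lam ^ (n + 1)).trace := by
  have h1 : T.matP lam ^ (n + 1)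
      = T.matX * ((T.m lam).transpose ^ n * T.matDLam lam) := by
    induction n with
    | zero => rw [zero_add, pow_one, pow_zero, Matrix.one_mul, matP]
    | succ n ih =>
      rw [pow_succ, ih, matP, Matrix.mul_assoc, Matrix.mul_assoc, ← Matrix.mul_assoc _ T.matX,
        matDLam_mul_matX, ← Matrix.mul_assoc (_ ^ n), ← pow_succ]
  have hm : (T.m lam).transpose ∈ evenMat T.par η (fun _ : Fin 2 => 1) := fun a b => m_mem hlam b a
  rw [h1, str_mul_comm (εΩ := fun _ : Fin 2 => (1 : ZMod 2)) hasParity_matX (fun a B => ?_),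
    Matrix.mul_assoc, matDLam_mul_matX, ← pow_succ, transpose_pow_m hlam]
  · simp only [str, sgn_one, neg_smul, one_smul, Finset.sum_neg_distrib]
    rfl
  · rw [Matrix.mul_apply]
    refine .sum fun c _ => ((pow_mem hm n a c).mul (hasParity_matDLam hlam c B)).of_eq ?_
    change (1 : ZMod 2) + 1 + (1 + T.par B) = 1 + T.par B
    generalize T.par B = y
    revert y; decide

/-! ### The expansion of `ℑ` -/

open PowerSeries in
theorem jacT_eq (hlam : ∀ a, HasParity 1 (lam a)) :
    T.jacT lam = matSeries (evenMat T.par η T.par)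
      (monomial 1 (⟨_, matP_mem hlam⟩ + ⟨_, matQ_mem hlam⟩)
        + monomial 2 (⟨_, matR_mem hlam⟩ + ⟨_, matQ_mem hlam⟩ * ⟨_, matP_mem hlam⟩)) := by
  rw [matSeries_add, matSeries_monomial, matSeries_monomial]
  ext A B : 1
  rw [jacT, Matrix.of_apply, rderiv_shift₁ hlam, rderiv_shift₂ hlam]
  rfl

theorem coeff_formalLogSum {S : Type*} [Ring S] [Algebra ℂ S] (u : ℕ → PowerSeries S) (N : ℕ) :
    PowerSeries.coeff N (formalLogSum u)
      = ∑ n ∈ Finset.Icc 1 N, logCoeff n • PowerSeries.coeff N (u n) := PowerSeries.coeff_mk _ _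

theorem mT_pow (n : ℕ) : T.mT lam ^ n = (T.m lam ^ n).map (PowerSeries.monomial n) := by
  induction n with
  | zero =>
    ext a b : 1
    rw [pow_zero, pow_zero, Matrix.map_apply, Matrix.one_apply, Matrix.one_apply]
    split_ifs <;> simp
  | succ n ih =>
    ext a b : 1
    rw [pow_succ, ih, Matrix.mul_apply, pow_succ, Matrix.map_apply, Matrix.mul_apply, map_sum]
    refine Finset.sum_congr rfl fun c _ => ?_
    rw [Matrix.map_apply, mT, Matrix.map_apply, PowerSeries.monomial_mul_monomial]

theorem coeff_trLn (N : ℕ) :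
    PowerSeries.coeff N (T.trLn lam) = logCoeff N • (T.m lam ^ N).trace := by
  have h : ∀ n, PowerSeries.coeff N (T.mT lam ^ n).trace
      = if N = n then (T.m lam ^ n).trace else 0 := by
    intro n
    rw [mT_pow, Matrix.trace, map_sum]
    simp only [Matrix.diag_apply, Matrix.map_apply, PowerSeries.coeff_monomial]
    split_ifs
    · rfl
    · exact Finset.sum_const_zero
  rw [trLn, coeff_formalLogSum]
  rcases Nat.eq_zero_or_pos N with rfl | hN
  · simp [logCoeff]
  · rw [Finset.sum_eq_single N]
    · rw [h, if_pos rfl]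
    · intro n _ hn
      rw [h, if_neg (Ne.symm hn), smul_zero]
    · intro h
      exact absurd (Finset.mem_Icc.2 ⟨hN, le_rfl⟩) h

theorem logJac_eq (hlam : ∀ a, HasParity 1 (lam a)) : T.logJac lam = -T.trLn lam := by
  ext N
  rw [map_neg, coeff_trLn, logJac, coeff_formalLogSum]
  rcases Nat.eq_zero_or_pos N with rfl | hN
  · simp [logCoeff]
  -- The abstract logarithm lemma is applied in the algebra of even supermatrices, where the
  -- supertrace is cyclic.
  · have h := sum_logCoeff_trace_of_factorization (strEven T.par η T.par)
      (strEven_mul_comm T.par)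
      (p := ⟨_, matP_mem hlam⟩) (q := ⟨_, matQ_mem hlam⟩) (r := ⟨_, matR_mem hlam⟩)
      (Subtype.ext (matQ_mul_matQ_mul_matQ hlam)) (Subtype.ext (matQ_mul_matR hlam))
      (Subtype.ext (matR_mul_matQ hlam)) (Subtype.ext (matR_mul_matR hlam))
      (Subtype.ext (matR_mul_matP hlam)) str_matQ (str_matQ_mul_matQ hlam) hN.ne'
    have h2 := str_matP_pow hlam (N - 1)
    rw [Nat.sub_add_cancel hN] at h2
    rw [← smul_neg, ← h2]
    refine Eq.trans (Finset.sum_congr rfl fun n _ => ?_) h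
    rw [jacT_eq hlam, ← matSeries_pow, coeff_str_matSeries]
    rfl

end GaugeTheory

/-! ### The inverse of 1 + ta as a geometric series. -/

section Geometric

open PowerSeries

variable {A : Type*} [Ring A]

/-- The geometric series `∑ (-a)^n t^n`. -/
def geomSeries (a : A) : PowerSeries A := mk fun n => (-a) ^ n

theorem monomial_one_eq (a : A) : (monomial 1 a : PowerSeries A) = C a * X := by
  ext n
  rw [coeff_monomial, coeff_C_mul, coeff_X]
  split_ifs <;> simp

theorem one_add_mul_geomSeries (a : A) : (1 + monomial 1 a) * geomSeries a = 1 := by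
  ext n
  rw [add_mul, one_mul, monomial_one_eq, mul_assoc, X_mul, ← mul_assoc, map_add]
  cases n with
  | zero => simp [geomSeries]
  | succ n =>
    rw [coeff_succ_mul_X, coeff_C_mul, geomSeries, coeff_mk, coeff_mk, coeff_one, pow_succ']
    simp

theorem geomSeries_mul_one_add (a : A) : geomSeries a * (1 + monomial 1 a) = 1 := by
  ext n
  rw [mul_add, mul_one, monomial_one_eq, ← mul_assoc, map_add]
  cases n with
  | zero => simp [geomSeries]
  | succ n =>
    rw [coeff_succ_mul_X, coeff_mul_C, geomSeries, coeff_mk, coeff_mk, coeff_one, pow_succ]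
    simp

end Geometric

theorem evalAt_tmul {Φ : Type*} [Fintype Φ] [DecidableEq Φ] {ε : Φ → ZMod 2} {η : Type*}
    [DecidableEq η] (x : Pt ε) (f : SmoothFn ε) (w : Grass ε η) :
    evalAt x (f ⊗ₜ w : SuperFn ε η) = f.1 x • w :=
  (Algebra.TensorProduct.lift_tmul _ _ _ f w).trans
    (show algebraMap ℂ (Grass ε η) (f.1 x) * w = _ from (Algebra.smul_def (f.1 x) w).symm)

namespace GaugeTheory

variable {I 𝒜 η : Type*} [Fintype I] [Fintype 𝒜] [DecidableEq I] [DecidableEq 𝒜]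
  [DecidableEq η] {T : GaugeTheory I 𝒜 η} {lam : Fin 2 → T.Fn}

/-! ### The variation of `ℑ` -/

/-- `e + m` as a unit in the expansion in powers of the parameters. -/
def unitMT (hlam : ∀ a, HasParity 1 (lam a)) : (Matrix (Fin 2) (Fin 2) (PowerSeries T.Fn))ˣ where
  val := 1 + T.mT lam
  inv := matSeries (evenMat T.par η fun _ : Fin 2 => 1) (geomSeries ⟨T.m lam, m_mem hlam⟩)
  val_inv := by
    have h : 1 + T.mT lam = matSeries (evenMat T.par η fun _ : Fin 2 => 1)
        (1 + PowerSeries.monomial 1 ⟨T.m lam, m_mem hlam⟩) := by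
      rw [matSeries_add, matSeries_one, matSeries_monomial]; rfl
    rw [h, ← matSeries_mul, one_add_mul_geomSeries, matSeries_one]
  inv_val := by
    have h : 1 + T.mT lam = matSeries (evenMat T.par η fun _ : Fin 2 => 1)
        (1 + PowerSeries.monomial 1 ⟨T.m lam, m_mem hlam⟩) := by
      rw [matSeries_add, matSeries_one, matSeries_monomial]; rfl
    rw [h, ← matSeries_mul, geomSeries_mul_one_add, matSeries_one]

theorem coeff_inverse_one_add_mT (hlam : ∀ a, HasParity 1 (lam a)) (n : ℕ) (b c : Fin 2) :
    PowerSeries.coeff n (Ring.inverse (1 + T.mT lam) b c) = ((-T.m lam) ^ n) b c := by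
  rw [show 1 + T.mT lam = (unitMT hlam : Matrix (Fin 2) (Fin 2) (PowerSeries T.Fn)) from rfl,
    Ring.inverse_unit]
  change PowerSeries.coeff n (matSeries _ _ b c) = _
  rw [coeff_matSeries, geomSeries, PowerSeries.coeff_mk]
  rfl

theorem trace_mul_comm_even {M : Matrix (Fin 2) (Fin 2) T.Fn} (hM : ∀ a b, HasParity 0 (M a b))
    (N : Matrix (Fin 2) (Fin 2) T.Fn) : (M * N).trace = (N * M).trace := by
  simp only [Matrix.trace, Matrix.diag_apply, Matrix.mul_apply]
  rw [Finset.sum_comm]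
  exact Finset.sum_congr rfl fun a _ => Finset.sum_congr rfl fun b _ => (hM b a).mul_comm_even _

theorem hasParity_m_pow (hlam : ∀ a, HasParity 1 (lam a)) (n : ℕ) (a b : Fin 2) :
    HasParity 0 ((T.m lam ^ n) a b) := pow_mem (m_mem hlam) n a b

theorem map_s_mul (a : Fin 2) (M : Matrix (Fin 2) (Fin 2) T.Fn)
    {N : Matrix (Fin 2) (Fin 2) T.Fn} (hN : ∀ b c, HasParity 0 (N b c)) :
    (M * N).map (T.s a) = M * N.map (T.s a) + M.map (T.s a) * N := by
  ext b c
  rw [Matrix.map_apply, Matrix.mul_apply, s_sum, Matrix.add_apply, Matrix.mul_apply,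
    Matrix.mul_apply, ← Finset.sum_add_distrib]
  refine Finset.sum_congr rfl fun d _ => ?_
  rw [s_mul, show parityAut T.par η (N d c) = sgn 0 • N d c from hN d c, sgn_zero, one_smul]
  rfl

/-- Entries of m are even, so s^a obeys an unsigned Leibniz rule on powers of m and cyclicity makes
the n+1 terms equal; the tail m^j carries the induction. -/
theorem trace_map_s_pow_mul (hlam : ∀ a, HasParity 1 (lam a)) (a : Fin 2) (n j : ℕ) :
    ((T.m lam ^ (n + 1)).map (T.s a) * T.m lam ^ j).trace
      = (n + 1) • ((T.m lam).map (T.s a) * T.m lam ^ (n + j)).trace := by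
  induction n generalizing j with
  | zero => simp
  | succ n ih =>
    have hm : ∀ b c, HasParity 0 (T.m lam b c) := m_mem hlam
    rw [pow_succ (T.m lam) (n + 1), map_s_mul a _ hm, Matrix.add_mul, Matrix.trace_add,
      Matrix.mul_assoc, trace_mul_comm_even (hasParity_m_pow hlam (n + 1)), Matrix.mul_assoc,
      Matrix.mul_assoc, ← pow_add, ← pow_succ', ih, show j + (n + 1) = n + 1 + j by omega,
      show n + (j + 1) = n + 1 + j by omega, succ_nsmul' _ (n + 1)]

theorem s_trace_m_pow (hlam : ∀ a, HasParity 1 (lam a)) (a : Fin 2) (n : ℕ) :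
    T.s a (T.m lam ^ (n + 1)).trace
      = ((n + 1 : ℕ) : ℂ) • ∑ b, ∑ c, T.s a (T.m lam b c) * (T.m lam ^ n) c b := by
  have h := trace_map_s_pow_mul hlam a n 0
  rw [pow_zero, Matrix.mul_one, add_zero, ← Nat.cast_smul_eq_nsmul ℂ] at h
  rw [Matrix.trace, s_sum]
  exact h

theorem sT_logJac (hlam : ∀ a, HasParity 1 (lam a)) (a : Fin 2) :
    T.sT a (T.logJac lam)
      = -∑ b, ∑ c, T.sT a (T.mT lam b c) * Ring.inverse (1 + T.mT lam) c b := by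
  have h1 : ∀ b c, T.sT a (T.mT lam b c) = PowerSeries.C (T.s a (T.m lam b c)) * PowerSeries.X := by
    intro b c
    rw [← monomial_one_eq]
    ext n
    rw [sT, PowerSeries.coeff_mk, mT, Matrix.map_apply, PowerSeries.coeff_monomial,
      PowerSeries.coeff_monomial]
    split_ifs
    · rfl
    · exact T.s_zero a
  have h2 : ∀ b c, T.sT a (T.mT lam b c) * Ring.inverse (1 + T.mT lam) c b
      = PowerSeries.C (T.s a (T.m lam b c)) * Ring.inverse (1 + T.mT lam) c b * PowerSeries.X := by
    intro b c
    rw [h1, mul_assoc, PowerSeries.X_mul, ← mul_assoc]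
  ext N
  rw [sT, PowerSeries.coeff_mk, logJac_eq hlam, map_neg, coeff_trLn, map_neg, s_neg, s_smul,
    map_sum]
  congr 1
  cases N with
  | zero =>
    simp only [h2, map_sum, PowerSeries.coeff_zero_mul_X, Finset.sum_const_zero]
    simp [logCoeff]
  | succ n =>
    rw [s_trace_m_pow hlam, smul_smul, logCoeff_succ_mul, Finset.smul_sum]
    refine Finset.sum_congr rfl fun b _ => ?_
    rw [Finset.smul_sum, map_sum]
    refine Finset.sum_congr rfl fun c _ => ?_
    rw [h2, PowerSeries.coeff_succ_mul_X, PowerSeries.coeff_C_mul, coeff_inverse_one_add_mT hlam]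
    rcases Nat.even_or_odd n with h | h
    · rw [h.neg_one_pow, h.neg_pow, one_smul]
    · rw [h.neg_one_pow, h.neg_pow, neg_smul, one_smul, Matrix.neg_apply, mul_neg]

/-! ### Parameters `λ_a = s_a Λ` -/

theorem hasParity_sLow {Lam : T.Fn} (h : HasParity 0 Lam) (a : Fin 2) :
    HasParity 1 (T.sLow a Lam) :=
  .sum fun b _ => .smul _ ((T.hasParity_s h b).of_eq (zero_add 1))

theorem sSq_eq (Lam : T.Fn) : T.sSq Lam = (2 : ℂ) • T.s 0 (T.s 1 Lam) := by
  simp only [sSq, Fin.sum_univ_two, epsLow, Matrix.of_apply, Matrix.cons_val',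
    Matrix.cons_val_zero, Matrix.cons_val_one, Matrix.cons_val_fin_one, zero_smul, one_smul,
    neg_smul, zero_add, add_zero, two_smul]
  rw [T.s_s_anticomm 1 0, neg_neg]

/-- Off the diagonal stands s^a s^a Λ = 0 up to sign; the two diagonal entries agree because s^1 and
s^2 anticommute. -/
theorem m_sLow (Lam : T.Fn) :
    T.m (fun a => T.sLow a Lam) = Matrix.diagonal (fun _ => -((1 / 2 : ℂ) • T.sSq Lam)) := by
  have h : -((1 / 2 : ℂ) • T.sSq Lam) = -T.s 0 (T.s 1 Lam) := by
    rw [sSq_eq, smul_smul]; norm_num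
  ext a b
  rw [h]
  change T.s a (T.sLow b Lam) = _
  fin_cases a <;> fin_cases b <;>
    simp only [Fin.zero_eta, Fin.mk_one, sLow, Fin.sum_univ_two, epsLow, Matrix.of_apply,
      Matrix.cons_val', Matrix.cons_val_zero, Matrix.cons_val_one, Matrix.cons_val_fin_one,
      zero_smul, one_smul, neg_smul, zero_add, add_zero, s_neg, s_s_self, neg_zero,
      Matrix.diagonal_apply, if_true, zero_ne_one, one_ne_zero, if_false]
  exact T.s_s_anticomm 1 0 Lam

theorem trace_m_sLow_pow (Lam : T.Fn) (n : ℕ) :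
    (T.m (fun a => T.sLow a Lam) ^ n).trace = (2 : ℂ) • (-((1 / 2 : ℂ) • T.sSq Lam)) ^ n := by
  rw [m_sLow, Matrix.diagonal_pow, Matrix.trace_diagonal, Fin.sum_univ_two, two_smul]
  rfl

theorem coeff_lnT (f : T.Fn) (N : ℕ) : PowerSeries.coeff N (T.lnT f) = logCoeff N • f ^ N := by
  rw [lnT, coeff_formalLogSum]
  rcases Nat.eq_zero_or_pos N with rfl | hN
  · simp [logCoeff]
  · rw [Finset.sum_eq_single N]
    · rw [monomial_pow, PowerSeries.coeff_monomial_same]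
    · intro n _ hn
      rw [monomial_pow, PowerSeries.coeff_monomial, if_neg (Ne.symm hn), smul_zero]
    · intro h
      exact absurd (Finset.mem_Icc.2 ⟨hN, le_rfl⟩) h

theorem logJac_sLow {Lam : T.Fn} (h : HasParity 0 Lam) :
    T.logJac (fun a => T.sLow a Lam) = (-2 : ℂ) • T.lnT (-((1 / 2 : ℂ) • T.sSq Lam)) := by
  rw [logJac_eq (hasParity_sLow h)]
  ext N
  change PowerSeries.coeff N _ = (-2 : ℂ) • PowerSeries.coeff N (T.lnT _)
  rw [map_neg, coeff_trLn, coeff_lnT, trace_m_sLow_pow, smul_comm, ← neg_smul]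

theorem s_one (a : Fin 2) : T.s a 1 = 0 := by
  simp only [s, rderiv_one, zero_mul, Finset.sum_const_zero]

theorem s_pow_eq_zero {a : Fin 2} {f : T.Fn} (h : T.s a f = 0) (n : ℕ) : T.s a (f ^ n) = 0 := by
  induction n with
  | zero => rw [pow_zero, s_one]
  | succ n ih => rw [pow_succ, s_mul, h, ih, mul_zero, zero_mul, add_zero]

theorem sT_logJac_sLow {Lam : T.Fn} (h : HasParity 0 Lam) (a : Fin 2) :
    T.sT a (T.logJac fun b => T.sLow b Lam) = 0 := by
  rw [logJac_eq (hasParity_sLow h)]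
  ext N
  rw [sT, PowerSeries.coeff_mk, map_neg, coeff_trLn, trace_m_sLow_pow, s_neg, s_smul, s_smul,
    s_pow_eq_zero, smul_zero, smul_zero, neg_zero, map_zero]
  rw [s_neg, s_smul, sSq_eq, s_smul, s_s_s, smul_zero, smul_zero, neg_zero]

/-! ### A variation which does not vanish -/

/-- The superfunctions at a point with vanishing odd coordinates. -/
def evalConst (x : Pt T.par) : T.Fn →ₐ[ℂ] Grass T.par η :=
  (ExteriorAlgebra.map (LinearMap.pi (Sum.elim (fun _ => 0)
    fun ζ => LinearMap.proj (Sum.inr ζ)))).comp (evalAt x)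

theorem evalConst_coord_even (x : Pt T.par) {A : FieldIx I 𝒜} (h : T.par A = 0) :
    T.evalConst x (coord η A) = algebraMap ℂ _ (x ⟨A, h⟩ : ℂ) := by
  rw [evalConst, AlgHom.comp_apply, coord, dif_pos h, evalAt_tmul, map_smul, map_one,
    ← Algebra.algebraMap_eq_smul_one]
  rfl

theorem evalConst_coord_odd (x : Pt T.par) {A : FieldIx I 𝒜} (h : T.par A ≠ 0) :
    T.evalConst x (coord η A) = 0 := by
  rw [evalConst, AlgHom.comp_apply, coord, dif_neg h, evalAt_tmul, map_smul,
    ExteriorAlgebra.map_apply_ι]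
  have : (LinearMap.pi (Sum.elim (fun _ => 0) fun ζ => LinearMap.proj (Sum.inr ζ)) :
      (OddIx T.par η → ℂ) →ₗ[ℂ] OddIx T.par η → ℂ) (Pi.single (Sum.inl ⟨A, h⟩) 1) = 0 := by
    ext k
    rcases k with k | k <;> simp
  rw [this, map_zero, smul_zero]

theorem evalConst_oddConst (x : Pt T.par) (ζ : η) :
    T.evalConst x (oddConst T.par ζ) = ExteriorAlgebra.ι ℂ (Pi.single (Sum.inr ζ) 1) := by
  rw [evalConst, AlgHom.comp_apply, oddConst, evalAt_tmul, map_smul,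
    ExteriorAlgebra.map_apply_ι]
  have : (LinearMap.pi (Sum.elim (fun _ => 0) fun ζ => LinearMap.proj (Sum.inr ζ)) :
      (OddIx T.par η → ℂ) →ₗ[ℂ] OddIx T.par η → ℂ) (Pi.single (Sum.inr ζ) 1)
      = Pi.single (Sum.inr ζ) 1 := by
    ext k
    rcases k with k | k <;> simp [Pi.single_apply]
  rw [this]
  exact one_smul ℂ _

theorem exists_sT_logJac_ne_zero {α : 𝒜} (hα : T.εA α = 0) (ζ : η) :
    ∃ lam : Fin 2 → T.Fn, (∀ a, HasParity 1 (lam a)) ∧ ¬ ∀ a, T.sT a (T.logJac lam) = 0 := by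
  classical
  have hC : ∀ a, HasParity 1 (T.ghost α a) := fun a =>
    (T.hasParity_ghost α a).of_eq (by rw [hα, zero_add])
  have hG : HasParity 0 (T.ghost α 0 * T.ghost α 1) := ((hC 0).mul (hC 1)).of_eq rfl
  -- The odd constant makes λ_1 odd while being annihilated by s^a. At first order ℑ = -tr m, so it
  -- suffices that s^2 s^1 (ζ C^1 C^2) contains ζ B².
  set lam : Fin 2 → T.Fn := ![oddConst T.par ζ * (T.ghost α 0 * T.ghost α 1), 0] with hl
  have hlam : ∀ a, HasParity 1 (lam a) := by
    intro a
    fin_cases a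
    · exact ((hasParity_oddConst ζ).mul hG).of_eq (add_zero 1)
    · exact .zero
  refine ⟨lam, hlam, fun hs => ?_⟩
  have h1 := congrArg (PowerSeries.coeff 1) (hs 1)
  have hζ : ∀ a, T.s a (oddConst T.par ζ) = 0 := fun a => by
    simp only [s, rderiv_oddConst, zero_mul, Finset.sum_const_zero]
  rw [sT, PowerSeries.coeff_mk, logJac_eq hlam, map_neg, coeff_trLn, s_neg, s_smul, pow_one,
    map_zero, Matrix.trace, Fin.sum_univ_two,
    show logCoeff 1 = 1 by simp [logCoeff], one_smul, neg_eq_zero] at h1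
  change T.s 1 (T.s 0 (oddConst T.par ζ * (T.ghost α 0 * T.ghost α 1)) + T.s 1 0) = 0 at h1
  rw [s_zero, add_zero, s_mul, hζ, zero_mul, add_zero, s_mul, hζ, zero_mul, add_zero] at h1
  have hpar : ∀ a, parityAut T.par η (T.ghost α a) = -T.ghost α a := fun a => by
    have := hC a
    rwa [HasParity, sgn_one, neg_smul, one_smul] at this
  have hsp : ∀ a b, parityAut T.par η (T.s a (T.ghost α b)) = T.s a (T.ghost α b) := fun a b => by
    rw [parityAut_s, hpar, s_neg, neg_neg]
  rw [s_mul, hpar, mul_neg, s_add, s_neg, s_mul, s_mul, hsp, hpar] at h1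
  -- At the point B^α = 1 with all other even coordinates zero (even ghosts included) and the odd
  -- fields dropped, s^2 s^1 (C^1 C^2) is a nonzero number and only ζ remains.
  set x : Pt T.par := fun i => if i.1 = Sum.inr (Sum.inr α) then 1 else 0 with hx
  have eC : ∀ γ c, T.evalConst x (T.ghost γ c) = 0 := by
    intro γ c
    by_cases h : T.par (Sum.inr (Sum.inl (γ, c))) = 0
    · rw [ghost, evalConst_coord_even x h, hx]
      simp
    · exact evalConst_coord_odd x h
  have eB : T.evalConst x (T.nl α) = 1 := by
    rw [nl, evalConst_coord_even x (A := Sum.inr (Sum.inr α)) hα, hx]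
    simp
  have eS : ∀ a b, T.evalConst x (T.s a (T.ghost α b)) = -(epsUp a b • 1) := by
    intro a b
    rw [show T.s a (T.ghost α b) = _ from T.s_coord a (Sum.inr (Sum.inl (α, b)))]
    change T.evalConst x (-(epsUp a b • T.nl α)
        - (1 / 2 : ℂ) • ∑ β, ∑ γ, (sgn (T.εA β) * T.F α β γ) • (T.ghost γ b * T.ghost β a)) = _
    simp only [map_sub, map_neg, map_smul, map_sum, map_mul, eC, eB, mul_zero, smul_zero,
      Finset.sum_const_zero, sub_zero]
  have h2 := congrArg (T.evalConst x) h1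
  simp only [map_mul, map_add, map_neg, map_zero, eC, eS, evalConst_oddConst, zero_mul, mul_zero,
    epsUp, Matrix.of_apply, Matrix.cons_val', Matrix.cons_val_zero, Matrix.cons_val_one,
    Matrix.cons_val_fin_one, zero_smul, one_smul, neg_smul, neg_zero, add_zero, zero_add, neg_neg,
    mul_neg, mul_one, neg_eq_zero, ExteriorAlgebra.ι_eq_zero_iff] at h2
  simpa using congrFun h2 (Sum.inr ζ)

end GaugeTheory

/-! ### Convergence in finite-dimensional algebras -/

section Summability

theorem norm_logCoeff_le (n : ℕ) : ‖logCoeff n‖ ≤ 1 := by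
  rw [logCoeff, norm_neg, norm_div, norm_pow, norm_neg, norm_one, one_pow, Complex.norm_natCast]
  rcases Nat.eq_zero_or_pos n with rfl | h
  · simp
  · exact div_le_one_of_le₀ (by exact_mod_cast h) (by positivity)

/-- A spectrum inside the open unit disc gives spectral radius below some r < 1; Gelfand's formula
then yields ‖M^n‖ ≤ r^n eventually. -/
theorem summable_norm_pow {B : Type*} [NormedRing B] [NormedAlgebra ℂ B] [FiniteDimensional ℂ B]
    (M : B) (h : ∀ z : ℂ, 1 ≤ ‖z‖ → IsUnit (algebraMap ℂ B z - M)) (L : B →ₗ[ℂ] ℂ) :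
    Summable fun n => ‖L (M ^ n)‖ := by
  have : CompleteSpace B := FiniteDimensional.complete ℂ B
  have hs : spectralRadius ℂ M < 1 := by
    rcases (spectrum ℂ M).eq_empty_or_nonempty with he | hne
    · rw [spectralRadius, he]; simp
    · refine spectrum.spectralRadius_lt_of_forall_lt_of_nonempty hne (r := 1) fun k hk => ?_
      by_contra hlt
      exact hk (h k (by have := not_lt.1 hlt; exact_mod_cast this))
  obtain ⟨r, hr, hr1⟩ := ENNReal.lt_iff_exists_nnreal_btwn.1 hs
  have hev := (spectrum.pow_nnnorm_pow_one_div_tendsto_nhds_spectralRadius M).eventually_lt_const hr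
  have hbound : ∀ᶠ n : ℕ in Filter.atTop, ‖M ^ n‖ ≤ (r : ℝ) ^ n := by
    filter_upwards [hev, Filter.eventually_gt_atTop 0] with n hn hn0
    have hn0' : (0 : ℝ) < n := by exact_mod_cast hn0
    have h1 : ((‖M ^ n‖₊ : ENNReal) ^ (1 / n : ℝ)) ^ (n : ℝ) ≤ (r : ENNReal) ^ (n : ℝ) :=
      ENNReal.rpow_le_rpow hn.le hn0'.le
    rw [← ENNReal.rpow_mul, one_div_mul_cancel hn0'.ne', ENNReal.rpow_one, ENNReal.rpow_natCast]
      at h1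
    exact_mod_cast h1
  have hr1' : (r : ℝ) < 1 := by exact_mod_cast hr1
  set L' := LinearMap.toContinuousLinearMap L
  have hsum : Summable fun n : ℕ => ‖L'‖ * (r : ℝ) ^ n :=
    (summable_geometric_of_lt_one r.2 hr1').mul_left _
  refine Summable.of_norm_bounded_eventually_nat hsum ?_
  filter_upwards [hbound] with n hn
  rw [norm_norm]
  exact (L'.le_opNorm (M ^ n)).trans (mul_le_mul_of_nonneg_left hn (norm_nonneg _))

/-- The left regular representation embeds R in a matrix algebra, which carries a complete norm; the
functional L is transported along a linear left inverse of the embedding. -/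
theorem summable_logCoeff_mul {R : Type*} [Ring R] [Algebra ℂ R] [Module.Finite ℂ R] (y : R)
    (h : ∀ z : ℂ, 1 ≤ ‖z‖ → IsUnit (algebraMap ℂ R z - y)) (L : R →ₗ[ℂ] ℂ) :
    Summable fun n => logCoeff n * L (y ^ n) := by
  classical
  set b := Module.finBasis ℂ R
  set φ := Algebra.leftMulMatrix b
  obtain ⟨g, hg⟩ := LinearMap.exists_leftInverse_of_injective φ.toLinearMap
    (LinearMap.ker_eq_bot.2 (Algebra.leftMulMatrix_injective b))
  have hφ : ∀ z : ℂ, 1 ≤ ‖z‖ → IsUnit (algebraMap ℂ (Matrix _ _ ℂ) z - φ y) := by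
    intro z hz
    have := (h z hz).map φ
    rwa [map_sub, AlgHom.commutes] at this
  have hLL : ∀ n, (L ∘ₗ g) (φ y ^ n) = L (y ^ n) := by
    intro n
    rw [← map_pow]
    exact congrArg L (LinearMap.congr_fun hg (y ^ n))
  have hsum : Summable fun n => ‖(L ∘ₗ g) (φ y ^ n)‖ := by
    let _ := Matrix.linftyOpNormedRing (n := Fin (Module.finrank ℂ R)) (α := ℂ)
    let _ := Matrix.linftyOpNormedAlgebra (n := Fin (Module.finrank ℂ R)) (R := ℂ) (α := ℂ)
    exact summable_norm_pow (φ y) hφ (L ∘ₗ g)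
  refine Summable.of_norm (Summable.of_nonneg_of_le (fun n => norm_nonneg _) (fun n => ?_) hsum)
  rw [hLL, norm_mul]
  exact mul_le_of_le_one_left (norm_nonneg _) (norm_logCoeff_le n)

end Summability

/-! ### Nilpotent parts of Grassmann-valued matrices -/

section Nilpotent

variable {Φ : Type*} [Fintype Φ] [DecidableEq Φ] {ε : Φ → ZMod 2} {η : Type*} [Fintype η]
  [DecidableEq η]

instance finite_grass : Module.Finite ℂ (Grass ε η) :=
  Module.Finite.of_basis (Module.finBasis ℂ (OddIx ε η → ℂ)).ExteriorAlgebra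

/-- The ideal of elements with vanishing numerical part. -/
def augIdeal (ε : Φ → ZMod 2) (η : Type*) : Submodule ℂ (Grass ε η) :=
  LinearMap.range (ExteriorAlgebra.ι ℂ) * ⊤

/-- Generators can be moved to the left past arbitrary elements at the cost of the parity
involution. Powers of the ideal thus lie in exterior powers times the algebra and eventually vanish.
-/
theorem augIdeal_pow_le (k : ℕ) :
    augIdeal ε η ^ k ≤ LinearMap.range (ExteriorAlgebra.ι ℂ) ^ k * ⊤ := by
  have hswap : (⊤ : Submodule ℂ (Grass ε η)) * LinearMap.range (ExteriorAlgebra.ι ℂ)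
      ≤ LinearMap.range (ExteriorAlgebra.ι ℂ) * ⊤ := by
    refine Submodule.mul_le.2 fun w _ v hv => ?_
    obtain ⟨v, rfl⟩ := hv
    have h := ι_mul_eq_involute_mul v (CliffordAlgebra.involute w)
    rw [CliffordAlgebra.involute_involute] at h
    rw [← h]
    exact Submodule.mul_mem_mul ⟨v, rfl⟩ trivial
  induction k with
  | zero =>
    rw [pow_zero, pow_zero, one_mul]
    exact le_top
  | succ k ih =>
    calc augIdeal ε η ^ (k + 1) = augIdeal ε η ^ k * augIdeal ε η := pow_succ _ _
      _ ≤ LinearMap.range (ExteriorAlgebra.ι ℂ) ^ k * ⊤ * augIdeal ε η := mul_le_mul_left ih _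
      _ = LinearMap.range (ExteriorAlgebra.ι ℂ) ^ k
          * (⊤ * LinearMap.range (ExteriorAlgebra.ι ℂ)) * ⊤ := by
        rw [augIdeal]; simp only [mul_assoc]
      _ ≤ LinearMap.range (ExteriorAlgebra.ι ℂ) ^ k
          * (LinearMap.range (ExteriorAlgebra.ι ℂ) * ⊤) * ⊤ :=
        mul_le_mul_left (mul_le_mul_right hswap _) _
      _ = LinearMap.range (ExteriorAlgebra.ι ℂ) ^ (k + 1) * (⊤ * ⊤) := by
        rw [pow_succ]; simp only [mul_assoc]
      _ ≤ LinearMap.range (ExteriorAlgebra.ι ℂ) ^ (k + 1) * ⊤ := mul_le_mul_right le_top _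

theorem exists_augIdeal_pow_eq_bot : ∃ k, augIdeal ε η ^ k = ⊥ := by
  refine ⟨Module.finrank ℂ (OddIx ε η → ℂ) + 1, ?_⟩
  have h : (LinearMap.range (ExteriorAlgebra.ι ℂ (M := OddIx ε η → ℂ)))
      ^ (Module.finrank ℂ (OddIx ε η → ℂ) + 1) = ⊥ := by
    rw [← Submodule.finrank_eq_zero (R := ℂ)]
    exact (exteriorPower.finrank_eq ℂ _).trans (Nat.choose_succ_self _)
  rw [eq_bot_iff]
  refine (augIdeal_pow_le _).trans ?_
  rw [h, Submodule.bot_mul]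

theorem sub_algebraMap_mem_augIdeal (w : Grass ε η) :
    w - algebraMap ℂ _ (ExteriorAlgebra.algebraMapInv w) ∈ augIdeal ε η := by
  have hmul : ∀ u ∈ augIdeal ε η, ∀ w, u * w ∈ augIdeal ε η := by
    intro u hu w
    have h := Submodule.mul_mem_mul hu (show w ∈ (⊤ : Submodule ℂ (Grass ε η)) from trivial)
    rw [augIdeal, mul_assoc] at h
    have hle : LinearMap.range (ExteriorAlgebra.ι ℂ (M := OddIx ε η → ℂ)) * (⊤ * ⊤) ≤ augIdeal ε η :=
      mul_le_mul_right le_top _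
    exact hle h
  induction w using ExteriorAlgebra.induction with
  | algebraMap r =>
    rw [AlgHom.commutes]
    simp
  | ι v =>
    have h := Submodule.mul_mem_mul (show ExteriorAlgebra.ι ℂ v
      ∈ LinearMap.range (ExteriorAlgebra.ι ℂ (M := OddIx ε η → ℂ)) from ⟨v, rfl⟩)
      (show (1 : Grass ε η) ∈ (⊤ : Submodule ℂ (Grass ε η)) from trivial)
    rw [mul_one] at h
    have e : ExteriorAlgebra.algebraMapInv (ExteriorAlgebra.ι ℂ v : Grass ε η) = 0 := by
      simp [ExteriorAlgebra.algebraMapInv]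
    rw [e, map_zero, sub_zero]
    exact h
  | mul a b ha hb =>
    have h : a * b - algebraMap ℂ _ (ExteriorAlgebra.algebraMapInv (a * b))
        = (a - algebraMap ℂ _ (ExteriorAlgebra.algebraMapInv a)) * b
          + (ExteriorAlgebra.algebraMapInv a) •
            (b - algebraMap ℂ _ (ExteriorAlgebra.algebraMapInv b)) := by
      rw [map_mul, map_mul, Algebra.smul_def]
      noncomm_ring
    rw [h]
    exact add_mem (hmul _ ha _) (Submodule.smul_mem _ _ hb)
  | add a b ha hb =>
    rw [map_add, map_add, add_sub_add_comm]
    exact add_mem ha hb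

variable {Ψ : Type*} [Fintype Ψ] [DecidableEq Ψ]

theorem isNilpotent_of_body_eq_zero {K : Matrix Ψ Ψ (Grass ε η)}
    (hK : ∀ A B, ExteriorAlgebra.algebraMapInv (K A B) = 0) : IsNilpotent K := by
  have h1 : ∀ A B, K A B ∈ augIdeal ε η := by
    intro A B
    have := sub_algebraMap_mem_augIdeal (K A B)
    rwa [hK, map_zero, sub_zero] at this
  have h2 : ∀ k A B, (K ^ k) A B ∈ augIdeal ε η ^ k := by
    intro k
    induction k with
    | zero =>
      intro A B
      rw [pow_zero, pow_zero, Matrix.one_apply]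
      split_ifs
      · exact Submodule.one_le.1 le_rfl
      · exact zero_mem _
    | succ k ih =>
      intro A B
      rw [pow_succ, pow_succ, Matrix.mul_apply]
      exact Submodule.sum_mem _ fun C _ => Submodule.mul_mem_mul (ih A C) (h1 C B)
  obtain ⟨k, hk⟩ := exists_augIdeal_pow_eq_bot (ε := ε) (η := η)
  refine ⟨k, ?_⟩
  ext A B
  have := h2 k A B
  rw [hk] at this
  exact (Submodule.mem_bot ℂ).1 this

/-- A Grassmann-valued matrix is invertible if its numerical part is. -/
theorem isUnit_of_isUnit_body {M : Matrix Ψ Ψ (Grass ε η)}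
    (hM : IsUnit (M.map (ExteriorAlgebra.algebraMapInv : Grass ε η → ℂ))) : IsUnit M := by
  set β : Matrix Ψ Ψ (Grass ε η) →ₐ[ℂ] Matrix Ψ Ψ ℂ :=
    (ExteriorAlgebra.algebraMapInv : Grass ε η →ₐ[ℂ] ℂ).mapMatrix with hβ
  set κ : Matrix Ψ Ψ ℂ →ₐ[ℂ] Matrix Ψ Ψ (Grass ε η) := (Algebra.ofId ℂ (Grass ε η)).mapMatrix with hκ
  have hβκ : ∀ N, β (κ N) = N := by
    intro N
    ext A B
    exact ExteriorAlgebra.algebraMap_leftInverse _ _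
  obtain ⟨u, hu⟩ := hM
  have hu' : β M = u := hu.symm
  -- Multiplying by the inverse of the numerical part leaves 1 plus a matrix with zero numerical
  -- part, which is nilpotent.
  have h1 : IsNilpotent (κ ↑u⁻¹ * M - 1) := by
    refine isNilpotent_of_body_eq_zero fun A B => ?_
    change β (κ ↑u⁻¹ * M - 1) A B = 0
    rw [map_sub, map_mul, hβκ, hu', map_one, Units.inv_mul, sub_self, Matrix.zero_apply]
  have h2 := h1.isUnit_one_add
  rw [add_sub_cancel] at h2
  have h3 : IsUnit (κ (u : Matrix Ψ Ψ ℂ)) := u.isUnit.map κ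
  have h4 := h3.mul h2
  rwa [← mul_assoc, ← map_mul, Units.mul_inv, map_one, one_mul] at h4

theorem exists_grassHasSum {u : ℕ → Grass ε η}
    (h : ∀ ℓ : Module.Dual ℂ (Grass ε η), Summable fun n => ℓ (u n)) : ∃ J, GrassHasSum u J := by
  set b := Module.finBasis ℂ (Grass ε η)
  set J := ∑ i, (∑' n, b.coord i (u n)) • b i with hJ
  refine ⟨J, fun ℓ => ?_⟩
  have h1 : ∀ w, ℓ w = ∑ i, b.coord i w * ℓ (b i) := by
    intro w
    calc ℓ w = ℓ (∑ i, b.repr w i • b i) := by rw [b.sum_repr]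
      _ = _ := by rw [map_sum]; simp only [map_smul, smul_eq_mul, Module.Basis.coord_apply]
  have h2 : ∀ i, b.coord i J = ∑' n, b.coord i (u n) := by
    intro i
    simp [hJ, Finsupp.single_apply]
  rw [show (fun n => ℓ (u n)) = fun n => ∑ i, b.coord i (u n) * ℓ (b i) from
    funext fun n => h1 (u n), h1 J]
  refine hasSum_sum fun i _ => ?_
  rw [h2]
  exact (h (b.coord i)).hasSum.mul_right _

end Nilpotent

/-! ### Words in two letters -/

section Words

variable {R : Type*} [Ring R]

/-- The parts of `(x + y)^n` with zero, one and two factors `y`. -/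
def words (x y : R) : ℕ → R × R × R
  | 0 => (1, 0, 0)
  | n + 1 => ((words x y n).1 * x, (words x y n).1 * y + (words x y n).2.1 * x,
      (words x y n).2.1 * y + (words x y n).2.2 * x)

/-- Arbitrary letters are allowed between the factors y, since the induction inserts further factors
x there. -/
theorem words_mul_eq_zero {x y : R} (hy : ∀ a b, y * a * y * b * y = 0) (n : ℕ) :
    (∀ w, (words x y n).2.2 * w * y = 0) ∧ ∀ w w', (words x y n).2.1 * w * y * w' * y = 0 := by
  induction n with
  | zero => simp [words]
  | succ n ih =>
    obtain ⟨h1, h2⟩ := ih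
    refine ⟨fun w => ?_, fun w w' => ?_⟩
    · have e1 := h2 1 w
      have e2 := h1 (x * w)
      rw [mul_one] at e1
      simp only [words, add_mul, ← mul_assoc] at *
      rw [e1, e2, add_zero]
    · have e1 := hy w w'
      have e2 := h2 (x * w) w'
      simp only [words, add_mul]
      rw [show (words x y n).1 * y * w * y * w' * y = (words x y n).1 * (y * w * y * w' * y) by
        simp only [mul_assoc], e1, mul_zero, zero_add]
      simpa only [mul_assoc] using e2

theorem add_smul_pow [Algebra ℂ R] {x y : R} (hy : ∀ a b, y * a * y * b * y = 0) (u : ℂ) (n : ℕ) :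
    (x + u • y) ^ n
      = (words x y n).1 + u • (words x y n).2.1 + (u * u) • (words x y n).2.2 := by
  induction n with
  | zero => simp [words]
  | succ n ih =>
    have h := (words_mul_eq_zero (x := x) hy n).1 1
    rw [mul_one] at h
    rw [pow_succ, ih]
    simp only [words, add_mul, mul_add, smul_add, smul_mul_assoc, mul_smul_comm, smul_smul, h,
      smul_zero, add_zero]
    abel

open PowerSeries in
theorem monomial_add_monomial_pow {x y : R} (hy : ∀ a b, y * a * y * b * y = 0) (n : ℕ) :
    (monomial 1 x + monomial 2 y) ^ n = monomial n (words x y n).1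
      + monomial (n + 1) (words x y n).2.1 + monomial (n + 2) (words x y n).2.2 := by
  induction n with
  | zero => simp [words]
  | succ n ih =>
    have h := (words_mul_eq_zero (x := x) hy n).1 1
    rw [mul_one] at h
    rw [pow_succ, ih]
    simp only [words, add_mul, mul_add, monomial_mul_monomial, h, map_add, map_zero, add_zero,
      add_assoc, Nat.reduceAdd]
    abel

end Words

/-! ### Summation of the expansion -/

section Resummation

open PowerSeries

variable {R : Type*} [Ring R] [Algebra ℂ R]

theorem logCoeff_zero : logCoeff 0 = 0 := by simp [logCoeff]

theorem hasSum_shift {a b : ℕ → ℂ} {S : ℂ} (k : ℕ) (h : HasSum a S) (hb : ∀ n, b (n + k) = a n)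
    (h0 : ∀ n < k, b n = 0) : HasSum b S := by
  have h1 : HasSum (fun n => b (n + k)) S := by simpa only [hb] using h
  have h2 := (hasSum_nat_add_iff k).1 h1
  rwa [Finset.sum_eq_zero fun n hn => h0 n (Finset.mem_range.1 hn), add_zero] at h2

theorem sum_Icc_logCoeff (f : ℕ → R) (g : R →ₗ[ℂ] ℂ) (j N : ℕ) :
    ∑ n ∈ Finset.Icc 1 N, logCoeff n * g (coeff N (monomial (n + j) (f n)))
      = if j ≤ N then logCoeff (N - j) * g (f (N - j)) else 0 := by
  have h : ∀ n, logCoeff n * g (coeff N (monomial (n + j) (f n)))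
      = if N = n + j then logCoeff n * g (f n) else 0 := by
    intro n
    rw [coeff_monomial]
    split_ifs <;> simp
  simp only [h]
  split_ifs with hj
  · rcases Nat.eq_zero_or_pos (N - j) with h0 | h0
    · rw [h0, logCoeff_zero, zero_mul]
      refine Finset.sum_eq_zero fun n hn => if_neg ?_
      rw [Finset.mem_Icc] at hn
      omega
    · rw [Finset.sum_eq_single (N - j), if_pos (by omega)]
      · intro n _ hn
        exact if_neg (by omega)
      · intro hn
        rw [Finset.mem_Icc] at hn
        omega
  · exact Finset.sum_eq_zero fun n _ => if_neg (by omega)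

/-- If words with three factors `y` vanish, then the series of `ln (1 + x + y)` may be reordered by
the degree in `t` after `x → t x`, `y → t² y`. -/
theorem hasSum_formalLog {x y : R} (hy : ∀ a b, y * a * y * b * y = 0) (g : R →ₗ[ℂ] ℂ)
    (h : ∀ u : ℂ, Summable fun n => logCoeff n * g ((x + u • y) ^ n)) :
    HasSum (fun N => ∑ n ∈ Finset.Icc 1 N,
        logCoeff n * g (coeff N ((monomial 1 x + monomial 2 y) ^ n)))
      (∑' n, logCoeff n * g ((x + y) ^ n)) := by
  set a₀ : ℕ → ℂ := fun n => logCoeff n * g (words x y n).1 with ha₀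
  set a₁ : ℕ → ℂ := fun n => logCoeff n * g (words x y n).2.1 with ha₁
  set a₂ : ℕ → ℂ := fun n => logCoeff n * g (words x y n).2.2 with ha₂
  have he : ∀ (u : ℂ) n, logCoeff n * g ((x + u • y) ^ n) = a₀ n + u * a₁ n + u * u * a₂ n := by
    intro u n
    rw [add_smul_pow hy, map_add, map_add, map_smul, map_smul, smul_eq_mul, smul_eq_mul, ha₀, ha₁,
      ha₂]
    ring
  simp only [he] at h
  -- The terms are quadratic polynomials in u, so summability at u = 0, 1, -1 separates the three
  -- coefficient series.
  have s₀ : Summable a₀ := by simpa using h 0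
  have s₁ : Summable a₁ :=
    (((h 1).sub (h (-1))).mul_left (1 / 2)).congr fun n => by ring
  have s₂ : Summable a₂ :=
    ((((h 1).add (h (-1))).mul_left (1 / 2)).sub s₀).congr fun n => by ring
  have htot : ∑' n, logCoeff n * g ((x + y) ^ n) = ∑' n, a₀ n + ∑' n, a₁ n + ∑' n, a₂ n := by
    rw [← s₀.tsum_add s₁, ← (s₀.add s₁).tsum_add s₂]
    refine tsum_congr fun n => ?_
    have := he 1 n
    rwa [one_smul, one_mul, one_mul, one_mul] at this
  rw [htot]
  -- A word of length n with j letters y has degree n + j in t, so the regrouped series is a sum of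
  -- three shifted copies.
  have hF : (fun N => ∑ n ∈ Finset.Icc 1 N,
        logCoeff n * g (coeff N ((monomial 1 x + monomial 2 y) ^ n)))
      = fun N => (if 0 ≤ N then a₀ (N - 0) else 0) + (if 1 ≤ N then a₁ (N - 1) else 0)
        + (if 2 ≤ N then a₂ (N - 2) else 0) := by
    funext N
    simp only [monomial_add_monomial_pow hy, map_add, mul_add, Finset.sum_add_distrib]
    congr 1
    · congr 1
      · exact sum_Icc_logCoeff (fun n => (words x y n).1) g 0 N
      · exact sum_Icc_logCoeff (fun n => (words x y n).2.1) g 1 N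
    · exact sum_Icc_logCoeff (fun n => (words x y n).2.2) g 2 N
  rw [hF]
  have hshift : ∀ {a : ℕ → ℂ} (j : ℕ), Summable a →
      HasSum (fun N => if j ≤ N then a (N - j) else 0) (∑' n, a n) := fun {a} j ha =>
    hasSum_shift j ha.hasSum (fun n => by simp) fun n hn => if_neg (by omega)
  exact ((hshift 0 s₀).add (hshift 1 s₁)).add (hshift 2 s₂)

end Resummation

/-! ### Numerical parts -/

section Body

variable {Φ : Type*} [Fintype Φ] [DecidableEq Φ] {ε : Φ → ZMod 2} {η : Type*} [DecidableEq η]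

/-- The numerical part at a point as a homomorphism. -/
def bodyHom (η : Type*) [DecidableEq η] (x : Pt ε) : SuperFn ε η →ₐ[ℂ] ℂ :=
  (ExteriorAlgebra.algebraMapInv : Grass ε η →ₐ[ℂ] ℂ).comp (evalAt x)

theorem algebraMap_sub_eq_smul {n : Type*} [Fintype n] [DecidableEq n] {z : ℂ} (hz : z ≠ 0)
    (N : Matrix n n ℂ) : algebraMap ℂ _ z - N = z • (1 - z⁻¹ • N) := by
  rw [smul_sub, smul_smul, mul_inv_cancel₀ hz, one_smul, Algebra.algebraMap_eq_smul_one]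

theorem evalAt_str {Ψ : Type*} [Fintype Ψ] [DecidableEq Ψ] (x : Pt ε) (εΨ : Ψ → ZMod 2)
    (M : Matrix Ψ Ψ (SuperFn ε η)) :
    evalAt x (str εΨ M) = str εΨ ((evalAt x).mapMatrix M) := by
  rw [str, str, map_sum]
  exact Finset.sum_congr rfl fun A _ => map_smul _ _ _

end Body

/-! ### Pointwise convergence of Str ln(1 + M) and its agreement with the expansion. -/

namespace GaugeTheory

variable {I 𝒜 η : Type*} [Fintype I] [Fintype 𝒜] [DecidableEq I] [DecidableEq 𝒜]
  [DecidableEq η] {T : GaugeTheory I 𝒜 η} {lam : Fin 2 → T.Fn}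

/-- Each λ_a squares to zero and ℂ has no nilpotents. -/
theorem bodyHom_lamIdeal (hlam : ∀ a, HasParity 1 (lam a)) (x : Pt T.par) {f : T.Fn}
    (hf : f ∈ lamIdeal lam) : bodyHom η x f = 0 := by
  have h : ∀ a, bodyHom η x (lam a) = 0 := by
    intro a
    have := congrArg (bodyHom η x) (lam_mul_self hlam a)
    rwa [map_mul, map_zero, mul_self_eq_zero] at this
  obtain ⟨a, b, rfl⟩ := Submodule.mem_span_pair.1 hf
  rw [smul_eq_mul, smul_eq_mul, map_add, map_mul, map_mul, h, h, mul_zero, mul_zero, add_zero]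

theorem matR_add_matQ_mul_matP_mem (hlam : ∀ a, HasParity 1 (lam a)) (A B : FieldIx I 𝒜) :
    (T.matR lam + T.matQ lam * T.matP lam) A B ∈ lamIdeal lam :=
  add_mem (lamSqIdeal_le (matR_mem_lamSqIdeal A B)) <| Submodule.sum_mem _ fun C _ =>
    mul_mem_lamIdeal_left hlam (matQ_mem_lamIdeal A C) _

theorem mul_eq_zero_of_mem_lamIdeal (hlam : ∀ a, HasParity 1 (lam a))
    {N : Matrix (FieldIx I 𝒜) (FieldIx I 𝒜) T.Fn} (hN : ∀ A B, N A B ∈ lamIdeal lam)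
    (a b : Matrix (FieldIx I 𝒜) (FieldIx I 𝒜) T.Fn) : N * a * N * b * N = 0 := by
  ext A B
  have h1 : ∀ (c : Matrix (FieldIx I 𝒜) (FieldIx I 𝒜) T.Fn) (A B : FieldIx I 𝒜), (N * c) A B ∈ lamIdeal lam := fun c A B =>
    Submodule.sum_mem _ fun C _ => mul_mem_lamIdeal_left hlam (hN A C) _
  rw [show N * a * N * b * N = N * a * (N * b) * N by simp only [mul_assoc]]
  exact Finset.sum_eq_zero fun C _ => lamSqIdeal_mul_lamIdeal hlam
    (Submodule.sum_mem _ fun D _ => mul_mem_lamSqIdeal hlam (h1 a A D) (h1 b D C)) (hN C B)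

theorem jac_eq (hlam : ∀ a, HasParity 1 (lam a)) :
    T.jac lam = T.matP lam + T.matQ lam + (T.matR lam + T.matQ lam * T.matP lam) := by
  ext A B
  rw [jac, Matrix.of_apply, shift, map_add, rderiv_shift₁ hlam, rderiv_shift₂ hlam]
  rfl

open PowerSeries in
theorem sum_logCoeff_strEven (hlam : ∀ a, HasParity 1 (lam a)) (f : T.Fn →ₗ[ℂ] ℂ) (N : ℕ) :
    ∑ n ∈ Finset.Icc 1 N, logCoeff n * f (strEven T.par η T.par (coeff N
      ((monomial 1 (⟨_, matP_mem hlam⟩ + ⟨_, matQ_mem hlam⟩)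
        + monomial 2 (⟨_, matR_mem hlam⟩ + ⟨_, matQ_mem hlam⟩ * ⟨_, matP_mem hlam⟩)) ^ n)))
      = -(logCoeff N * f (T.m lam ^ N).trace) := by
  rw [← smul_eq_mul (logCoeff N), ← map_smul, ← coeff_trLn, ← map_neg, ← map_neg,
    ← logJac_eq hlam, logJac, coeff_formalLogSum, map_sum]
  refine Finset.sum_congr rfl fun n _ => ?_
  rw [jacT_eq hlam, ← matSeries_pow, coeff_str_matSeries, map_smul]
  rfl

variable [Fintype η]

/-- Numerically only P = XL survives, and det(1 - z⁻¹XL) = det(1 - z⁻¹LX) with LX the transpose of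
m, so the spectral condition on the 2×2 matrix controls the large one. -/
theorem isUnit_algebraMap_sub (hlam : ∀ a, HasParity 1 (lam a)) {x : Pt T.par}
    (hx : ∀ μ ∈ spectrum ℂ ((T.m lam).map (bodyAt x)), ‖μ‖ < 1)
    {K : Matrix (FieldIx I 𝒜) (FieldIx I 𝒜) T.Fn} (hK : ∀ A B, K A B ∈ lamIdeal lam) {z : ℂ}
    (hz : 1 ≤ ‖z‖) :
    IsUnit (algebraMap ℂ _ z - (evalAt x).mapMatrix (T.matP lam + K)) := by
  apply isUnit_of_isUnit_body
  have hz0 : z ≠ 0 := by rintro rfl; norm_num at hz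
  set bX := T.matX.map (bodyHom η x) with hbX
  set bL := (T.matDLam lam).map (bodyHom η x) with hbL
  set bm := (T.m lam).map (bodyHom η x) with hbm
  have h1 : (algebraMap ℂ (Matrix _ _ (Grass T.par η)) z
      - (evalAt x).mapMatrix (T.matP lam + K)).map
        (ExteriorAlgebra.algebraMapInv : Grass T.par η → ℂ)
      = algebraMap ℂ _ z - bX * bL := by
    have hb : (bodyHom η x).mapMatrix (T.matP lam + K) = bX * bL := by
      rw [map_add, hbX, hbL, ← Matrix.map_mul]
      have : (bodyHom η x).mapMatrix K = 0 := by
        ext A B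
        exact bodyHom_lamIdeal hlam x (hK A B)
      rw [this, add_zero]
      rfl
    rw [← hb]
    change (ExteriorAlgebra.algebraMapInv : Grass T.par η →ₐ[ℂ] ℂ).mapMatrix _ = _
    rw [map_sub, AlgHom.commutes]
    rfl
  have h2 : bL * bX = bm.transpose := by
    rw [hbX, hbL, ← Matrix.map_mul, matDLam_mul_matX]
    rfl
  have h3 : IsUnit (algebraMap ℂ (Matrix (Fin 2) (Fin 2) ℂ) z - bm) := by
    by_contra hn
    exact absurd (hx z hn) (not_lt.2 hz)
  rw [h1]
  rw [Matrix.isUnit_iff_isUnit_det, isUnit_iff_ne_zero, algebraMap_sub_eq_smul hz0,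
    Matrix.det_smul] at h3 ⊢
  have h4 := right_ne_zero_of_mul h3
  refine mul_ne_zero (pow_ne_zero _ hz0) ?_
  rw [← Matrix.smul_mul, Matrix.det_one_sub_mul_comm, Matrix.mul_smul, h2, ← Matrix.transpose_smul,
    ← Matrix.transpose_one, ← Matrix.transpose_sub, Matrix.det_transpose]
  exact h4

/-- Convergence of `Str ln (𝕀 + P + K)` for `K` of first order in the undifferentiated parameters. -/
theorem summable_logCoeff_str (hlam : ∀ a, HasParity 1 (lam a)) {x : Pt T.par}
    (hx : ∀ μ ∈ spectrum ℂ ((T.m lam).map (bodyAt x)), ‖μ‖ < 1)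
    {K : Matrix (FieldIx I 𝒜) (FieldIx I 𝒜) T.Fn} (hK : ∀ A B, K A B ∈ lamIdeal lam)
    (ℓ : Module.Dual ℂ (Grass T.par η)) :
    Summable fun n => logCoeff n * ℓ (evalAt x (str T.par ((T.matP lam + K) ^ n))) := by
  refine (summable_logCoeff_mul ((evalAt x).mapMatrix (T.matP lam + K))
    (fun z hz => isUnit_algebraMap_sub hlam hx hK hz)
    (ℓ ∘ₗ strLin T.par (Grass T.par η))).congr fun n => ?_
  rw [← map_pow, evalAt_str]
  rfl

theorem smul_mem_lamIdeal (u : ℂ) {f : T.Fn} (hf : f ∈ lamIdeal lam) : u • f ∈ lamIdeal lam := by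
  rw [← one_mul f, ← smul_mul_assoc]
  exact Submodule.smul_mem _ _ hf

set_option maxHeartbeats 800000 in
theorem exists_hasStrLn (hlam : ∀ a, HasParity 1 (lam a)) {x : Pt T.par}
    (hx : ∀ μ ∈ spectrum ℂ ((T.m lam).map (bodyAt x)), ‖μ‖ < 1) :
    ∃ J : Grass T.par η, HasStrLn x (T.jac lam) J ∧ HasTrLn x (T.m lam) (-J) := by
  set p : evenMat T.par η T.par := ⟨_, matP_mem hlam⟩ + ⟨_, matQ_mem hlam⟩ with hp
  set y : evenMat T.par η T.par :=
    ⟨_, matR_mem hlam⟩ + ⟨_, matQ_mem hlam⟩ * ⟨_, matP_mem hlam⟩ with hyd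
  have hyL : ∀ A B, y.1 A B ∈ lamIdeal lam := matR_add_matQ_mul_matP_mem hlam
  have hy : ∀ a b, y * a * y * b * y = 0 := fun a b =>
    Subtype.ext (mul_eq_zero_of_mem_lamIdeal hlam hyL a.1 b.1)
  have hjac : ∀ n, T.jac lam ^ n = ((p + y) ^ n).1 := by
    intro n
    rw [jac_eq hlam]
    rfl
  let g (ℓ : Module.Dual ℂ (Grass T.par η)) : evenMat T.par η T.par →ₗ[ℂ] ℂ :=
    ℓ ∘ₗ (evalAt x).toLinearMap ∘ₗ strEven T.par η T.par
  -- Rescaling y by any u changes only terms in the ideal of the parameters, hence not the numerical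
  -- part; this provides the values of u used to split the series.
  have hsum : ∀ ℓ (u : ℂ), Summable fun n => logCoeff n * g ℓ ((p + u • y) ^ n) := by
    intro ℓ u
    refine (summable_logCoeff_str hlam hx (K := T.matQ lam + u • y.1)
      (fun A B => add_mem (matQ_mem_lamIdeal A B) (smul_mem_lamIdeal u (hyL A B))) ℓ).congr
      fun n => ?_
    rw [← add_assoc]
    rfl
  have hsum1 : ∀ ℓ, Summable fun n => logCoeff n * g ℓ ((p + y) ^ n) := fun ℓ => by
    simpa only [one_smul] using hsum ℓ 1
  have hterm : ∀ (ℓ : Module.Dual ℂ (Grass T.par η)) n,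
      ℓ (logCoeff n • evalAt x (str T.par (T.jac lam ^ n))) = logCoeff n * g ℓ ((p + y) ^ n) := by
    intro ℓ n
    rw [map_smul, smul_eq_mul, hjac]
    rfl
  obtain ⟨J, hJ⟩ := exists_grassHasSum
    (u := fun n => logCoeff (n + 1) • evalAt x (str T.par (T.jac lam ^ (n + 1)))) fun ℓ => by
      simp only [hterm]
      exact (summable_nat_add_iff 1).2 (hsum1 ℓ)
  refine ⟨J, hJ, fun ℓ => ?_⟩
  have hJ' : ℓ J = ∑' n, logCoeff n * g ℓ ((p + y) ^ n) := by
    rw [(hsum1 ℓ).tsum_eq_zero_add, logCoeff_zero, zero_mul, zero_add]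
    have := (hJ ℓ).tsum_eq
    simp only [hterm] at this
    exact this.symm
  have hF := hasSum_formalLog hy (g ℓ) (hsum ℓ)
  -- Degree by degree in λ the regrouped series is known from the formal identity.
  have hN : ∀ N, ∑ n ∈ Finset.Icc 1 N, logCoeff n * g ℓ (PowerSeries.coeff N
      ((PowerSeries.monomial 1 p + PowerSeries.monomial 2 y) ^ n))
        = -(logCoeff N * ℓ (evalAt x (T.m lam ^ N).trace)) :=
    fun N => sum_logCoeff_strEven hlam (ℓ ∘ₗ (evalAt x).toLinearMap) N
  rw [funext hN, ← hJ'] at hF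
  have hF' := hF.neg
  simp only [neg_neg] at hF'
  -- The term n = 0 is present but zero, so the index may be shifted to start at 1.
  rw [← hasSum_nat_add_iff' 1, Finset.sum_range_one, logCoeff_zero, zero_mul, sub_zero,
    ← map_neg] at hF'
  simpa only [map_smul, smul_eq_mul] using hF'

theorem exists_hasLn_sLow {Lam : T.Fn} (h : HasParity 0 Lam) {x : Pt T.par}
    (hx : ‖bodyAt x ((1 / 2 : ℂ) • T.sSq Lam)‖ < 1) :
    ∃ L : Grass T.par η, HasLn x (-((1 / 2 : ℂ) • T.sSq Lam)) L ∧
      HasStrLn x (T.jac fun a => T.sLow a Lam) ((-2 : ℂ) • L) := by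
  obtain ⟨J, hJ, hm⟩ := exists_hasStrLn (hasParity_sLow h) (x := x) fun μ hμ => by
    have hd : (T.m fun a => T.sLow a Lam).map (bodyAt x)
        = algebraMap ℂ _ (-bodyAt x ((1 / 2 : ℂ) • T.sSq Lam)) := by
      rw [m_sLow]
      change (bodyHom η x).mapMatrix _ = algebraMap ℂ _ (-bodyHom η x _)
      ext a b
      rw [AlgHom.mapMatrix_apply, Matrix.map_apply, Matrix.diagonal_apply,
        Matrix.algebraMap_matrix_apply]
      split_ifs
      · rw [map_neg]; rfl
      · rw [map_zero]
    rw [hd, spectrum.scalar_eq, Set.mem_singleton_iff] at hμ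
    rwa [hμ, norm_neg]
  -- Since m is scalar, its 2×2 trace doubles each power: -J = 2L.
  refine ⟨-((1 / 2 : ℂ) • J), fun ℓ => ?_, ?_⟩
  · have h1 := (hm ℓ).mul_left (1 / 2)
    have e : ℓ (-((1 / 2 : ℂ) • J)) = 1 / 2 * ℓ (-J) := by
      rw [← smul_neg, map_smul, smul_eq_mul]
    rw [e]
    have e' : ∀ n, ℓ (logCoeff (n + 1) • evalAt x ((-((1 / 2 : ℂ) • T.sSq Lam)) ^ (n + 1)))
        = 1 / 2 * ℓ (logCoeff (n + 1) • evalAt x ((T.m fun a => T.sLow a Lam) ^ (n + 1)).trace) := by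
      intro n
      rw [trace_m_sLow_pow, map_smul (evalAt x), smul_comm, map_smul ℓ (2 : ℂ), smul_eq_mul,
        ← mul_assoc]
      norm_num
    exact (funext e') ▸ h1
  · rw [smul_neg, smul_smul]
    norm_num
    exact hJ

end GaugeTheory

end BRST

end

theorem mainTheorem1 {I 𝒜 η : Type*} [Fintype I] [Fintype 𝒜] [Fintype η]
    [DecidableEq I] [DecidableEq 𝒜] [DecidableEq η] (T : GaugeTheory I 𝒜 η) :
    (∀ lam : Fin 2 → T.Fn, (∀ a, HasParity 1 (lam a)) →
      -- `ℑ = - tr ln (e + m)` as an identity of expansions in powers of the parameters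
      T.logJac lam = -T.trLn lam ∧
      -- `ℑ = - tr ln (e + m)` as an identity of convergent series
      (∀ x : Pt T.par, (∀ μ ∈ spectrum ℂ ((T.m lam).map (bodyAt x)), ‖μ‖ < 1) →
        ∃ J : Grass T.par η, HasStrLn x (T.jac lam) J ∧ HasTrLn x (T.m lam) (-J)) ∧
      -- the BRST-antiBRST variation of `ℑ`
      IsUnit (1 + T.mT lam) ∧
      (∀ a, T.sT a (T.logJac lam) =
        -∑ b, ∑ c, T.sT a (T.mT lam b c) * Ring.inverse (1 + T.mT lam) c b)) ∧
    -- the reduction to the invariant `ln (1 - s²Λ/2)^{-2}` for `λ_a = s_a Λ`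
    (∀ Lam : T.Fn, HasParity 0 Lam →
      (∀ a, HasParity 1 (T.sLow a Lam)) ∧
      T.m (fun a => T.sLow a Lam) = Matrix.diagonal (fun _ => -((1 / 2 : ℂ) • T.sSq Lam)) ∧
      T.logJac (fun a => T.sLow a Lam) = (-2 : ℂ) • T.lnT (-((1 / 2 : ℂ) • T.sSq Lam)) ∧
      (∀ a, T.sT a (T.logJac fun b => T.sLow b Lam) = 0) ∧
      (∀ x : Pt T.par, ‖bodyAt x ((1 / 2 : ℂ) • T.sSq Lam)‖ < 1 →
        ∃ L : Grass T.par η, HasLn x (-((1 / 2 : ℂ) • T.sSq Lam)) L ∧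
          HasStrLn x (T.jac fun a => T.sLow a Lam) ((-2 : ℂ) • L))) ∧
    -- `ℑ` is not invariant in general
    ((∃ α, T.εA α = 0) → Nonempty η →
      ∃ lam : Fin 2 → T.Fn, (∀ a, HasParity 1 (lam a)) ∧
        ¬ ∀ a, T.sT a (T.logJac lam) = 0) := by
  refine ⟨fun lam hlam => ⟨GaugeTheory.logJac_eq hlam, fun x hx => GaugeTheory.exists_hasStrLn hlam hx,
    (GaugeTheory.unitMT hlam).isUnit, GaugeTheory.sT_logJac hlam⟩, fun Lam h =>
    ⟨GaugeTheory.hasParity_sLow h, GaugeTheory.m_sLow Lam, GaugeTheory.logJac_sLow h,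
      GaugeTheory.sT_logJac_sLow h, fun x hx => GaugeTheory.exists_hasLn_sLow h hx⟩, ?_⟩
  rintro ⟨α, hα⟩ ⟨ζ⟩
  exact GaugeTheory.exists_sT_logJac_ne_zero hα ζ
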